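/- Let $n,m\ge 1$ be integers, let $\alpha>0$, and let $\widetilde\mu_n=(2\pi)^{-n/2}\mu_n$, where $\mu_n$ is the Lebesgue measure on $\mathbb R^n$; on $\mathbb R^{2n}=\mathbb R^n\times\mathbb R^n$ put $\widetilde\mu_{2n}=\widetilde\mu_n\times\widetilde\mu_n$. Write $\langle z,w\rangle=\sum_{r=1}^n z_r\overline{w_r}$. A smooth function $f\colon\mathbb C^n\to\mathbb C$ is called $m$-analytic if $\overline D^k f=0$ (iterated Wirtinger derivatives $\partial/\partial\overline z_r$) for every multi-index $k\in\mathbb N_0^n$ with $|k|=m$. Let $\mathcal F_{\alpha,m}$ be the space of all $m$-analytic functions that are square integrable with respect to $\frac{\alpha^n}{\pi^n}e^{-\alpha|z|^2}\,d\mu_{2n}(z)$, with the norm of this $L^2$ space. Put $$(Uf)(x,y)=2^{n/2}e^{-\frac12|x|^2-\frac12|y|^2-i\langle x,y\rangle}f\Bigl(\tfrac{x+iy}{\sqrt\alpha}\Bigr)\qquad(x,y\in\mathbb R^n),$$ and let $\mathcal H_m=U(\mathcal F_{\alpha,m})\subset L^2(\mathbb R^{2n},\widetilde\mu_{2n})$.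 For $a\in\mathbb R^n$ define the horizontal Weyl operators $(\rho_{\mathcal F_{\alpha,m}}(a)f)(z)=f(z-a)e^{\alpha\langle z,a\rangle-\frac\alpha2|a|^2}$ on $\mathcal F_{\alpha,m}$ and the horizontal translations $(\rho_{\mathcal H_m}(a)g)(x,y)=g(x-a,y)$ on $\mathcal H_m$. For a family $\rho$ of bounded operators on a Hilbert space, $\mathcal C(\rho)$ denotes its commutant, the set of all bounded operators that commute with every $\rho(a)$. Let $d$ be the number of multi-indices $k\in\mathbb N_0^n$ with $|k|\le m-1$, and let $\phi(1),\dots,\phi(d)$ be these multi-indices in the lexicographic order. Let $\psi_j(t)=(2^j j!\sqrt\pi)^{-1/2}e^{-t^2/2}H_j(t)$ be the Hermite functions ($H_j$ the physicist's Hermite polynomials) and $$q_{k,\xi}(v)=2^{n/2}\pi^{n/4}\prod_{r=1}^n\psi_{k_r}\Bigl(\frac{\xi_r+2v_r}{\sqrt2}\Bigr).$$ Let $F\otimes I$ be the Fourier--Plancherel transform on $L^2(\mathbb R^{2n},\widetilde\mu_{2n})$ in the first variable $x\in\mathbb R^n$, with the kernel $(2\pi)^{-n/2}e^{-i\langle x,\xi\rangle}$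 with respect to $\mu_n$. Define $R_{\mathcal H_m}\colon\mathcal H_m\to L^2(\mathbb R^n,\widetilde\mu_n)^d$ by $$(R_{\mathcal H_m}g)(\xi)_j=\int_{\mathbb R^n}\bigl((F\otimes I)g\bigr)(\xi,v)\,\overline{q_{\phi(j),\xi}(v)}\,d\widetilde\mu_n(v)\qquad(1\le j\le d),$$ and $R_{\mathcal F_{\alpha,m}}=R_{\mathcal H_m}U$. For $\sigma\in L^\infty(\mathbb R^n)^{d\times d}$ (with the pointwise operations, the pointwise adjoint, and the essential supremum of the operator norm) let $(M_\sigma f)(\xi)=\sigma(\xi)f(\xi)$ on $L^2(\mathbb R^n,\widetilde\mu_n)^d$. Then $d=\binom{n+m-1}{n}$; the spaces $\mathcal H_m$ and $\mathcal F_{\alpha,m}$ are Hilbert spaces; $\mathcal C(\rho_{\mathcal H_m})$ and $\mathcal C(\rho_{\mathcal F_{\alpha,m}})$ are von Neumann algebras; and the maps $$\Lambda_{\mathcal H_m}(\sigma)=R_{\mathcal H_m}^*M_\sigma R_{\mathcal H_m},\qquad \Lambda_{\mathcal F_{\alpha,m}}(\sigma)=R_{\mathcal F_{\alpha,m}}^*M_\sigma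 R_{\mathcal F_{\alpha,m}}$$ are well-defined isometric $*$-isomorphisms of $L^\infty(\mathbb R^n)^{d\times d}$ onto $\mathcal C(\rho_{\mathcal H_m})$ and onto $\mathcal C(\rho_{\mathcal F_{\alpha,m}})$, respectively. In particular, both von Neumann algebras are isometrically $*$-isomorphic to $L^\infty(\mathbb R^n)^{d\times d}$. -/

import Mathlib

open MeasureTheory
open scoped ENNReal NNReal Matrix.Norms.L2Operator

namespace PolyFock
noncomputable section

/-! ### Weighted composition operators between `L²` spaces -/

section WeightedComp
variable {X Y E : Type*} [MeasurableSpace X] [MeasurableSpace Y] {μ : Measure X} {ν : Measure Y}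
  [NormedAddCommGroup E] [NormedSpace ℂ E]

/-- Change of variables `∫ |w|² (F ∘ φ) dμ = ∫ F dν` for all measurable `F ≥ 0`. -/
structure IsWeightedChange (φ : X → Y) (w : X → ℂ) (μ : Measure X) (ν : Measure Y) : Prop where
  measurable_map : Measurable φ
  measurable_weight : Measurable w
  lintegral_eq : ∀ F : Y → ℝ≥0∞, Measurable F →
    ∫⁻ x, ‖w x‖ₑ ^ 2 * F (φ x) ∂μ = ∫⁻ y, F y ∂ν

variable {φ : X → Y} {w : X → ℂ}

theorem IsWeightedChange.ae_smul_eq (h : IsWeightedChange φ w μ ν) {f g : Y → E}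
    (hfg : f =ᵐ[ν] g) : (fun x => w x • f (φ x)) =ᵐ[μ] fun x => w x • g (φ x) := by
  obtain ⟨s, hs, hsm, hs0⟩ := exists_measurable_superset_of_null (ae_iff.1 hfg)
  have h1 := h.lintegral_eq (s.indicator 1) (measurable_one.indicator hsm)
  rw [lintegral_indicator_one hsm, hs0] at h1
  replace h1 := (lintegral_eq_zero_iff ((h.measurable_weight.enorm.pow_const 2).mul
    ((measurable_one.indicator hsm).comp h.measurable_map))).1 h1
  filter_upwards [h1] with x hx
  by_cases hw : w x = 0
  · simp [hw]
  · have : φ x ∉ s := by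
      intro hmem
      simp [hmem, hw] at hx
    have : f (φ x) = g (φ x) := by
      by_contra hne
      exact this (hs hne)
    rw [this]

theorem IsWeightedChange.eLpNorm_eq (h : IsWeightedChange φ w μ ν) {f : Y → E}
    (hf : AEStronglyMeasurable f ν) :
    eLpNorm (fun x => w x • f (φ x)) 2 μ = eLpNorm f 2 ν := by
  rw [eLpNorm_congr_ae (h.ae_smul_eq hf.ae_eq_mk), eLpNorm_congr_ae hf.ae_eq_mk]
  simp only [eLpNorm_eq_lintegral_rpow_enorm_toReal (two_ne_zero) (ENNReal.ofNat_ne_top)]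
  congr 1
  simp only [ENNReal.toReal_ofNat, ENNReal.rpow_ofNat, enorm_smul, mul_pow]
  exact h.lintegral_eq _ (hf.stronglyMeasurable_mk.enorm.pow_const 2)

theorem IsWeightedChange.memLp (h : IsWeightedChange φ w μ ν) {f : Y → E}
    (hf : MemLp f 2 ν) : MemLp (fun x => w x • f (φ x)) 2 μ := by
  refine ⟨?_, ?_⟩
  · refine AEStronglyMeasurable.congr ?_ (h.ae_smul_eq hf.1.ae_eq_mk).symm
    exact (h.measurable_weight.stronglyMeasurable.smul
      (hf.1.stronglyMeasurable_mk.comp_measurable h.measurable_map)).aestronglyMeasurable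
  · rw [h.eLpNorm_eq hf.1]; exact hf.2

/-- The isometry `f ↦ w · (f ∘ φ)` from `L²(ν)` to `L²(μ)`. -/
def weightedComp (h : IsWeightedChange φ w μ ν) : Lp E 2 ν →ₗᵢ[ℂ] Lp E 2 μ where
  toFun f := (h.memLp (Lp.memLp f)).toLp (fun x => w x • f (φ x))
  map_add' f g := by
    rw [← MemLp.toLp_add]
    refine MemLp.toLp_congr _ _ ((h.ae_smul_eq (Lp.coeFn_add f g)).trans ?_)
    exact .of_forall fun x => by simp
  map_smul' c f := by
    rw [RingHom.id_apply, ← MemLp.toLp_const_smul]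
    refine MemLp.toLp_congr _ _ ((h.ae_smul_eq (Lp.coeFn_smul c f)).trans ?_)
    exact .of_forall fun x => by simp only [Pi.smul_apply]; rw [smul_comm]
  norm_map' f := by
    change ‖(h.memLp (Lp.memLp f)).toLp _‖ = ‖f‖
    rw [Lp.norm_toLp, h.eLpNorm_eq (Lp.aestronglyMeasurable f), Lp.norm_def]

theorem coeFn_weightedComp (h : IsWeightedChange φ w μ ν) (f : Lp E 2 ν) :
    weightedComp h f =ᵐ[μ] fun x => w x • f (φ x) :=
  MemLp.coeFn_toLp (h.memLp (Lp.memLp f))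

end WeightedComp

/-! ### Slicing: the identification `L²(X × Y) = L²(X; L²(Y))` -/

section Slice
variable {X Y : Type*} [MeasurableSpace X] [MeasurableSpace Y] {μ : Measure X} {ν : Measure Y}

open Classical in
/-- The class in `L²(ν)` of a function; zero if the function is not square integrable. -/
def classL2 (ν : Measure Y) (f : Y → ℂ) : Lp ℂ 2 ν := if h : MemLp f 2 ν then h.toLp f else 0

theorem classL2_of_memLp {f : Y → ℂ} (h : MemLp f 2 ν) : classL2 ν f = h.toLp f := dif_pos h

theorem classL2_congr {f g : Y → ℂ} (h : f =ᵐ[ν] g) : classL2 ν f = classL2 ν g := by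
  by_cases hf : MemLp f 2 ν
  · rw [classL2_of_memLp hf, classL2_of_memLp (hf.ae_eq h)]
    exact MemLp.toLp_congr _ _ h
  · have hg : ¬ MemLp g 2 ν := fun hg => hf (hg.ae_eq h.symm)
    rw [classL2, classL2, dif_neg hf, dif_neg hg]

variable [SigmaFinite μ] [SigmaFinite ν]

theorem memLp_slice {f : X × Y → ℂ} (hf : MemLp f 2 (μ.prod ν)) :
    ∀ᵐ x ∂μ, MemLp (fun y => f (x, y)) 2 ν := by
  have h1 := hf.1.prodMk_left
  have h2 : Integrable (fun p => ‖f p‖ ^ 2) (μ.prod ν) := hf.norm.integrable_sq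
  filter_upwards [h1, h2.prod_right_ae] with x hx hx2
  exact (memLp_two_iff_integrable_sq_norm hx).2 hx2

theorem stronglyMeasurable_slice [MeasurableSpace.CountablyGenerated Y] {f : X × Y → ℂ}
    (hf : StronglyMeasurable f) :
    StronglyMeasurable fun x => classL2 ν fun y => f (x, y) := by
  have : Fact ((2 : ℝ≥0∞) ≠ ∞) := ⟨ENNReal.ofNat_ne_top⟩
  have : SecondCountableTopology (Lp ℂ 2 ν) := inferInstance
  let _ : MeasurableSpace (Lp ℂ 2 ν) := borel _
  have : BorelSpace (Lp ℂ 2 ν) := ⟨rfl⟩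
  have hslice : ∀ x, AEStronglyMeasurable (fun y => f (x, y)) ν := fun x =>
    (hf.comp_measurable measurable_prodMk_left).aestronglyMeasurable
  have key : ∀ g : Y → ℂ, StronglyMeasurable g →
      Measurable fun x => eLpNorm (fun y => f (x, y) - g y) 2 ν := by
    intro g hg
    simp only [eLpNorm_eq_lintegral_rpow_enorm_toReal (two_ne_zero) (ENNReal.ofNat_ne_top)]
    refine Measurable.pow_const ?_ _
    refine Measurable.lintegral_prod_right' (f := fun p : X × Y =>
      ‖f p - g p.2‖ₑ ^ ((2 : ℝ≥0∞).toReal)) ?_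
    exact (hf.sub (hg.comp_measurable measurable_snd)).enorm.pow_const _
  have hD : MeasurableSet {x | MemLp (fun y => f (x, y)) 2 ν} := by
    have h0 := key 0 stronglyMeasurable_zero
    simp only [Pi.zero_apply, sub_zero] at h0
    have : {x | MemLp (fun y => f (x, y)) 2 ν} = {x | eLpNorm (fun y => f (x, y)) 2 ν < ∞} := by
      ext x; exact ⟨fun h => h.2, fun h => ⟨hslice x, h⟩⟩
    rw [this]
    exact measurableSet_lt h0 measurable_const
  have hball : ∀ (g : Lp ℂ 2 ν) (r : ℝ≥0∞),
      MeasurableSet ((fun x => classL2 ν fun y => f (x, y)) ⁻¹' Metric.eball g r) := by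
    intro g r
    have : (fun x => classL2 ν fun y => f (x, y)) ⁻¹' Metric.eball g r =
        ({x | MemLp (fun y => f (x, y)) 2 ν} ∩
          {x | eLpNorm (fun y => f (x, y) - g y) 2 ν < r}) ∪
        ({x | MemLp (fun y => f (x, y)) 2 ν}ᶜ ∩ {x | edist 0 g < r}) := by
      ext x
      by_cases hx : MemLp (fun y => f (x, y)) 2 ν
      · simp only [Set.mem_preimage, Metric.mem_eball, classL2_of_memLp hx, Set.mem_union,
          Set.mem_inter_iff, Set.mem_ofPred_eq, hx, true_and, Set.mem_compl_iff, not_true, false_and,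
          or_false]
        rw [Lp.edist_def, eLpNorm_congr_ae (hx.coeFn_toLp.sub (Filter.EventuallyEq.refl _ g))]
        rfl
      · simp [classL2, hx]
    rw [this]
    exact (hD.inter (measurableSet_lt (key g (Lp.stronglyMeasurable g)) measurable_const)).union
      (hD.compl.inter (.const _))
  refine Measurable.stronglyMeasurable (measurable_of_isOpen fun s hs => ?_)
  choose r hr hrs using fun g : s => EMetric.isOpen_iff.1 hs g g.2
  obtain ⟨T, hT, hTs⟩ := TopologicalSpace.isOpen_iUnion_countable
    (fun g : s => Metric.eball (g : Lp ℂ 2 ν) (r g)) fun g => Metric.isOpen_eball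
  have hs' : s = ⋃ g ∈ T, Metric.eball (g : Lp ℂ 2 ν) (r g) := by
    rw [hTs]
    refine Set.Subset.antisymm (fun g hg => Set.mem_iUnion.2 ⟨⟨g, hg⟩, ?_⟩)
      (Set.iUnion_subset hrs)
    exact Metric.mem_eball_self (hr ⟨g, hg⟩)
  rw [hs', Set.preimage_iUnion₂]
  exact MeasurableSet.biUnion hT fun g _ => hball _ _

theorem eLpNorm_slice {f : X × Y → ℂ} (hf : MemLp f 2 (μ.prod ν)) :
    eLpNorm (fun x => classL2 ν fun y => f (x, y)) 2 μ = eLpNorm f 2 (μ.prod ν) := by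
  simp only [eLpNorm_eq_lintegral_rpow_enorm_toReal (two_ne_zero) (ENNReal.ofNat_ne_top)]
  congr 1
  rw [lintegral_prod _ (hf.1.enorm.pow_const _)]
  refine lintegral_congr_ae ?_
  filter_upwards [memLp_slice hf] with x hx
  rw [classL2_of_memLp hx, Lp.enorm_def, eLpNorm_congr_ae hx.coeFn_toLp,
    eLpNorm_eq_lintegral_rpow_enorm_toReal (two_ne_zero) (ENNReal.ofNat_ne_top),
    ← ENNReal.rpow_mul]
  simp

variable [MeasurableSpace.CountablyGenerated Y]

theorem memLp_classL2_slice (f : Lp ℂ 2 (μ.prod ν)) :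
    MemLp (fun x => classL2 ν fun y => f (x, y)) 2 μ := by
  refine ⟨(stronglyMeasurable_slice (Lp.stronglyMeasurable f)).aestronglyMeasurable, ?_⟩
  rw [eLpNorm_slice (Lp.memLp f)]
  exact Lp.eLpNorm_lt_top f

/-- Slicing `f ↦ (x ↦ f(x, ·))`, the isometry `L²(X × Y) → L²(X; L²(Y))`. -/
def slice (μ : Measure X) (ν : Measure Y) [SigmaFinite μ] [SigmaFinite ν] :
    Lp ℂ 2 (μ.prod ν) →ₗᵢ[ℂ] Lp (Lp ℂ 2 ν) 2 μ where
  toFun f := (memLp_classL2_slice f).toLp _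
  map_add' f g := by
    rw [← MemLp.toLp_add]
    refine MemLp.toLp_congr _ _ ?_
    filter_upwards [Measure.ae_ae_of_ae_prod (Lp.coeFn_add f g), memLp_slice (Lp.memLp f),
      memLp_slice (Lp.memLp g)] with x hx hf hg
    rw [classL2_congr hx, Pi.add_apply, classL2_of_memLp hf, classL2_of_memLp hg,
      ← MemLp.toLp_add, classL2_of_memLp (f := fun y => (⇑f + ⇑g) (x, y)) (hf.add hg)]
    rfl
  map_smul' c f := by
    rw [RingHom.id_apply, ← MemLp.toLp_const_smul]
    refine MemLp.toLp_congr _ _ ?_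
    filter_upwards [Measure.ae_ae_of_ae_prod (Lp.coeFn_smul c f), memLp_slice (Lp.memLp f)]
      with x hx hf
    rw [classL2_congr hx, Pi.smul_apply, classL2_of_memLp hf, ← MemLp.toLp_const_smul,
      classL2_of_memLp (f := fun y => (c • ⇑f) (x, y)) (hf.const_smul c)]
    rfl
  norm_map' f := by
    change ‖(memLp_classL2_slice f).toLp _‖ = ‖f‖
    rw [Lp.norm_toLp, eLpNorm_slice (Lp.memLp f), Lp.norm_def]

end Slice

/-! ### Polyanalytic functions -/

/-- `ℝⁿ`. -/
abbrev RealSpace (n : ℕ) := EuclideanSpace ℝ (Fin n)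

/-- `ℂⁿ`. -/
abbrev ComplexSpace (n : ℕ) := EuclideanSpace ℂ (Fin n)

/-- The point `x + i y` of `ℂⁿ`. -/
def complexPoint {n : ℕ} (x y : RealSpace n) : ComplexSpace n :=
  WithLp.toLp 2 fun r => (x r : ℂ) + Complex.I * (y r : ℂ)

/-- The Wirtinger derivative `∂/∂z̄_r = (∂/∂x_r + i ∂/∂y_r)/2`. -/
def dbar {n : ℕ} (r : Fin n) (f : ComplexSpace n → ℂ) : ComplexSpace n → ℂ := fun z =>
  (1 / 2 : ℂ) * (fderiv ℝ f z (EuclideanSpace.single r 1) +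
    Complex.I * fderiv ℝ f z (EuclideanSpace.single r Complex.I))

/-- `D̄ᵏ = (∂/∂z̄_1)^{k_1} ⋯ (∂/∂z̄_n)^{k_n}`. -/
def dbarPow {n : ℕ} (k : Fin n → ℕ) (f : ComplexSpace n → ℂ) : ComplexSpace n → ℂ :=
  (List.finRange n).foldr (fun r g => (dbar r)^[k r] g) f

/-- A smooth function on `ℂⁿ` is (homogeneously) `m`-analytic if `D̄ᵏ f = 0` whenever `|k| = m`. -/
def IsPolyanalytic {n : ℕ} (m : ℕ) (f : ComplexSpace n → ℂ) : Prop :=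
  ContDiff ℝ (⊤ : ℕ∞) f ∧ ∀ k : Fin n → ℕ, ∑ r, k r = m → dbarPow k f = 0

theorem contDiff_dbar {n : ℕ} (r : Fin n) {f : ComplexSpace n → ℂ}
    (hf : ContDiff ℝ (⊤ : ℕ∞) f) : ContDiff ℝ (⊤ : ℕ∞) (dbar r f) := by
  have h : ContDiff ℝ (⊤ : ℕ∞) (fderiv ℝ f) := hf.fderiv_right (by simp)
  exact contDiff_const.mul ((h.clm_apply contDiff_const).add
    (contDiff_const.mul (h.clm_apply contDiff_const)))

/-- If a map commutes with every `∂/∂z̄_r` on smooth functions, it commutes with `D̄ᵏ`. -/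
theorem dbarPow_comm {n : ℕ} (L : (ComplexSpace n → ℂ) → ComplexSpace n → ℂ)
    (hL : ∀ r f, ContDiff ℝ (⊤ : ℕ∞) f → dbar r (L f) = L (dbar r f)) (k : Fin n → ℕ)
    {f : ComplexSpace n → ℂ} (hf : ContDiff ℝ (⊤ : ℕ∞) f) :
    dbarPow k (L f) = L (dbarPow k f) := by
  have iter : ∀ (r : Fin n) (j : ℕ) (g : ComplexSpace n → ℂ), ContDiff ℝ (⊤ : ℕ∞) g →
      (dbar r)^[j] (L g) = L ((dbar r)^[j] g) ∧ ContDiff ℝ (⊤ : ℕ∞) ((dbar r)^[j] g) := by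
    intro r j
    induction j with
    | zero => intro g hg; exact ⟨rfl, hg⟩
    | succ j ih =>
      intro g hg
      simp only [Function.iterate_succ, Function.comp_apply]
      rw [hL r g hg]
      exact ih _ (contDiff_dbar r hg)
  have main : ∀ l : List (Fin n),
      l.foldr (fun r g => (dbar r)^[k r] g) (L f) =
        L (l.foldr (fun r g => (dbar r)^[k r] g) f) ∧
      ContDiff ℝ (⊤ : ℕ∞) (l.foldr (fun r g => (dbar r)^[k r] g) f) := by
    intro l
    induction l with
    | nil => exact ⟨rfl, hf⟩
    | cons r l ih =>
      simp only [List.foldr_cons]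
      rw [ih.1]
      exact iter r (k r) _ ih.2
  exact (main _).1

theorem dbarPow_add {n : ℕ} (k : Fin n → ℕ) {f g : ComplexSpace n → ℂ}
    (hf : ContDiff ℝ (⊤ : ℕ∞) f) (hg : ContDiff ℝ (⊤ : ℕ∞) g) :
    dbarPow k (f + g) = dbarPow k f + dbarPow k g := by
  have one : ∀ r (f g : ComplexSpace n → ℂ), ContDiff ℝ (⊤ : ℕ∞) f → ContDiff ℝ (⊤ : ℕ∞) g →
      dbar r (f + g) = dbar r f + dbar r g := by
    intro r f g hf hg
    funext z
    simp only [dbar, Pi.add_apply]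
    rw [fderiv_add (hf.differentiable (by simp) z) (hg.differentiable (by simp) z)]
    simp only [add_apply]
    ring
  have iter : ∀ (r : Fin n) (j : ℕ) (f g : ComplexSpace n → ℂ), ContDiff ℝ (⊤ : ℕ∞) f →
      ContDiff ℝ (⊤ : ℕ∞) g → (dbar r)^[j] (f + g) = (dbar r)^[j] f + (dbar r)^[j] g ∧
        ContDiff ℝ (⊤ : ℕ∞) ((dbar r)^[j] f) ∧ ContDiff ℝ (⊤ : ℕ∞) ((dbar r)^[j] g) := by
    intro r j
    induction j with
    | zero => intro f g hf hg; exact ⟨rfl, hf, hg⟩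
    | succ j ih =>
      intro f g hf hg
      simp only [Function.iterate_succ, Function.comp_apply]
      rw [one r f g hf hg]
      exact ih _ _ (contDiff_dbar r hf) (contDiff_dbar r hg)
  have main : ∀ l : List (Fin n),
      l.foldr (fun r g => (dbar r)^[k r] g) (f + g) =
        l.foldr (fun r g => (dbar r)^[k r] g) f + l.foldr (fun r g => (dbar r)^[k r] g) g ∧
      ContDiff ℝ (⊤ : ℕ∞) (l.foldr (fun r g => (dbar r)^[k r] g) f) ∧
      ContDiff ℝ (⊤ : ℕ∞) (l.foldr (fun r g => (dbar r)^[k r] g) g) := by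
    intro l
    induction l with
    | nil => exact ⟨rfl, hf, hg⟩
    | cons r l ih =>
      simp only [List.foldr_cons]
      rw [ih.1]
      exact iter r (k r) _ _ ih.2.1 ih.2.2
  exact (main _).1

theorem IsPolyanalytic.add {n m : ℕ} {f g : ComplexSpace n → ℂ} (hf : IsPolyanalytic m f)
    (hg : IsPolyanalytic m g) : IsPolyanalytic m (f + g) :=
  ⟨hf.1.add hg.1, fun k hk => by rw [dbarPow_add k hf.1 hg.1, hf.2 k hk, hg.2 k hk, add_zero]⟩

/-- `m`-analyticity is preserved by a translation followed by multiplication with an entire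
function. -/
theorem IsPolyanalytic.mul_comp_sub {n m : ℕ} {f : ComplexSpace n → ℂ} (hf : IsPolyanalytic m f)
    {h : ComplexSpace n → ℂ} (hh : ContDiff ℂ (⊤ : ℕ∞) h) (a : ComplexSpace n) :
    IsPolyanalytic m fun z => h z * f (z - a) := by
  have hhR : ContDiff ℝ (⊤ : ℕ∞) h := hh.restrict_scalars ℝ
  refine ⟨hhR.mul (hf.1.comp (contDiff_id.sub contDiff_const)), fun k hk => ?_⟩
  rw [dbarPow_comm (fun g z => h z * g (z - a)) ?_ k hf.1, hf.2 k hk]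
  · funext z; simp
  · intro r g hg
    funext z
    have h1 : HasFDerivAt h ((fderiv ℂ h z).restrictScalars ℝ) z :=
      (hh.differentiable (by simp) z).hasFDerivAt.restrictScalars ℝ
    have h2 : HasFDerivAt (fun z => g (z - a)) (fderiv ℝ g (z - a)) z :=
      (hg.differentiable (by simp) (z - a)).hasFDerivAt.comp z ((hasFDerivAt_id z).sub_const a)
    have h3 : (EuclideanSpace.single r Complex.I : ComplexSpace n) =
        Complex.I • EuclideanSpace.single r 1 := by
      ext i; simp
    simp only [dbar]
    have h4 : HasFDerivAt (fun z => h z * g (z - a)) _ z := h1.mul h2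
    rw [h4.fderiv]
    simp only [add_apply, smul_apply,
      ContinuousLinearMap.coe_restrictScalars', smul_eq_mul]
    have h5 : fderiv ℂ h z (EuclideanSpace.single r Complex.I) =
        Complex.I * fderiv ℂ h z (EuclideanSpace.single r 1) := by
      rw [h3, map_smul, smul_eq_mul]
    rw [h5]
    linear_combination (1 / 2 * g (z - a) * fderiv ℂ h z (EuclideanSpace.single r 1)) *
      Complex.I_mul_I

theorem IsPolyanalytic.const_smul {n m : ℕ} {f : ComplexSpace n → ℂ} (hf : IsPolyanalytic m f)
    (c : ℂ) : IsPolyanalytic m (c • f) := by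
  have := hf.mul_comp_sub (h := fun _ => c) contDiff_const 0
  simpa [Pi.smul_def] using this

theorem isPolyanalytic_zero {n m : ℕ} : IsPolyanalytic m (0 : ComplexSpace n → ℂ) := by
  have h : ContDiff ℝ (⊤ : ℕ∞) (0 : ComplexSpace n → ℂ) := contDiff_const
  refine ⟨h, fun k _ => ?_⟩
  rw [dbarPow_comm (f := 0) (fun _ => 0) _ k h]
  intro r f _
  funext z
  simp [dbar]

/-! ### The polyanalytic Fock space and its flattened version -/

/-- The measure `μ̃_n = (2π)^{-n/2} μ_n` on `ℝⁿ`. On `ℝ²ⁿ = ℝⁿ × ℝⁿ` the measure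
`μ̃_{2n} = (2π)^{-n} μ_{2n}` is the product of two copies of it. -/
def lebesgueT (n : ℕ) : Measure (RealSpace n) :=
  Real.toNNReal ((2 * Real.pi) ^ (-(n : ℝ) / 2)) • volume

instance (n : ℕ) : SigmaFinite (lebesgueT n) := by unfold lebesgueT; infer_instance

instance (n : ℕ) : (lebesgueT n).IsAddRightInvariant := by unfold lebesgueT; infer_instance

/-- The Gaussian measure `(α^n/π^n) e^{-α|z|²} dμ_{2n}(z)` on `ℂⁿ`. -/
def gaussian (n : ℕ) (α : ℝ) : Measure (ComplexSpace n) :=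
  volume.withDensity fun z => ENNReal.ofReal (α ^ n / Real.pi ^ n * Real.exp (-α * ‖z‖ ^ 2))

theorem lintegral_gaussian (n : ℕ) (α : ℝ) (F : ComplexSpace n → ℝ≥0∞) (hF : Measurable F) :
    ∫⁻ z, F z ∂gaussian n α =
      ∫⁻ z, ENNReal.ofReal (α ^ n / Real.pi ^ n * Real.exp (-α * ‖z‖ ^ 2)) * F z := by
  rw [gaussian, lintegral_withDensity_eq_lintegral_mul _ (by fun_prop) hF]
  rfl

/-- The `m`-analytic Bargmann–Segal–Fock space: the elements of `L²` of the Gaussian measure that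
are (represented by) `m`-analytic functions. -/
def fock (n m : ℕ) (α : ℝ) : Submodule ℂ (Lp ℂ 2 (gaussian n α)) where
  carrier := {f | ∃ g : ComplexSpace n → ℂ, IsPolyanalytic m g ∧ f =ᵐ[gaussian n α] g}
  zero_mem' := ⟨0, isPolyanalytic_zero, Lp.coeFn_zero _ _ _⟩
  add_mem' := by
    rintro f₁ f₂ ⟨g₁, hg₁, h₁⟩ ⟨g₂, hg₂, h₂⟩
    exact ⟨g₁ + g₂, hg₁.add hg₂, (Lp.coeFn_add f₁ f₂).trans (h₁.add h₂)⟩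
  smul_mem' := by
    rintro c f ⟨g, hg, h⟩
    exact ⟨c • g, hg.const_smul c, (Lp.coeFn_smul c f).trans (h.const_smul c)⟩

/-- The factor `e^{α⟨z,a⟩ - α|a|²/2}`; Mathlib's `inner ℂ a z` is `⟨z,a⟩ = ∑ z_r conj(a_r)`. -/
def weylWeight {n : ℕ} (α : ℝ) (a z : ComplexSpace n) : ℂ :=
  Complex.exp (α * inner ℂ a z - α / 2 * (‖a‖ : ℂ) ^ 2)

theorem isWeightedChange_weyl {n : ℕ} (α : ℝ) (a : ComplexSpace n) :
    IsWeightedChange (fun z => z - a) (weylWeight α a) (gaussian n α) (gaussian n α) where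
  measurable_map := by fun_prop
  measurable_weight := by unfold weylWeight; fun_prop
  lintegral_eq F hF := by
    rw [lintegral_gaussian n α F hF, lintegral_gaussian n α _
      (by unfold weylWeight; fun_prop),
      ← lintegral_sub_right_eq_self (fun z => ENNReal.ofReal _ * F z) a]
    refine lintegral_congr fun z => ?_
    rw [← mul_assoc]
    congr 1
    have hn : ‖weylWeight α a z‖ₑ ^ 2 =
        ENNReal.ofReal (Real.exp (2 * (α * RCLike.re (inner ℂ a z) - α / 2 * ‖a‖ ^ 2))) := by
      rw [← ofReal_norm, ← ENNReal.ofReal_pow (norm_nonneg _), weylWeight,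
        Complex.norm_exp, ← Real.exp_nat_mul]
      congr 3
      simp [← Complex.ofReal_pow]
    rw [hn, mul_comm, ← ENNReal.ofReal_mul (Real.exp_pos _).le, mul_left_comm, ← Real.exp_add]
    congr 3
    rw [@norm_sub_sq ℂ, inner_re_symm]
    ring

/-- The Weyl operator `(W_a f)(z) = f(z - a) e^{α⟨z,a⟩ - α|a|²/2}` on `L²` of the Gaussian
measure. -/
def weyl {n : ℕ} (α : ℝ) (a : ComplexSpace n) :
    Lp ℂ 2 (gaussian n α) →ₗᵢ[ℂ] Lp ℂ 2 (gaussian n α) :=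
  weightedComp (isWeightedChange_weyl α a)

theorem weyl_mem_fock {n m : ℕ} {α : ℝ} (a : ComplexSpace n) (f : Lp ℂ 2 (gaussian n α))
    (hf : f ∈ fock n m α) : weyl α a f ∈ fock n m α := by
  obtain ⟨g, hg, h⟩ := hf
  refine ⟨fun z => weylWeight α a z * g (z - a), hg.mul_comp_sub ?_ a, ?_⟩
  · unfold weylWeight
    exact ((contDiff_const.mul ((innerSL ℂ a).contDiff)).sub contDiff_const).cexp
  · exact (coeFn_weightedComp _ f).trans ((isWeightedChange_weyl α a).ae_smul_eq h)

/-- The horizontal Weyl operator on the `m`-analytic Fock space, for `a ∈ ℝⁿ ⊂ ℂⁿ`. -/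
def rhoF (n m : ℕ) (α : ℝ) (a : RealSpace n) : fock n m α →L[ℂ] fock n m α :=
  (weyl α (complexPoint a 0)).toContinuousLinearMap.restrict fun f hf => weyl_mem_fock _ f hf

/-- The factor `2^{n/2} e^{-|x|²/2 - |y|²/2 - i⟨x,y⟩}`. -/
def flatWeight {n : ℕ} (p : RealSpace n × RealSpace n) : ℂ :=
  ((2 : ℝ) ^ ((n : ℝ) / 2) : ℝ) * Complex.exp (-(1 / 2) * (‖p.1‖ : ℂ) ^ 2 - 1 / 2 * (‖p.2‖ : ℂ) ^ 2
    - Complex.I * (inner ℝ p.1 p.2 : ℝ))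

/-- The point `(x + i y)/√α`. -/
def flatPoint {n : ℕ} (α : ℝ) (p : RealSpace n × RealSpace n) : ComplexSpace n :=
  (√α)⁻¹ • complexPoint p.1 p.2

/-- `(x, y) ↦ x + i y` as a linear isometry. -/
def complexPointₗᵢ (n : ℕ) : WithLp 2 (RealSpace n × RealSpace n) ≃ₗᵢ[ℝ] ComplexSpace n where
  toFun p := complexPoint p.fst p.snd
  invFun z := WithLp.toLp 2 (WithLp.toLp 2 fun r => (z r).re, WithLp.toLp 2 fun r => (z r).im)
  left_inv p := by
    apply WithLp.ofLp_injective
    ext r <;> simp [complexPoint]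
  right_inv z := by
    ext r
    simp [complexPoint, mul_comm Complex.I, Complex.re_add_im]
  map_add' p q := by ext r; simp [complexPoint]; ring
  map_smul' c p := by ext r; simp [complexPoint]; ring
  norm_map' p := by
    rw [← sq_eq_sq₀ (norm_nonneg _) (norm_nonneg _), WithLp.prod_norm_sq_eq_of_L2]
    simp only [EuclideanSpace.norm_sq_eq, ← Finset.sum_add_distrib]
    refine Finset.sum_congr rfl fun r _ => ?_
    rw [← Complex.normSq_eq_norm_sq, Complex.normSq_apply]
    simp [complexPoint, sq]

theorem measurePreserving_complexPoint (n : ℕ) :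
    MeasurePreserving (fun p : RealSpace n × RealSpace n => complexPoint p.1 p.2)
      volume volume :=
  (complexPointₗᵢ n).measurePreserving.comp (WithLp.volume_preserving_toLp _ _)

theorem norm_complexPoint_sq {n : ℕ} (x y : RealSpace n) :
    ‖complexPoint x y‖ ^ 2 = ‖x‖ ^ 2 + ‖y‖ ^ 2 := by
  have := (complexPointₗᵢ n).norm_map (WithLp.toLp 2 (x, y))
  change ‖complexPoint x y‖ = _ at this
  rw [this, WithLp.prod_norm_sq_eq_of_L2]
  rfl

theorem isWeightedChange_flat {n : ℕ} {α : ℝ} (hα : 0 < α) :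
    IsWeightedChange (flatPoint α) flatWeight ((lebesgueT n).prod (lebesgueT n))
      (gaussian n α) where
  measurable_map := by
    have := (measurePreserving_complexPoint n).measurable
    unfold flatPoint
    fun_prop
  measurable_weight := by unfold flatWeight; fun_prop
  lintegral_eq F hF := by
    have hw : ∀ p : RealSpace n × RealSpace n, ‖flatWeight p‖ₑ ^ 2 =
        ENNReal.ofReal (2 ^ n * Real.exp (-‖complexPoint p.1 p.2‖ ^ 2)) := by
      intro p
      have h2 : ((2 : ℝ) ^ ((n : ℝ) / 2)) ^ 2 = 2 ^ n := by
        rw [← Real.rpow_mul_natCast (by norm_num)]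
        simp
      rw [← ofReal_norm, ← ENNReal.ofReal_pow (norm_nonneg _), flatWeight, norm_mul,
        Complex.norm_real, Complex.norm_exp, mul_pow, ← Real.exp_nat_mul, Real.norm_eq_abs, sq_abs,
        h2, norm_complexPoint_sq]
      congr 3
      simp [← Complex.ofReal_pow]
      ring
    set G : ComplexSpace n → ℝ≥0∞ := fun z =>
      ENNReal.ofReal (2 ^ n * Real.exp (-‖z‖ ^ 2)) * F ((√α)⁻¹ • z) with hG
    have hGm : Measurable G := by fun_prop
    have hs : √α ≠ 0 := (Real.sqrt_pos.2 hα).ne'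
    have hfin : Module.finrank ℝ (ComplexSpace n) = 2 * n := by
      rw [← (complexPointₗᵢ n).toLinearEquiv.finrank_eq,
        (WithLp.linearEquiv 2 ℝ (RealSpace n × RealSpace n)).finrank_eq]
      simp [two_mul]
    have hscale : ∫⁻ z, G (√α • z) = ENNReal.ofReal ((α ^ n)⁻¹) * ∫⁻ z, G z := by
      have h := Measure.map_addHaar_smul (volume : Measure (ComplexSpace n)) hs
      rw [← lintegral_map (μ := volume) (f := G) (g := fun z : ComplexSpace n => √α • z) hGm
        (by fun_prop), h, lintegral_smul_measure, hfin, pow_mul, Real.sq_sqrt hα.le, abs_of_pos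
        (by positivity), smul_eq_mul]
    have hvol : ∫⁻ z, G z = ENNReal.ofReal (α ^ n) * ∫⁻ z, G (√α • z) := by
      rw [hscale, ← mul_assoc, ← ENNReal.ofReal_mul (by positivity),
        mul_inv_cancel₀ (by positivity), ENNReal.ofReal_one, one_mul]
    have hc : (0 : ℝ) ≤ (2 * Real.pi) ^ (-(n : ℝ) / 2) := by positivity
    have hcc : (2 * Real.pi) ^ (-(n : ℝ) / 2) * (2 * Real.pi) ^ (-(n : ℝ) / 2) =
        ((2 * Real.pi) ^ n)⁻¹ := by
      rw [← Real.rpow_add (by positivity), ← Real.rpow_natCast, ← Real.rpow_neg (by positivity)]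
      congr 1
      ring
    have hint : ∀ p : RealSpace n × RealSpace n,
        ‖flatWeight p‖ₑ ^ 2 * F (flatPoint α p) = G (complexPoint p.1 p.2) := fun p => by
      rw [hw, hG, flatPoint]
    simp only [hint]
    rw [lebesgueT, Measure.prod_smul_left, Measure.prod_smul_right]
    simp only [lintegral_smul_measure]
    rw [← Measure.volume_eq_prod, (measurePreserving_complexPoint n).lintegral_comp hGm, hvol,
      lintegral_gaussian n α F hF, ← lintegral_const_mul _ (by fun_prop)]
    simp only [ENNReal.smul_def, smul_eq_mul]
    rw [← mul_assoc, ← lintegral_const_mul _ (by fun_prop)]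
    refine lintegral_congr fun z => ?_
    rw [hG]
    simp only [smul_smul, inv_mul_cancel₀ hs, one_smul, ← mul_assoc]
    congr 1
    change ENNReal.ofReal _ * ENNReal.ofReal _ * _ * _ = _
    rw [← ENNReal.ofReal_mul hc, ← ENNReal.ofReal_mul (by positivity),
      ← ENNReal.ofReal_mul (by positivity), hcc, norm_smul, Real.norm_eq_abs,
      abs_of_pos (Real.sqrt_pos.2 hα), mul_pow √α, Real.sq_sqrt hα.le, mul_pow, neg_mul]
    congr 1
    field_simp

/-- The operator `(U f)(x, y) = 2^{n/2} e^{-|x|²/2 - |y|²/2 - i⟨x,y⟩} f((x + i y)/√α)`. -/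
def flatten (n : ℕ) {α : ℝ} (hα : 0 < α) :
    Lp ℂ 2 (gaussian n α) →ₗᵢ[ℂ] Lp ℂ 2 ((lebesgueT n).prod (lebesgueT n)) :=
  weightedComp (isWeightedChange_flat hα)

/-- The flattened space `H_m`, the image of the `m`-analytic Fock space under `U`. -/
def flatFock (n m : ℕ) {α : ℝ} (hα : 0 < α) :
    Submodule ℂ (Lp ℂ 2 ((lebesgueT n).prod (lebesgueT n))) :=
  (fock n m α).map (flatten n hα).toLinearMap

/-- `U` as an operator from the `m`-analytic Fock space to `H_m`. -/
def flattenFock (n m : ℕ) {α : ℝ} (hα : 0 < α) : fock n m α →L[ℂ] flatFock n m hα :=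
  (flatten n hα).toContinuousLinearMap.restrict fun _ hf => Submodule.mem_map_of_mem hf

theorem measurePreserving_horizontal {n : ℕ} (a : RealSpace n) :
    MeasurePreserving (fun p : RealSpace n × RealSpace n => (p.1 - a, p.2))
      ((lebesgueT n).prod (lebesgueT n)) ((lebesgueT n).prod (lebesgueT n)) :=
  (measurePreserving_sub_right (lebesgueT n) a).prod (MeasurePreserving.id _)

/-- The horizontal translation `(x, y) ↦ f(x - a, y)` on `L²(ℝ²ⁿ, μ̃_{2n})`. -/
def translation {n : ℕ} (a : RealSpace n) :
    Lp ℂ 2 ((lebesgueT n).prod (lebesgueT n)) →ₗᵢ[ℂ]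
      Lp ℂ 2 ((lebesgueT n).prod (lebesgueT n)) :=
  Lp.compMeasurePreservingₗᵢ ℂ _ (measurePreserving_horizontal a)

theorem translation_flatten {n : ℕ} {α : ℝ} (hα : 0 < α) (a : RealSpace n)
    (f : Lp ℂ 2 (gaussian n α)) :
    translation a (flatten n hα f) =
      flatten n hα (weyl α (complexPoint ((√α)⁻¹ • a) 0) f) := by
  have hs : √α ≠ 0 := (Real.sqrt_pos.2 hα).ne'
  have hsC : ((√α : ℝ) : ℂ) ≠ 0 := by exact_mod_cast hs
  have hα' : (α : ℂ) = ((√α : ℝ) : ℂ) ^ 2 := by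
    rw [← Complex.ofReal_pow, Real.sq_sqrt hα.le]
  refine Lp.ext ?_
  have h1 : translation a (flatten n hα f) =ᵐ[(lebesgueT n).prod (lebesgueT n)]
      fun p => flatWeight (p.1 - a, p.2) • f (flatPoint α (p.1 - a, p.2)) :=
    (Lp.coeFn_compMeasurePreserving _ (measurePreserving_horizontal a)).trans
      ((measurePreserving_horizontal a).quasiMeasurePreserving.ae_eq_comp
        (coeFn_weightedComp (isWeightedChange_flat hα) f))
  have h2 := (coeFn_weightedComp (isWeightedChange_flat hα)
    (weyl α (complexPoint ((√α)⁻¹ • a) 0) f)).trans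
      ((isWeightedChange_flat hα).ae_smul_eq (coeFn_weightedComp (isWeightedChange_weyl α _) f))
  refine h1.trans (Filter.EventuallyEq.trans (.of_forall fun p => ?_) h2.symm)
  have hp : flatPoint α (p.1 - a, p.2) = flatPoint α p - complexPoint ((√α)⁻¹ • a) 0 := by
    ext r
    simp [flatPoint, complexPoint]
    ring
  simp only [smul_smul]
  rw [hp]
  congr 1
  have hin : (inner ℂ (complexPoint ((√α)⁻¹ • a) 0) (flatPoint α p) : ℂ) =
      (α : ℂ)⁻¹ * ((inner ℝ a p.1 : ℝ) + Complex.I * (inner ℝ a p.2 : ℝ)) := by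
    simp only [PiLp.inner_apply, complexPoint, flatPoint]
    push_cast
    rw [Finset.mul_sum, ← Finset.sum_add_distrib, Finset.mul_sum]
    refine Finset.sum_congr rfl fun r _ => ?_
    simp
    rw [hα']
    field_simp
  have hna : ((‖complexPoint ((√α)⁻¹ • a) 0‖ : ℝ) : ℂ) ^ 2 = (α : ℂ)⁻¹ * (‖a‖ : ℂ) ^ 2 := by
    rw [← Complex.ofReal_pow, norm_complexPoint_sq, norm_smul]
    simp
    rw [mul_pow, inv_pow, abs_of_pos (Real.sqrt_pos.2 hα), ← Complex.ofReal_pow √α, Real.sq_sqrt hα.le]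
  have hαC : (α : ℂ) ≠ 0 := by exact_mod_cast hα.ne'
  rw [flatWeight, flatWeight, weylWeight, mul_assoc, ← Complex.exp_add, hin, hna]
  congr 2
  have hsq : ((‖p.1 - a‖ : ℝ) : ℂ) ^ 2 =
      (‖p.1‖ : ℂ) ^ 2 - 2 * (inner ℝ a p.1 : ℝ) + (‖a‖ : ℂ) ^ 2 := by
    rw [← Complex.ofReal_pow, norm_sub_sq_real, real_inner_comm]
    push_cast
    ring
  have hi : ((inner ℝ (p.1 - a) p.2 : ℝ) : ℂ) = (inner ℝ p.1 p.2 : ℝ) - (inner ℝ a p.2 : ℝ) := by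
    rw [inner_sub_left]; push_cast; ring
  simp only [hsq, hi]
  field_simp
  ring

theorem translation_mem_flatFock {n m : ℕ} {α : ℝ} (hα : 0 < α) (a : RealSpace n)
    (g : Lp ℂ 2 ((lebesgueT n).prod (lebesgueT n))) (hg : g ∈ flatFock n m hα) :
    translation a g ∈ flatFock n m hα := by
  obtain ⟨f, hf, rfl⟩ := hg
  exact ⟨_, weyl_mem_fock (complexPoint ((√α)⁻¹ • a) 0) f hf, (translation_flatten hα a f).symm⟩

/-- The horizontal translation on `H_m`. -/
def rhoH (n m : ℕ) {α : ℝ} (hα : 0 < α) (a : RealSpace n) :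
    flatFock n m hα →L[ℂ] flatFock n m hα :=
  (translation a).toContinuousLinearMap.restrict fun g hg => translation_mem_flatFock hα a g hg

/-! ### The horizontal Fourier transform and the operators `R` -/

theorem isWeightedChange_id (n : ℕ) :
    IsWeightedChange (fun x : RealSpace n => x)
      (fun _ => (((2 * Real.pi) ^ (-(n : ℝ) / 4) : ℝ) : ℂ)) volume (lebesgueT n) where
  measurable_map := measurable_id
  measurable_weight := measurable_const
  lintegral_eq F hF := by
    rw [lintegral_const_mul _ hF, lebesgueT, lintegral_smul_measure, ENNReal.smul_def, smul_eq_mul]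
    congr 1
    rw [← ofReal_norm, ← ENNReal.ofReal_pow (norm_nonneg _), Complex.norm_real, Real.norm_eq_abs,
      sq_abs, ← Real.rpow_mul_natCast (by positivity)]
    change _ = ENNReal.ofReal _
    congr 2
    push_cast
    ring

theorem isWeightedChange_dilation (n : ℕ) :
    IsWeightedChange (fun ξ : RealSpace n => (2 * Real.pi)⁻¹ • ξ)
      (fun _ => (((2 * Real.pi) ^ (-(n : ℝ) / 4) : ℝ) : ℂ)) (lebesgueT n) volume where
  measurable_map := by fun_prop
  measurable_weight := measurable_const
  lintegral_eq F hF := by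
    have h := Measure.map_addHaar_smul (volume : Measure (RealSpace n))
      (r := (2 * Real.pi)⁻¹) (by positivity)
    have h' := lintegral_map (μ := volume) (f := F)
      (g := fun z : RealSpace n => (2 * Real.pi)⁻¹ • z) hF (by fun_prop)
    rw [lintegral_const_mul _ (by fun_prop), lebesgueT, lintegral_smul_measure, ENNReal.smul_def,
      smul_eq_mul, ← h', h, lintegral_smul_measure, smul_eq_mul, ← mul_assoc, ← mul_assoc]
    convert one_mul _
    rw [← ofReal_norm, ← ENNReal.ofReal_pow (norm_nonneg _), Complex.norm_real, Real.norm_eq_abs,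
      sq_abs, ← Real.rpow_mul_natCast (by positivity)]
    change ENNReal.ofReal _ * ENNReal.ofReal _ * _ = _
    rw [← ENNReal.ofReal_mul (by positivity), ← ENNReal.ofReal_mul (by positivity),
      ← Real.rpow_add (by positivity), abs_of_pos (by positivity), finrank_euclideanSpace_fin,
      inv_pow, inv_inv, ← Real.rpow_natCast (2 * Real.pi) n, ← Real.rpow_add (by positivity)]
    convert ENNReal.ofReal_one
    convert Real.rpow_zero _
    push_cast
    ring

/-- The Fourier–Plancherel transform
`(F f)(ξ) = (2π)^{-n/2} ∫ f(x) e^{-i⟨x,ξ⟩} dx = (2π)^{-n/2} (𝓕 f)(ξ/(2π))`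
on `L²(ℝⁿ, μ̃_n; E)`, where `𝓕` is Mathlib's transform with the kernel `e^{-2πi⟨x,ξ⟩}`. The factor
`(2π)^{-n/2}` is split between the passages from `μ̃_n` to `μ_n` and back. With `E = L²(ℝⁿ, μ̃_n)`,
this is `F ⊗ I` on `L²(ℝⁿ, μ̃_n) ⊗ L²(ℝⁿ, μ̃_n)`. -/
def fourierT (n : ℕ) (E : Type*) [NormedAddCommGroup E] [InnerProductSpace ℂ E]
    [CompleteSpace E] : Lp E 2 (lebesgueT n) →ₗᵢ[ℂ] Lp E 2 (lebesgueT n) :=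
  (weightedComp (isWeightedChange_dilation n)).comp
    ((Lp.fourierTransformₗᵢ (RealSpace n) E).toLinearIsometry.comp
      (weightedComp (isWeightedChange_id n)))

/-- The Hermite function `ψ_k(t) = (2^k k! √π)^{-1/2} e^{-t²/2} H_k(t)`; the physicist's Hermite
polynomial `H_k(t) = 2^{k/2} He_k(√2 t)` is expressed through Mathlib's `hermite k = He_k`. -/
def hermiteFun (k : ℕ) (t : ℝ) : ℝ :=
  (2 ^ k * (k.factorial : ℝ) * √Real.pi) ^ (-(1 / 2) : ℝ) * Real.exp (-(1 / 2) * t ^ 2) *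
    (2 ^ ((k : ℝ) / 2) * Polynomial.aeval (√2 * t) (Polynomial.hermite k))

/-- `q_{k,ξ}(v) = 2^{n/2} π^{n/4} ∏_r ψ_{k_r}((ξ_r + 2 v_r)/√2)`. -/
def qFun {n : ℕ} (k : Fin n → ℕ) (ξ v : RealSpace n) : ℂ :=
  ((2 ^ ((n : ℝ) / 2) * Real.pi ^ ((n : ℝ) / 4) *
    ∏ r, hermiteFun (k r) ((ξ r + 2 * v r) / √2) : ℝ) : ℂ)

theorem continuous_hermiteFun (k : ℕ) : Continuous (hermiteFun k) := by
  unfold hermiteFun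
  have : Continuous fun t : ℝ => Polynomial.aeval (√2 * t) (Polynomial.hermite k) :=
    (Polynomial.continuous_aeval _).comp (by fun_prop)
  fun_prop

theorem integrable_hermiteFun_sq (k : ℕ) :
    Integrable fun t : ℝ => hermiteFun k (2 * t / √2) ^ 2 := by
  have key : ∀ p : Polynomial ℝ, Integrable fun t : ℝ => p.eval t * Real.exp (-2 * t ^ 2) := by
    intro p
    induction p using Polynomial.induction_on' with
    | add p q hp hq =>
      simp only [Polynomial.eval_add, add_mul]
      exact hp.add hq
    | monomial j c =>
      have h := (integrable_rpow_mul_exp_neg_mul_sq (b := 2) (by norm_num) (s := j)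
        (by have : (0 : ℝ) ≤ j := j.cast_nonneg; linarith)).const_mul c
      simpa [Polynomial.eval_monomial, mul_assoc] using h
  have h2 : √2 * √2 = (2 : ℝ) := Real.mul_self_sqrt (by norm_num)
  have h20 : √2 ≠ (0 : ℝ) := by positivity
  have h := (key ((((Polynomial.hermite k).map (Int.castRingHom ℝ)).comp
    (Polynomial.C 2 * Polynomial.X)) ^ 2)).const_mul
    (((2 ^ k * (k.factorial : ℝ) * √Real.pi) ^ (-(1 / 2) : ℝ) * 2 ^ ((k : ℝ) / 2)) ^ 2)
  refine h.congr (.of_forall fun t => ?_)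
  have e1 : √2 * (2 * t / √2) = 2 * t := by field_simp
  have e2 : (2 * t / √2) ^ 2 = 2 * t ^ 2 := by
    rw [div_pow, Real.sq_sqrt (by norm_num)]; ring
  have e3 : Real.exp (-2 * t ^ 2) = Real.exp (-(1 / 2) * (2 * t ^ 2)) ^ 2 := by
    rw [← Real.exp_nat_mul]; congr 1; push_cast; ring
  simp only [hermiteFun, e1, e2, e3, Polynomial.eval_pow, Polynomial.eval_comp,
    Polynomial.eval_mul, Polynomial.eval_C, Polynomial.eval_X, Polynomial.eval_map,
    Polynomial.aeval_def, algebraMap_int_eq]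
  ring

theorem qFun_eq {n : ℕ} (k : Fin n → ℕ) (ξ v : RealSpace n) :
    qFun k ξ v = qFun k 0 (v + (2 : ℝ)⁻¹ • ξ) := by
  unfold qFun
  congr 2
  refine Finset.prod_congr rfl fun r _ => ?_
  congr 1
  simp
  ring

theorem continuous_qFun {n : ℕ} (k : Fin n → ℕ) (ξ : RealSpace n) : Continuous (qFun k ξ) := by
  unfold qFun
  have := fun r => continuous_hermiteFun (k r)
  fun_prop

theorem memLp_qFun_zero {n : ℕ} (k : Fin n → ℕ) : MemLp (qFun k 0) 2 (lebesgueT n) := by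
  unfold lebesgueT
  refine MemLp.smul_measure ?_ (by simp)
  rw [memLp_two_iff_integrable_sq_norm (continuous_qFun k 0).aestronglyMeasurable]
  have h := (Integrable.fintype_prod (μ := fun _ : Fin n => (volume : Measure ℝ))
    (f := fun r t => hermiteFun (k r) (2 * t / √2) ^ 2)
    fun r => integrable_hermiteFun_sq (k r)).const_mul
      ((2 ^ ((n : ℝ) / 2) * Real.pi ^ ((n : ℝ) / 4)) ^ 2)
  have h' := (PiLp.volume_preserving_ofLp (Fin n)).integrable_comp_of_integrable h
  refine h'.congr (.of_forall fun v => ?_)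
  simp only [Function.comp_apply, qFun, Complex.norm_real, Real.norm_eq_abs, sq_abs, mul_pow,
    Finset.prod_pow, PiLp.zero_apply, zero_add]

theorem measurePreserving_half {n : ℕ} (ξ : RealSpace n) :
    MeasurePreserving (fun v : RealSpace n => v + (2 : ℝ)⁻¹ • ξ) (lebesgueT n) (lebesgueT n) :=
  measurePreserving_add_right _ _

theorem memLp_qFun {n : ℕ} (k : Fin n → ℕ) (ξ : RealSpace n) :
    MemLp (qFun k ξ) 2 (lebesgueT n) := by
  have h := (memLp_qFun_zero k).comp_measurePreserving (measurePreserving_half ξ)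
  exact (memLp_congr_ae (.of_forall fun v => qFun_eq k ξ v)).2 h

/-- `q_{k,ξ}` as an element of `L²(ℝⁿ, μ̃_n)`. -/
def q {n : ℕ} (k : Fin n → ℕ) (ξ : RealSpace n) : Lp ℂ 2 (lebesgueT n) :=
  (memLp_qFun k ξ).toLp (qFun k ξ)

theorem q_eq {n : ℕ} (k : Fin n → ℕ) (ξ : RealSpace n) :
    q k ξ = Lp.compMeasurePreserving _ (measurePreserving_half ξ) (q k 0) := by
  rw [q, q, Lp.toLp_compMeasurePreserving]
  exact MemLp.toLp_congr _ _ (.of_forall fun v => qFun_eq k ξ v)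

theorem continuous_q {n : ℕ} (k : Fin n → ℕ) : Continuous (q (n := n) k) := by
  rw [show q (n := n) k = fun ξ => Lp.compMeasurePreserving _ (measurePreserving_half ξ) (q k 0)
    from funext fun ξ => q_eq k ξ]
  let g : RealSpace n → C(RealSpace n, RealSpace n) := fun ξ =>
    ⟨fun v => v + (2 : ℝ)⁻¹ • ξ, by fun_prop⟩
  have hg : Continuous g := ContinuousMap.continuous_of_continuous_uncurry _ (by
    change Continuous fun p : RealSpace n × RealSpace n => p.2 + (2 : ℝ)⁻¹ • p.1
    fun_prop)
  have : IsLocallyFiniteMeasure (lebesgueT n) := by unfold lebesgueT; infer_instance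
  exact Continuous.compMeasurePreservingLp (f := fun _ => q k 0) (g := g) continuous_const hg
    (fun ξ => measurePreserving_half ξ) (by simp)

theorem norm_q {n : ℕ} (k : Fin n → ℕ) (ξ : RealSpace n) : ‖q k ξ‖ = ‖q k 0‖ := by
  rw [q_eq, Lp.norm_compMeasurePreserving]

/-- The multi-indices `k ∈ ℕ₀ⁿ` with `|k| ≤ m - 1`, with the lexicographic order. -/
def multiIndices (n m : ℕ) : Finset (Lex (Fin n → ℕ)) :=
  ((Fintype.piFinset fun _ : Fin n => Finset.range m).filter fun k => ∑ r, k r < m).map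
    toLex.toEmbedding

theorem mem_multiIndices {n m : ℕ} (k : Fin n → ℕ) :
    toLex k ∈ multiIndices n m ↔ ∑ r, k r < m := by
  simp only [multiIndices, Finset.mem_map_equiv, Finset.mem_filter, Fintype.mem_piFinset,
    Finset.mem_range]
  refine ⟨fun h => h.2, fun h => ⟨fun r => ?_, h⟩⟩
  exact (Finset.single_le_sum (fun _ _ => Nat.zero_le _) (Finset.mem_univ r)).trans_lt h

/-- `d = #{k ∈ ℕ₀ⁿ : |k| ≤ m - 1}`. -/
def dim (n m : ℕ) : ℕ := (multiIndices n m).card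

/-- The increasing enumeration of the multi-indices in the lexicographic order. -/
def enum (n m : ℕ) (j : Fin (dim n m)) : Fin n → ℕ :=
  ofLex ((multiIndices n m).orderEmbOfFin rfl j)

/-- `L²(ℝⁿ, μ̃_n)^d = L²(ℝⁿ, μ̃_n; ℂ^d)`. -/
abbrev L2d (n m : ℕ) := Lp (EuclideanSpace ℂ (Fin (dim n m))) 2 (lebesgueT n)

/-- The operator `h ↦ (⟨h, q_{φ(j),ξ}⟩)_j` from `L²(ℝⁿ, μ̃_n)` to `ℂ^d`. -/
def coeffs (n m : ℕ) (ξ : RealSpace n) :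
    Lp ℂ 2 (lebesgueT n) →L[ℂ] EuclideanSpace ℂ (Fin (dim n m)) :=
  ∑ j, (innerSL ℂ (q (enum n m j) ξ)).smulRight (EuclideanSpace.single j 1)

theorem coeffs_apply (n m : ℕ) (ξ : RealSpace n) (h : Lp ℂ 2 (lebesgueT n)) (j : Fin (dim n m)) :
    coeffs n m ξ h j = inner ℂ (q (enum n m j) ξ) h := by
  simp [coeffs, Pi.single_apply]

theorem memLp_coeffs (n m : ℕ) : MemLp (coeffs n m) ∞ (lebesgueT n) := by
  have hc : Continuous (coeffs n m) := continuous_finsetSum _ fun j _ =>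
    ((ContinuousLinearMap.smulRightL ℂ (Lp ℂ 2 (lebesgueT n))
      (EuclideanSpace ℂ (Fin (dim n m)))).flip (EuclideanSpace.single j 1)).continuous.comp
        ((innerSL ℂ).continuous.comp (continuous_q (enum n m j)))
  refine memLp_top_of_bound hc.aestronglyMeasurable (∑ j : Fin (dim n m), ‖q (enum n m j) 0‖)
    (.of_forall fun ξ => ?_)
  refine (norm_sum_le _ _).trans (Finset.sum_le_sum fun j _ => ?_)
  rw [ContinuousLinearMap.norm_smulRight_apply]
  simp [norm_q]

/-- The operator `(N g)(ξ)_j = ⟨g(ξ, ·), q_{φ(j),ξ}⟩`, for `g ∈ L²(ℝⁿ; L²(ℝⁿ)) = L²(ℝ²ⁿ)`. -/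
def fiberCoeffs (n m : ℕ) : Lp (Lp ℂ 2 (lebesgueT n)) 2 (lebesgueT n) →L[ℂ] L2d n m :=
  (ContinuousLinearMap.id ℂ
    (Lp ℂ 2 (lebesgueT n) →L[ℂ] EuclideanSpace ℂ (Fin (dim n m)))).holderL (lebesgueT n) ∞ 2 2
      ((memLp_coeffs n m).toLp (coeffs n m))

/-- `R_{H_m} = N (F ⊗ I)` on `H_m`. -/
def RH (n m : ℕ) {α : ℝ} (hα : 0 < α) : flatFock n m hα →L[ℂ] L2d n m :=
  fiberCoeffs n m ∘L (fourierT n (Lp ℂ 2 (lebesgueT n))).toContinuousLinearMap ∘L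
    (slice (lebesgueT n) (lebesgueT n)).toContinuousLinearMap ∘L (flatFock n m hα).subtypeL

/-- `R_{F_{α,m}} = R_{H_m} U`. -/
def RF (n m : ℕ) {α : ℝ} (hα : 0 < α) : fock n m α →L[ℂ] L2d n m :=
  RH n m hα ∘L flattenFock n m hα

/-! ### Matrix symbols -/

/-- `L^∞(ℝⁿ)^{d×d}`: essentially bounded matrix functions, with the essential supremum of the
operator norm as the norm. -/
abbrev Symbols (n m : ℕ) := Lp (Matrix (Fin (dim n m)) (Fin (dim n m)) ℂ) ∞ (lebesgueT n)

/-- The pointwise product of matrix functions. -/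
instance (n m : ℕ) : Mul (Symbols n m) where
  mul σ τ := (σ • τ : Symbols n m)

/-- The multiplication operator `(M_σ f)(ξ) = σ(ξ) f(ξ)` on `L²(ℝⁿ, μ̃_n)^d`. -/
def mulOp {n m : ℕ} (σ : Symbols n m) : L2d n m →L[ℂ] L2d n m :=
  (LinearMap.toContinuousLinearMap (Matrix.toEuclideanCLM (n := Fin (dim n m))
    (𝕜 := ℂ)).toAlgEquiv.toLinearMap).holderL (lebesgueT n) ∞ 2 2 σ

theorem coeFn_mul {n m : ℕ} (σ τ : Symbols n m) :
    (σ * τ : Symbols n m) =ᵐ[lebesgueT n] fun ξ => σ ξ * τ ξ :=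
  Lp.coeFn_lpSMul σ τ

theorem coeFn_mulOp {n m : ℕ} (σ : Symbols n m) (f : L2d n m) :
    mulOp σ f =ᵐ[lebesgueT n] fun ξ => WithLp.toLp 2 ((σ ξ).mulVec (f ξ)) :=
  ContinuousLinearMap.coeFn_holder _ σ f

/-- `Λ(σ) = R* M_σ R` for an operator `R` from a Hilbert space to `L²(ℝⁿ, μ̃_n)^d`. -/
def Lam {n m : ℕ} {H : Type*} [NormedAddCommGroup H] [InnerProductSpace ℂ H] [CompleteSpace H]
    (R : H →L[ℂ] L2d n m) (σ : Symbols n m) : H →L[ℂ] H :=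
  ContinuousLinearMap.adjoint R ∘L mulOp σ ∘L R

end
end PolyFock

/-!
The partial Fourier transform in `x` turns the translations of `𝓗_m` into the modulations by
`e^{-i⟨a,ξ⟩}`, and it turns the image under `U` of a monomial `z̄^k` into a nonvanishing function
of `ξ` times `q_{k,ξ}`. For fixed `ξ` the `q_{k,ξ}` form an orthonormal basis of the fibre
`L²(ℝⁿ, μ̃_n)`: this is the completeness of the Hermite functions. A function in `𝓕_{α,m}` is
orthogonal to `z̄^k` for `|k| ≥ m`, as is each of its Weyl translates. Since an integrable
function is determined by its Fourier transform, orthogonality to all modulates is pointwise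
orthogonality of the fibres. Hence the fibres of `(F ⊗ I) g`, for `g` in `𝓗_m`, lie in the span
of the `q_{k,ξ}` with `|k| < m`, which makes `R` isometric, and the Weyl translates of the `z̄^k`
with `|k| < m` show that its range is dense. So `R` is unitary and carries the commutant of the
translations onto that of the modulations on `L²(ℝⁿ, μ̃_n)^d`; an operator in the latter commutes
with the multiplications by all bounded scalar functions and is therefore itself the
multiplication by a bounded matrix symbol.
-/

namespace PolyFock
noncomputable section

open scoped FourierTransform SchwartzMap

/-! ### Uniqueness for the Fourier transform -/

section FourierUniqueness
variable {V E : Type*} [NormedAddCommGroup V] [InnerProductSpace ℝ V] [FiniteDimensional ℝ V]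
  [MeasurableSpace V] [BorelSpace V] [NormedAddCommGroup E] [NormedSpace ℂ E] [CompleteSpace E]

theorem integral_fourier_smul_eq {f : V → ℂ} {g : V → E} (hf : Integrable f) (hg : Integrable g) :
    ∫ ξ, 𝓕 f ξ • g ξ = ∫ x, f x • 𝓕 g x := by
  simpa using! VectorFourier.integral_fourierIntegral_smul_eq_flip (L := innerₗ V)
    Real.continuous_fourierChar continuous_inner hf hg

theorem ae_eq_zero_of_integral_schwartz_smul_eq_zero {f : V → E} (hf : LocallyIntegrable f)
    (h : ∀ g : 𝓢(V, ℂ), ∫ x, g x • f x = 0) : f =ᵐ[volume] 0 := by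
  refine ae_eq_zero_of_integral_contDiff_smul_eq_zero hf fun g hg hgc => ?_
  have hg' : ContDiff ℝ (⊤ : ℕ∞) fun x => (g x : ℂ) := Complex.ofRealCLM.contDiff.comp hg
  have hgc' : HasCompactSupport fun x => (g x : ℂ) := hgc.comp_left (g := fun t : ℝ => (t : ℂ)) rfl
  simpa using h (hgc'.toSchwartzMap hg')

theorem ae_eq_zero_of_fourier_eq_zero {f : V → E} (hf : Integrable f) (h : 𝓕 f = 0) :
    f =ᵐ[volume] 0 := by
  refine ae_eq_zero_of_integral_schwartz_smul_eq_zero hf.locallyIntegrable fun g => ?_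
  have hg : 𝓕 (⇑(𝓕⁻ g : 𝓢(V, ℂ))) = ⇑g := by
    rw [← SchwartzMap.fourier_coe, FourierTransform.fourier_fourierInv_eq]
  have := integral_fourier_smul_eq (𝓕⁻ g : 𝓢(V, ℂ)).integrable hf
  simpa [hg, h] using this

end FourierUniqueness

section LebesgueT
variable {n : ℕ} {E : Type*} [NormedAddCommGroup E] {f : RealSpace n → E}

theorem lebesgueT_eq_ofReal_smul (n : ℕ) :
    lebesgueT n = ENNReal.ofReal ((2 * Real.pi) ^ (-(n : ℝ) / 2)) • volume := rfl

theorem ofReal_two_pi_rpow_ne_zero (s : ℝ) : ENNReal.ofReal ((2 * Real.pi) ^ s) ≠ 0 :=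
  (ENNReal.ofReal_pos.2 (by positivity)).ne'

theorem ae_lebesgueT (n : ℕ) : ae (lebesgueT n) = ae volume := by
  rw [lebesgueT_eq_ofReal_smul]
  exact Measure.ae_ennreal_smul_measure_eq (ofReal_two_pi_rpow_ne_zero _) _

theorem integrable_lebesgueT_iff : Integrable f (lebesgueT n) ↔ Integrable f := by
  rw [lebesgueT_eq_ofReal_smul]
  exact integrable_smul_measure (ofReal_two_pi_rpow_ne_zero _) ENNReal.ofReal_ne_top

theorem memLp_lebesgueT_iff {p : ℝ≥0∞} : MemLp f p (lebesgueT n) ↔ MemLp f p := by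
  rw [lebesgueT_eq_ofReal_smul]
  refine ⟨fun h => ?_, fun h => h.smul_measure ENNReal.ofReal_ne_top⟩
  have hc := ofReal_two_pi_rpow_ne_zero (-(n : ℝ) / 2)
  have h' := h.smul_measure (ENNReal.inv_ne_top.2 hc)
  rwa [smul_smul, ENNReal.inv_mul_cancel hc ENNReal.ofReal_ne_top, one_smul] at h'

theorem integral_lebesgueT [NormedSpace ℝ E] (f : RealSpace n → E) :
    ∫ x, f x ∂lebesgueT n = ((2 * Real.pi) ^ (-(n : ℝ) / 2) : ℝ) • ∫ x, f x := by
  rw [lebesgueT_eq_ofReal_smul, integral_smul_measure, ENNReal.toReal_ofReal (by positivity)]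

end LebesgueT

/-! ### Modulations -/

/-- The character `ξ ↦ e^{-i⟨a,ξ⟩}`. -/
def expChar {n : ℕ} (a ξ : RealSpace n) : ℂ := Complex.exp (-(inner ℝ a ξ : ℝ) * Complex.I)

section ExpChar
variable {n : ℕ} (a b ξ : RealSpace n)

theorem norm_expChar : ‖expChar a ξ‖ = 1 := by
  rw [expChar, ← Complex.ofReal_neg, Complex.norm_exp_ofReal_mul_I]

@[fun_prop]
theorem continuous_expChar : Continuous (expChar a) := by
  unfold expChar; fun_prop

theorem expChar_zero : expChar 0 ξ = 1 := by simp [expChar]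

theorem expChar_add : expChar (a + b) ξ = expChar a ξ * expChar b ξ := by
  rw [expChar, expChar, expChar, ← Complex.exp_add, inner_add_left]
  push_cast
  ring_nf

theorem fourier_inv_two_pi_smul {E : Type*} [NormedAddCommGroup E] [NormedSpace ℂ E]
    (f : RealSpace n → E) : 𝓕 f ((2 * Real.pi)⁻¹ • ξ) = ∫ x, expChar ξ x • f x := by
  rw [Real.fourier_eq']
  congr 1
  funext x
  rw [expChar, inner_smul_right, real_inner_comm]
  congr 2
  have : (Real.pi : ℂ) ≠ 0 := by exact_mod_cast Real.pi_ne_zero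
  push_cast
  field_simp

end ExpChar

theorem ae_eq_zero_of_integral_expChar_smul_eq_zero {n : ℕ} {E : Type*} [NormedAddCommGroup E]
    [NormedSpace ℂ E] [CompleteSpace E] {f : RealSpace n → E} (hf : Integrable f (lebesgueT n))
    (h : ∀ a, ∫ ξ, expChar a ξ • f ξ ∂lebesgueT n = 0) : f =ᵐ[lebesgueT n] 0 := by
  rw [Filter.EventuallyEq, ae_lebesgueT]
  refine ae_eq_zero_of_fourier_eq_zero (integrable_lebesgueT_iff.1 hf) (funext fun ξ => ?_)
  have hξ := h ((2 * Real.pi) • ξ)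
  rwa [integral_lebesgueT, smul_eq_zero_iff_right (by positivity), ← fourier_inv_two_pi_smul,
    inv_smul_smul₀ (by positivity)] at hξ

theorem isWeightedChange_expChar {n : ℕ} (a : RealSpace n) :
    IsWeightedChange id (expChar a) (lebesgueT n) (lebesgueT n) where
  measurable_map := measurable_id
  measurable_weight := (continuous_expChar a).measurable
  lintegral_eq F _ := by simp [← ofReal_norm, norm_expChar]

section Modulation
variable {n : ℕ} {E E' : Type*} [NormedAddCommGroup E] [NormedAddCommGroup E']

/-- The modulation operator `(M_a f)(ξ) = e^{-i⟨a,ξ⟩} f(ξ)` on `L²(ℝⁿ, μ̃_n; E)`, the image of the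
translation by `a` under the Fourier transform. -/
def modulation [NormedSpace ℂ E] (a : RealSpace n) :
    Lp E 2 (lebesgueT n) →ₗᵢ[ℂ] Lp E 2 (lebesgueT n) :=
  weightedComp (isWeightedChange_expChar a)

theorem coeFn_modulation [NormedSpace ℂ E] (a : RealSpace n) (f : Lp E 2 (lebesgueT n)) :
    modulation a f =ᵐ[lebesgueT n] fun ξ => expChar a ξ • f ξ :=
  coeFn_weightedComp (isWeightedChange_expChar a) f

theorem modulation_modulation [NormedSpace ℂ E] (a b : RealSpace n) (f : Lp E 2 (lebesgueT n)) :
    modulation a (modulation b f) = modulation (a + b) f := by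
  refine Lp.ext ?_
  filter_upwards [coeFn_modulation a (modulation b f), coeFn_modulation b f,
    coeFn_modulation (a + b) f] with ξ h₁ h₂ h₃
  rw [h₁, h₂, h₃, expChar_add, mul_smul]

theorem modulation_zero [NormedSpace ℂ E] (f : Lp E 2 (lebesgueT n)) : modulation 0 f = f := by
  refine Lp.ext ?_
  filter_upwards [coeFn_modulation 0 f] with ξ h
  rw [h, expChar_zero, one_smul]

variable [InnerProductSpace ℂ E] [InnerProductSpace ℂ E']

theorem inner_modulation_left (a : RealSpace n) (f g : Lp E 2 (lebesgueT n)) :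
    inner ℂ (modulation a f) g = inner ℂ f (modulation (-a) g) := by
  rw [← (modulation a).inner_map_map f, modulation_modulation, add_neg_cancel, modulation_zero]

theorem inner_modulation_right (a : RealSpace n) (f g : Lp E 2 (lebesgueT n)) :
    inner ℂ f (modulation a g) = ∫ ξ, expChar a ξ • (inner ℂ (f ξ) (g ξ) : ℂ) ∂lebesgueT n := by
  rw [L2.inner_def]
  refine integral_congr_ae ?_
  filter_upwards [coeFn_modulation a g] with ξ h
  rw [h, inner_smul_right, smul_eq_mul]

theorem ae_inner_eq_of_inner_modulation_eq {f g : Lp E 2 (lebesgueT n)}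
    {f' g' : Lp E' 2 (lebesgueT n)}
    (h : ∀ a, (inner ℂ f (modulation a g) : ℂ) = inner ℂ f' (modulation a g')) :
    ∀ᵐ ξ ∂lebesgueT n, (inner ℂ (f ξ) (g ξ) : ℂ) = inner ℂ (f' ξ) (g' ξ) := by
  have integrable_mul : ∀ (a : RealSpace n) {k : RealSpace n → ℂ}, Integrable k (lebesgueT n) →
      Integrable (fun ξ => expChar a ξ • k ξ) (lebesgueT n) := fun a _ hk =>
    hk.bdd_mul (continuous_expChar a).aestronglyMeasurable
      (.of_forall fun ξ => (norm_expChar a ξ).le)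
  have hfg : Integrable (fun ξ => (inner ℂ (f ξ) (g ξ) : ℂ)) (lebesgueT n) :=
    L2.integrable_inner f g
  have hfg' : Integrable (fun ξ => (inner ℂ (f' ξ) (g' ξ) : ℂ)) (lebesgueT n) :=
    L2.integrable_inner f' g'
  have hdiff := ae_eq_zero_of_integral_expChar_smul_eq_zero (hfg.sub hfg') fun a => by
    simp only [Pi.sub_apply, smul_sub]
    rw [integral_sub (integrable_mul a hfg) (integrable_mul a hfg'), ← inner_modulation_right,
      ← inner_modulation_right, h, sub_self]
  filter_upwards [hdiff] with ξ hξ using sub_eq_zero.1 hξ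

end Modulation

section OperatorNorm

variable {X E F : Type*} [MeasurableSpace X] {μ : Measure X} [NormedAddCommGroup E]
  [NormedAddCommGroup F] {p : ℝ≥0∞}

theorem ae_enorm_le_of_forall_eLpNorm_restrict_le [SigmaFinite μ] {f : X → E}
    (hf : AEStronglyMeasurable f μ) (hp₀ : p ≠ 0) (hp : p ≠ ∞) {C : ℝ≥0∞}
    (h : ∀ s, MeasurableSet s → μ s < ∞ → eLpNorm f p (μ.restrict s) ≤ C * μ s ^ (1 / p.toReal)) :
    ∀ᵐ x ∂μ, ‖f x‖ₑ ≤ C := by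
  have hpos : 0 < p.toReal := ENNReal.toReal_pos hp₀ hp
  have hpow := ae_le_of_forall_setLIntegral_le_of_sigmaFinite₀ (g := fun _ => C ^ p.toReal)
    (hf.enorm.pow_const p.toReal) fun s hs hμs => by
      have hle := ENNReal.rpow_le_rpow (h s hs hμs) hpos.le
      rwa [eLpNorm_eq_lintegral_rpow_enorm_toReal hp₀ hp, ENNReal.mul_rpow_of_nonneg _ _ hpos.le,
        ← ENNReal.rpow_mul, ← ENNReal.rpow_mul, one_div_mul_cancel hpos.ne', ENNReal.rpow_one,
        ENNReal.rpow_one, ← setLIntegral_const] at hle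
  filter_upwards [hpow] with x hx using (ENNReal.rpow_le_rpow_iff hpos).1 hx

theorem ae_norm_le_opNorm_of_forall_ae_eq [SigmaFinite μ] [NormedSpace ℂ E] [NormedSpace ℂ F]
    [TopologicalSpace.SeparableSpace E] [Fact (1 ≤ p)] (hp : p ≠ ∞)
    {B : Lp E p μ →L[ℂ] Lp F p μ} {A : X → E →L[ℂ] F}
    (hA : ∀ c, AEStronglyMeasurable (fun x => A x c) μ)
    (h : ∀ u, B u =ᵐ[μ] fun x => A x (u x)) : ∀ᵐ x ∂μ, ‖A x‖ ≤ ‖B‖ := by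
  have hp₀ : p ≠ 0 := (zero_lt_one.trans_le Fact.out).ne'
  have bound (c : E) : ∀ᵐ x ∂μ, ‖A x c‖ₑ ≤ ‖B‖ₑ * ‖c‖ₑ := by
    refine ae_enorm_le_of_forall_eLpNorm_restrict_le (hA c) hp₀ hp fun s hs hμs => ?_
    have hind : s.indicator (fun x => A x c) =ᵐ[μ] B (indicatorConstLp p hs hμs.ne c) := by
      filter_upwards [h (indicatorConstLp p hs hμs.ne c),
        indicatorConstLp_coeFn (p := p) (hs := hs) (hμs := hμs.ne) (c := c)] with x hB hc
      rw [hB, hc]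
      by_cases hx : x ∈ s <;> simp [hx]
    calc eLpNorm (fun x => A x c) p (μ.restrict s)
        = ‖B (indicatorConstLp p hs hμs.ne c)‖ₑ := by
          rw [← eLpNorm_indicator_eq_eLpNorm_restrict hs, eLpNorm_congr_ae hind, Lp.enorm_def]
      _ ≤ ‖B‖ₑ * ‖indicatorConstLp p hs hμs.ne c‖ₑ := B.le_opENorm _
      _ = ‖B‖ₑ * ‖c‖ₑ * μ s ^ (1 / p.toReal) := by
          rw [Lp.enorm_def, eLpNorm_congr_ae indicatorConstLp_coeFn,
            eLpNorm_indicator_const hs hp₀ hp, mul_assoc]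
  filter_upwards [ae_all_iff.2 fun i => bound (TopologicalSpace.denseSeq E i)] with x hx
  refine ContinuousLinearMap.opNorm_le_bound _ (norm_nonneg _) fun c => ?_
  refine (TopologicalSpace.denseRange_denseSeq E).induction_on
    (p := fun c => ‖A x c‖ ≤ ‖B‖ * ‖c‖) c (isClosed_le (by fun_prop) (by fun_prop)) fun i => ?_
  simpa [← toReal_enorm] using
    ENNReal.toReal_mono (ENNReal.mul_ne_top enorm_ne_top enorm_ne_top) (hx i)

end OperatorNorm

section MulOp

variable {n m : ℕ}

theorem coeFn_mulOp_clm (σ : Symbols n m) (f : L2d n m) :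
    mulOp σ f =ᵐ[lebesgueT n] fun ξ => Matrix.toEuclideanCLM (𝕜 := ℂ) (σ ξ) (f ξ) :=
  ContinuousLinearMap.coeFn_holder _ σ f

theorem mulOp_add (σ τ : Symbols n m) : mulOp (σ + τ) = mulOp σ + mulOp τ := map_add _ σ τ

theorem mulOp_smul (c : ℂ) (σ : Symbols n m) : mulOp (c • σ) = c • mulOp σ := map_smul _ c σ

theorem mulOp_mul (σ τ : Symbols n m) : mulOp (σ * τ) = mulOp σ * mulOp τ := by
  refine ContinuousLinearMap.ext fun f => Lp.ext ?_
  filter_upwards [coeFn_mulOp_clm (σ * τ) f, coeFn_mulOp_clm σ (mulOp τ f), coeFn_mulOp_clm τ f,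
    coeFn_mul σ τ] with ξ hστf hστ' hτf hστ
  rw [mul_apply_eq_comp, hστf, hστ', hτf, hστ, map_mul, mul_apply_eq_comp]

theorem mulOp_star (σ : Symbols n m) : mulOp (star σ) = star (mulOp σ) := by
  rw [ContinuousLinearMap.star_eq_adjoint, ContinuousLinearMap.eq_adjoint_iff]
  intro f g
  rw [L2.inner_def, L2.inner_def]
  refine integral_congr_ae ?_
  filter_upwards [coeFn_mulOp_clm (star σ) f, coeFn_mulOp_clm σ g, Lp.coeFn_star σ]
    with ξ hf hg hσ
  rw [hf, hg, hσ, Pi.star_apply, map_star, ContinuousLinearMap.star_eq_adjoint,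
    ContinuousLinearMap.adjoint_inner_left]

theorem aestronglyMeasurable_toEuclideanCLM_apply {X ι : Type*} [MeasurableSpace X] {μ : Measure X}
    [Fintype ι] [DecidableEq ι] {A : X → Matrix ι ι ℂ} (hA : AEStronglyMeasurable A μ)
    (c : EuclideanSpace ℂ ι) :
    AEStronglyMeasurable (fun x => Matrix.toEuclideanCLM (𝕜 := ℂ) (A x) c) μ :=
  (LinearMap.continuous_of_finiteDimensional ((ContinuousLinearMap.apply ℂ _ c).toLinearMap ∘ₗ
    (Matrix.toEuclideanCLM (n := ι) (𝕜 := ℂ)).toAlgEquiv.toLinearMap)).comp_aestronglyMeasurable hA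

theorem ae_norm_le_of_forall_ae_eq_toEuclideanCLM {X ι : Type*} [MeasurableSpace X] {μ : Measure X}
    [SigmaFinite μ] [Fintype ι] [DecidableEq ι] {p : ℝ≥0∞} [Fact (1 ≤ p)] (hp : p ≠ ∞)
    {B : Lp (EuclideanSpace ℂ ι) p μ →L[ℂ] Lp (EuclideanSpace ℂ ι) p μ} {A : X → Matrix ι ι ℂ}
    (hA : AEStronglyMeasurable A μ)
    (h : ∀ u, B u =ᵐ[μ] fun x => Matrix.toEuclideanCLM (𝕜 := ℂ) (A x) (u x)) :
    ∀ᵐ x ∂μ, ‖A x‖ ≤ ‖B‖ := by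
  simpa only [Matrix.cstar_norm_def] using
    ae_norm_le_opNorm_of_forall_ae_eq hp (aestronglyMeasurable_toEuclideanCLM_apply hA) h

theorem ae_norm_le_norm_Lp_top {X E : Type*} [MeasurableSpace X] {μ : Measure X}
    [NormedAddCommGroup E] (f : Lp E ∞ μ) : ∀ᵐ x ∂μ, ‖f x‖ ≤ ‖f‖ := by
  have hf : eLpNormEssSup f μ ≠ ∞ := eLpNorm_exponent_top (f := f) ▸ Lp.eLpNorm_ne_top f
  filter_upwards [ae_le_eLpNormEssSup (f := f) (μ := μ)] with x hx
  rw [Lp.norm_def, eLpNorm_exponent_top, ← toReal_enorm]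
  exact ENNReal.toReal_mono hf hx

theorem norm_mulOp (σ : Symbols n m) : ‖mulOp σ‖ = ‖σ‖ := by
  refine le_antisymm ?_ ?_
  · refine ContinuousLinearMap.opNorm_le_bound _ (norm_nonneg _) fun f => ?_
    refine Lp.norm_le_mul_norm_of_ae_le_mul ?_
    filter_upwards [coeFn_mulOp_clm σ f, ae_norm_le_norm_Lp_top σ] with ξ hf hσ
    rw [hf]
    refine (ContinuousLinearMap.le_opNorm _ _).trans ?_
    rw [← Matrix.cstar_norm_def]
    gcongr
  · have h := ae_norm_le_of_forall_ae_eq_toEuclideanCLM ENNReal.ofNat_ne_top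
      (Lp.aestronglyMeasurable σ) (coeFn_mulOp_clm σ)
    rw [Lp.norm_def, eLpNorm_exponent_top]
    exact ENNReal.toReal_le_of_le_ofReal (norm_nonneg _) (eLpNormEssSup_le_of_ae_bound h)

theorem modulation_mulOp (a : RealSpace n) (σ : Symbols n m) (f : L2d n m) :
    modulation a (mulOp σ f) = mulOp σ (modulation a f) := by
  refine Lp.ext ?_
  filter_upwards [coeFn_modulation a (mulOp σ f), coeFn_mulOp_clm σ f,
    coeFn_mulOp_clm σ (modulation a f), coeFn_modulation a f] with ξ hl hf hr ha
  rw [hl, hf, hr, ha, map_smul]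

end MulOp

section OfCommutesModulation

variable {n : ℕ}

theorem integrable_exp_neg_mul_sq_norm {V : Type*} [NormedAddCommGroup V] [InnerProductSpace ℝ V]
    [FiniteDimensional ℝ V] [MeasurableSpace V] [BorelSpace V] {b : ℝ} (hb : 0 < b) :
    Integrable fun v : V => Real.exp (-b * ‖v‖ ^ 2) := by
  refine (GaussianFourier.integrable_cexp_neg_mul_sq_norm_add (b := (b : ℂ)) (by simpa using hb) 0
    (0 : V)).norm.congr (.of_forall fun v => ?_)
  simp only [Complex.norm_exp]
  congr 1
  simp [← Complex.ofReal_pow]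

theorem memLp_exp_neg_mul_sq_norm (n : ℕ) {b : ℝ} (hb : 0 < b) :
    MemLp (fun ξ : RealSpace n => (Real.exp (-b * ‖ξ‖ ^ 2) : ℂ)) 2 (lebesgueT n) := by
  have hc : Continuous fun ξ : RealSpace n => (Real.exp (-b * ‖ξ‖ ^ 2) : ℂ) := by fun_prop
  rw [memLp_lebesgueT_iff, memLp_two_iff_integrable_sq_norm hc.aestronglyMeasurable]
  refine (integrable_exp_neg_mul_sq_norm (b := 2 * b) (by positivity)).congr
    (.of_forall fun ξ => ?_)
  simp only [Complex.norm_real, Real.norm_eq_abs, Real.abs_exp, ← Real.exp_nat_mul]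
  congr 1
  ring

/-- The function `ξ ↦ e^{-|ξ|²} v` of `L²(ℝⁿ, μ̃_n; E)`: a substitute for the constant function `v`,
which is not square integrable. -/
def gaussianSmul {E : Type*} [NormedAddCommGroup E] [NormedSpace ℂ E] (n : ℕ) (v : E) :
    Lp E 2 (lebesgueT n) :=
  ((ContinuousLinearMap.toSpanSingleton ℂ v).comp_memLp'
    (memLp_exp_neg_mul_sq_norm n one_pos)).toLp _

theorem coeFn_gaussianSmul {E : Type*} [NormedAddCommGroup E] [NormedSpace ℂ E] (v : E) :
    gaussianSmul n v =ᵐ[lebesgueT n] fun ξ => (Real.exp (-1 * ‖ξ‖ ^ 2) : ℂ) • v :=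
  MemLp.coeFn_toLp _

theorem stronglyMeasurable_matrix {X ι : Type*} [MeasurableSpace X] [Finite ι]
    {A : X → Matrix ι ι ℂ} (hA : ∀ i j, StronglyMeasurable fun x => A x i j) :
    StronglyMeasurable A := by
  classical
  cases nonempty_fintype ι
  have hsum : A = fun x => ∑ i, ∑ j, A x i j • Matrix.single i j (1 : ℂ) := by
    funext x
    conv_lhs => rw [Matrix.matrix_eq_sum_single (A x)]
    simp [Matrix.smul_single]
  rw [hsum]
  exact Finset.stronglyMeasurable_fun_sum _ fun i _ => Finset.stronglyMeasurable_fun_sum _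
    fun j _ => (hA i j).smul_const _

variable {ι : Type*} [Fintype ι]
  {B : Lp (EuclideanSpace ℂ ι) 2 (lebesgueT n) →L[ℂ] Lp (EuclideanSpace ℂ ι) 2 (lebesgueT n)}

theorem ae_inner_adjoint_eq_of_commute_modulation
    (hB : ∀ a u, B (modulation a u) = modulation a (B u))
    (w u : Lp (EuclideanSpace ℂ ι) 2 (lebesgueT n)) :
    ∀ᵐ ξ ∂lebesgueT n,
      (inner ℂ (ContinuousLinearMap.adjoint B w ξ) (u ξ) : ℂ) = inner ℂ (w ξ) (B u ξ) :=
  ae_inner_eq_of_inner_modulation_eq fun a => by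
    rw [ContinuousLinearMap.adjoint_inner_left, hB]

variable [DecidableEq ι]

/-- The matrix function by which an operator `B` on `L²(ℝⁿ, μ̃_n; ℂ^ι)` commuting with all
modulations acts. Its `i`-th row is the conjugate of `B* (e^{-|ξ|²} e_i)`, divided by
`e^{-|ξ|²}`. -/
def symbolOf
    (B : Lp (EuclideanSpace ℂ ι) 2 (lebesgueT n) →L[ℂ] Lp (EuclideanSpace ℂ ι) 2 (lebesgueT n))
    (ξ : RealSpace n) : Matrix ι ι ℂ :=
  Matrix.of fun i j => (Real.exp (-1 * ‖ξ‖ ^ 2) : ℂ)⁻¹ * (starRingEnd ℂ)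
    (ContinuousLinearMap.adjoint B (gaussianSmul n (EuclideanSpace.single i (1 : ℂ))) ξ j)

variable (B) in
theorem stronglyMeasurable_symbolOf : StronglyMeasurable (symbolOf B) := by
  refine stronglyMeasurable_matrix fun i j => ?_
  have hgauss : StronglyMeasurable fun ξ : RealSpace n => (Real.exp (-1 * ‖ξ‖ ^ 2) : ℂ)⁻¹ :=
    Measurable.stronglyMeasurable (by fun_prop)
  exact hgauss.mul ((Complex.continuous_conj.comp
    (EuclideanSpace.proj (𝕜 := ℂ) j).continuous).comp_stronglyMeasurable (Lp.stronglyMeasurable _))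

theorem ae_eq_symbolOf_apply (hB : ∀ a u, B (modulation a u) = modulation a (B u))
    (u : Lp (EuclideanSpace ℂ ι) 2 (lebesgueT n)) :
    B u =ᵐ[lebesgueT n] fun ξ => Matrix.toEuclideanCLM (𝕜 := ℂ) (symbolOf B ξ) (u ξ) := by
  filter_upwards [ae_all_iff.2 fun i => ae_inner_adjoint_eq_of_commute_modulation hB
      (gaussianSmul n (EuclideanSpace.single i (1 : ℂ))) u,
    ae_all_iff.2 fun i : ι => coeFn_gaussianSmul (n := n) (EuclideanSpace.single i (1 : ℂ))]
    with ξ hadj hgauss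
  ext i
  have hne : (Real.exp (-1 * ‖ξ‖ ^ 2) : ℂ) ≠ 0 := by exact_mod_cast (Real.exp_pos _).ne'
  have hi := hadj i
  rw [hgauss i, inner_smul_left, EuclideanSpace.inner_single_left, PiLp.inner_apply,
    Complex.conj_ofReal, map_one, one_mul] at hi
  rw [Matrix.ofLp_toEuclideanCLM, Matrix.mulVec, dotProduct]
  simp only [symbolOf, Matrix.of_apply, mul_assoc, ← Finset.mul_sum]
  rw [eq_inv_mul_iff_mul_eq₀ hne, ← hi]
  exact Finset.sum_congr rfl fun j _ => by rw [RCLike.inner_apply, mul_comm]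

end OfCommutesModulation

theorem exists_mulOp_eq_of_commute_modulation {n m : ℕ} {B : L2d n m →L[ℂ] L2d n m}
    (hB : ∀ a u, B (modulation a u) = modulation a (B u)) : ∃ σ : Symbols n m, mulOp σ = B := by
  have hmeas := (stronglyMeasurable_symbolOf B).aestronglyMeasurable (μ := lebesgueT n)
  have hbound := ae_norm_le_of_forall_ae_eq_toEuclideanCLM ENNReal.ofNat_ne_top hmeas
    (ae_eq_symbolOf_apply hB)
  have hmem := memLp_top_of_bound hmeas ‖B‖ hbound
  refine ⟨hmem.toLp _, ContinuousLinearMap.ext fun u => Lp.ext ?_⟩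
  filter_upwards [coeFn_mulOp_clm (hmem.toLp _) u, ae_eq_symbolOf_apply hB u, hmem.coeFn_toLp]
    with ξ hmul hu hσ
  rw [hmul, hu, hσ]

section Commutant

variable {H : Type*} [NormedAddCommGroup H] [InnerProductSpace ℂ H] [CompleteSpace H]

/-- The commutant of `S ∪ S*`, as a von Neumann algebra. -/
def commutantVN (S : Set (H →L[ℂ] H)) : VonNeumannAlgebra H where
  toStarSubalgebra := StarSubalgebra.centralizer ℂ S
  centralizer_centralizer' := Set.centralizer_centralizer_centralizer _

theorem coe_commutantVN {S : Set (H →L[ℂ] H)} (hS : ∀ T ∈ S, star T ∈ S) :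
    (commutantVN S : Set (H →L[ℂ] H)) = Set.centralizer S := by
  change Set.centralizer (S ∪ star S) = Set.centralizer S
  rw [Set.union_eq_self_of_subset_right fun T hT => by simpa using hS _ hT]

variable {n m : ℕ} (U : H ≃ₗᵢ[ℂ] L2d n m)

theorem Lam_apply (σ : Symbols n m) (x : H) :
    Lam (U : H →L[ℂ] L2d n m) σ x = U.symm (mulOp σ (U x)) := by
  rw [Lam, LinearIsometryEquiv.adjoint_eq_symm]
  rfl

theorem Lam_eq_conjStarAlgEquiv (σ : Symbols n m) :
    Lam (U : H →L[ℂ] L2d n m) σ = U.conjStarAlgEquiv.symm (mulOp σ) := by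
  ext x
  rw [Lam_apply, LinearIsometryEquiv.symm_conjStarAlgEquiv_apply_apply]

theorem Lam_add (σ τ : Symbols n m) :
    Lam (U : H →L[ℂ] L2d n m) (σ + τ) = Lam (U : H →L[ℂ] L2d n m) σ + Lam U τ := by
  ext x
  simp only [Lam_apply, mulOp_add, add_apply, map_add]

theorem Lam_smul (c : ℂ) (σ : Symbols n m) :
    Lam (U : H →L[ℂ] L2d n m) (c • σ) = c • Lam (U : H →L[ℂ] L2d n m) σ := by
  ext x
  simp only [Lam_apply, mulOp_smul, smul_apply, map_smul]

theorem Lam_mul (σ τ : Symbols n m) :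
    Lam (U : H →L[ℂ] L2d n m) (σ * τ) = Lam (U : H →L[ℂ] L2d n m) σ * Lam U τ := by
  simp only [Lam_eq_conjStarAlgEquiv, mulOp_mul, map_mul]

theorem Lam_star (σ : Symbols n m) :
    Lam (U : H →L[ℂ] L2d n m) (star σ) = star (Lam (U : H →L[ℂ] L2d n m) σ) := by
  simp only [Lam_eq_conjStarAlgEquiv, mulOp_star, map_star]

theorem norm_Lam (σ : Symbols n m) : ‖Lam (U : H →L[ℂ] L2d n m) σ‖ = ‖σ‖ := by
  rw [← norm_mulOp, Lam_eq_conjStarAlgEquiv, StarAlgEquiv.norm_map]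

variable {U} {ρ : RealSpace n → H →L[ℂ] H} {s : ℝ}

theorem star_mem_range_of_map_eq_modulation (hρ : ∀ a x, U (ρ a x) = modulation (s • a) (U x)) :
    ∀ T ∈ Set.range ρ, star T ∈ Set.range ρ := by
  rintro _ ⟨a, rfl⟩
  refine ⟨-a, ?_⟩
  rw [ContinuousLinearMap.star_eq_adjoint, ContinuousLinearMap.eq_adjoint_iff]
  intro x y
  rw [← U.inner_map_map, ← U.inner_map_map x, hρ, hρ, inner_modulation_left, smul_neg, neg_neg]

theorem Lam_mem_centralizer (hρ : ∀ a x, U (ρ a x) = modulation (s • a) (U x)) (σ : Symbols n m) :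
    Lam (U : H →L[ℂ] L2d n m) σ ∈ Set.centralizer (Set.range ρ) := by
  rintro _ ⟨a, rfl⟩
  ext x
  rw [Lam_eq_conjStarAlgEquiv]
  refine U.injective ?_
  simp only [mul_apply_eq_comp, LinearIsometryEquiv.symm_conjStarAlgEquiv_apply_apply, hρ,
    LinearIsometryEquiv.apply_symm_apply, modulation_mulOp]

theorem exists_Lam_eq_of_mem_centralizer (hs : s ≠ 0)
    (hρ : ∀ a x, U (ρ a x) = modulation (s • a) (U x)) {T : H →L[ℂ] H}
    (hT : T ∈ Set.centralizer (Set.range ρ)) :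
    ∃ σ : Symbols n m, Lam (U : H →L[ℂ] L2d n m) σ = T := by
  have hcomm : ∀ a u, U.conjStarAlgEquiv T (modulation a u) =
      modulation a (U.conjStarAlgEquiv T u) := fun a u => by
    have hTa := DFunLike.congr_fun (hT (ρ (s⁻¹ • a)) ⟨_, rfl⟩) (U.symm u)
    have hmod : U.symm (modulation a u) = ρ (s⁻¹ • a) (U.symm u) := by
      rw [U.symm_apply_eq, hρ, smul_inv_smul₀ hs, U.apply_symm_apply]
    simp only [LinearIsometryEquiv.conjStarAlgEquiv_apply_apply, hmod]
    rw [mul_apply_eq_comp, mul_apply_eq_comp] at hTa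
    rw [← hTa, hρ, smul_inv_smul₀ hs]
  obtain ⟨σ, hσ⟩ := exists_mulOp_eq_of_commute_modulation hcomm
  exact ⟨σ, by rw [Lam_eq_conjStarAlgEquiv, hσ, StarAlgEquiv.symm_apply_apply]⟩

theorem exists_vonNeumann_starAlgEquiv (hs : s ≠ 0)
    (hρ : ∀ a x, U (ρ a x) = modulation (s • a) (U x)) :
    ∃ A : VonNeumannAlgebra H, (A : Set (H →L[ℂ] H)) = Set.centralizer (Set.range ρ) ∧
      ∃ Φ : Symbols n m ≃⋆ₐ[ℂ] A.toStarSubalgebra, Isometry Φ ∧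
        ∀ σ, (Φ σ : H →L[ℂ] H) = Lam (U : H →L[ℂ] L2d n m) σ := by
  have hcoe := coe_commutantVN (star_mem_range_of_map_eq_modulation hρ)
  have hmem (T : H →L[ℂ] H) :
      T ∈ (commutantVN (Set.range ρ)).toStarSubalgebra ↔ T ∈ Set.centralizer (Set.range ρ) :=
    Set.ext_iff.1 hcoe T
  let Ψ : Symbols n m →+ (commutantVN (Set.range ρ)).toStarSubalgebra :=
    { toFun := fun σ => ⟨Lam (U : H →L[ℂ] L2d n m) σ,
        (hmem _).2 (Lam_mem_centralizer hρ σ)⟩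
      map_zero' := Subtype.ext (by simpa using Lam_smul U 0 0)
      map_add' := fun σ τ => Subtype.ext (Lam_add U σ τ) }
  have hiso : Isometry Ψ := AddMonoidHomClass.isometry_of_norm Ψ (norm_Lam U)
  have hsurj : Function.Surjective Ψ := fun T =>
    (exists_Lam_eq_of_mem_centralizer hs hρ ((hmem T).1 T.2)).imp fun _ => Subtype.ext
  exact ⟨commutantVN (Set.range ρ), hcoe,
    { Equiv.ofBijective Ψ ⟨hiso.injective, hsurj⟩ with
      map_mul' := fun σ τ => Subtype.ext (Lam_mul U σ τ)
      map_add' := Ψ.map_add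
      map_star' := fun σ => Subtype.ext (Lam_star U σ)
      map_smul' := fun c σ => Subtype.ext (Lam_smul U c σ) }, hiso, fun _ => rfl⟩

end Commutant

/-! ### Hermite functions -/

section Hermite

open Polynomial

theorem integrable_eval_mul_exp (p : ℝ[X]) {b : ℝ} (hb : 0 < b) :
    Integrable fun t : ℝ => p.eval t * Real.exp (-b * t ^ 2) := by
  induction p using Polynomial.induction_on' with
  | add p q hp hq =>
    simp only [eval_add, add_mul]
    exact hp.add hq
  | monomial j c =>
    have h := (integrable_rpow_mul_exp_neg_mul_sq hb (s := j)
      (neg_one_lt_zero.trans_le j.cast_nonneg)).const_mul c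
    simpa [eval_monomial, mul_assoc] using h

/-- The probabilists' Hermite polynomial `He_k` over `ℝ`. -/
def hermiteR (k : ℕ) : ℝ[X] := (hermite k).map (Int.castRingHom ℝ)

theorem hermiteR_succ (k : ℕ) : hermiteR (k + 1) = X * hermiteR k - derivative (hermiteR k) := by
  simp [hermiteR, hermite_succ, derivative_map]

theorem eval_hermiteR (k : ℕ) (t : ℝ) : (hermiteR k).eval t = aeval t (hermite k) :=
  eval_map_algebraMap (hermite k) t

theorem natDegree_hermiteR (k : ℕ) : (hermiteR k).natDegree = k := by
  rw [hermiteR, natDegree_map_eq_of_injective (RingHom.injective_int _), natDegree_hermite]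

theorem iterate_derivative_hermiteR_self (k : ℕ) :
    derivative^[k] (hermiteR k) = C (k.factorial : ℝ) := by
  have hdeg : (derivative^[k] (hermiteR k)).natDegree ≤ 0 :=
    (natDegree_iterate_derivative _ _).trans (by rw [natDegree_hermiteR, Nat.sub_self])
  rw [eq_C_of_natDegree_le_zero hdeg, coeff_iterate_derivative, zero_add, Nat.descFactorial_self]
  simp [hermiteR]

theorem integral_derivative_sub_mul_exp (p : ℝ[X]) :
    ∫ t : ℝ, (derivative p - X * p).eval t * Real.exp (-(1 / 2) * t ^ 2) = 0 := by
  refine integral_eq_zero_of_hasDerivAt_of_integrable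
    (f := fun t => p.eval t * Real.exp (-(1 / 2) * t ^ 2)) (fun t => ?_)
    (integrable_eval_mul_exp _ (by norm_num)) (integrable_eval_mul_exp _ (by norm_num))
  have hexp : HasDerivAt (fun t : ℝ => Real.exp (-(1 / 2) * t ^ 2))
      (Real.exp (-(1 / 2) * t ^ 2) * (-(1 / 2) * (2 * t))) t := by
    simpa using ((hasDerivAt_pow 2 t).const_mul (-(1 / 2) : ℝ)).exp
  refine ((p.hasDerivAt t).mul hexp).congr_deriv ?_
  simp only [eval_sub, eval_mul, eval_X]
  ring

theorem integral_hermiteR_mul (k : ℕ) (p : ℝ[X]) :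
    ∫ t : ℝ, (hermiteR k * p).eval t * Real.exp (-(1 / 2) * t ^ 2) =
      ∫ t : ℝ, (derivative^[k] p).eval t * Real.exp (-(1 / 2) * t ^ 2) := by
  induction k generalizing p with
  | zero => simp [hermiteR]
  | succ k ih =>
    rw [Function.iterate_succ, Function.comp_apply, ← ih, ← sub_eq_zero, ← integral_sub
      (integrable_eval_mul_exp _ (by norm_num)) (integrable_eval_mul_exp _ (by norm_num)),
      ← neg_eq_zero, ← integral_neg, ← integral_derivative_sub_mul_exp (hermiteR k * p)]
    refine integral_congr_ae (.of_forall fun t => ?_)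
    simp only [hermiteR_succ, derivative_mul, eval_sub, eval_add, eval_mul, eval_X]
    ring

theorem integral_hermiteR_mul_hermiteR (j k : ℕ) :
    ∫ t : ℝ, (hermiteR j).eval t * (hermiteR k).eval t * Real.exp (-(1 / 2) * t ^ 2) =
      if j = k then (k.factorial : ℝ) * √(2 * Real.pi) else 0 := by
  wlog hkj : k ≤ j generalizing j k
  · rw [if_neg (by lia), ← (this k j (by lia)).trans (if_neg (by lia))]
    simp only [mul_comm (eval _ (hermiteR j))]
  simp only [← eval_mul]
  rw [integral_hermiteR_mul]
  split_ifs with hjk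
  · simp only [hjk, iterate_derivative_hermiteR_self, eval_C]
    rw [integral_const_mul, integral_gaussian]
    congr 2
    field_simp
  · rw [iterate_derivative_eq_zero (by rw [natDegree_hermiteR]; lia)]
    simp

end Hermite

/-- The Hermite function `√(2 / k!) e^{-t²} He_k(2t)`, normalized in `L²(ℝ, (2π)^{-1/2} dt)`; the
fiber function `q_{k,0}` is the tensor product of these. -/
def hermiteGauss (k : ℕ) (t : ℝ) : ℝ :=
  √(2 / k.factorial) * (Real.exp (-t ^ 2) * (hermiteR k).eval (2 * t))

theorem hermiteGauss_eq_hermiteFun (k : ℕ) (t : ℝ) :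
    hermiteGauss k t = √2 * Real.pi ^ (1 / 4 : ℝ) * hermiteFun k (2 * t / √2) := by
  have harg : √2 * (2 * t / √2) = 2 * t := by field_simp
  have hsq : -(1 / 2) * (2 * t / √2) ^ 2 = -t ^ 2 := by
    rw [div_pow, Real.sq_sqrt zero_le_two]
    ring
  have hpow : ((2 : ℝ) ^ k) ^ (-(1 / 2) : ℝ) * 2 ^ ((k : ℝ) / 2) = 1 := by
    rw [← Real.rpow_natCast, ← Real.rpow_mul zero_le_two, ← Real.rpow_add zero_lt_two]
    convert Real.rpow_zero (2 : ℝ) using 2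
    ring
  have hpi : Real.pi ^ (1 / 4 : ℝ) * √Real.pi ^ (-(1 / 2) : ℝ) = 1 := by
    rw [Real.sqrt_eq_rpow, ← Real.rpow_mul Real.pi_pos.le, ← Real.rpow_add Real.pi_pos]
    norm_num
  have hfact : √(2 / k.factorial) = √2 * (k.factorial : ℝ) ^ (-(1 / 2) : ℝ) := by
    rw [Real.sqrt_div zero_le_two, Real.rpow_neg (by positivity), ← Real.sqrt_eq_rpow,
      div_eq_mul_inv]
  rw [hermiteGauss, hermiteFun, harg, hsq, hfact, ← eval_hermiteR,
    Real.mul_rpow (by positivity) (by positivity), Real.mul_rpow (by positivity) (by positivity)]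
  linear_combination -√2 * (k.factorial : ℝ) ^ (-(1 / 2) : ℝ) * Real.exp (-t ^ 2) *
    (hermiteR k).eval (2 * t) * (Real.pi ^ (1 / 4 : ℝ) * √Real.pi ^ (-(1 / 2) : ℝ) * hpow + hpi)

theorem integral_hermiteGauss_mul_hermiteGauss (j k : ℕ) :
    ∫ t : ℝ, hermiteGauss j t * hermiteGauss k t = if j = k then √(2 * Real.pi) else 0 := by
  have hscale : ∀ t : ℝ, hermiteGauss j t * hermiteGauss k t =
      √(2 / j.factorial) * √(2 / k.factorial) * ((hermiteR j).eval (2 * t) *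
        (hermiteR k).eval (2 * t) * Real.exp (-(1 / 2) * (2 * t) ^ 2)) := by
    intro t
    have hexp : Real.exp (-(1 / 2) * (2 * t) ^ 2) = Real.exp (-t ^ 2) * Real.exp (-t ^ 2) := by
      rw [← Real.exp_add]
      ring_nf
    rw [hermiteGauss, hermiteGauss, hexp]
    ring
  simp only [hscale]
  rw [integral_const_mul, Measure.integral_comp_mul_left (fun t => (hermiteR j).eval t *
    (hermiteR k).eval t * Real.exp (-(1 / 2) * t ^ 2)), integral_hermiteR_mul_hermiteR]
  split_ifs with hjk
  · have hk : (k.factorial : ℝ) ≠ 0 := by positivity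
    rw [hjk, Real.mul_self_sqrt (by positivity), abs_of_pos (by norm_num), smul_eq_mul]
    field_simp
  · simp

section TensorProducts

variable {ι 𝕜 : Type*} [Fintype ι] [RCLike 𝕜]

theorem integral_prod_coord (f : ι → ℝ → 𝕜) :
    ∫ v : EuclideanSpace ℝ ι, ∏ r, f r (v r) = ∏ r, ∫ t, f r t := by
  rw [← integral_fintype_prod_eq_prod (μ := fun _ => volume), ← volume_pi]
  exact (EuclideanSpace.volume_preserving_symm_measurableEquiv_toLp ι).integral_comp'
    (fun x : ι → ℝ => ∏ r, f r (x r))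

theorem integrable_prod_coord {f : ι → ℝ → 𝕜} (hf : ∀ r, Integrable (f r)) :
    Integrable fun v : EuclideanSpace ℝ ι => ∏ r, f r (v r) :=
  (PiLp.volume_preserving_ofLp ι).integrable_comp_of_integrable
    (Integrable.fintype_prod (μ := fun _ : ι => (volume : Measure ℝ)) hf)

end TensorProducts

section Fibers

variable {n : ℕ}

theorem integral_prod_coord_lebesgueT {𝕜 : Type*} [RCLike 𝕜] (f : Fin n → ℝ → 𝕜) :
    ∫ v, ∏ r, f r (v r) ∂lebesgueT n =
      ∏ r, (((2 * Real.pi) ^ (-(1 / 2) : ℝ) : ℝ) : 𝕜) * ∫ t, f r t := by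
  have hconst : ((2 * Real.pi) ^ (-(n : ℝ) / 2) : ℝ) = ((2 * Real.pi) ^ (-(1 / 2) : ℝ)) ^ n := by
    rw [← Real.rpow_mul_natCast (by positivity)]
    ring_nf
  rw [integral_lebesgueT, integral_prod_coord, Finset.prod_mul_distrib, RCLike.real_smul_eq_coe_mul,
    hconst]
  simp

theorem qFun_eq_prod_hermiteGauss (k : Fin n → ℕ) (ξ v : RealSpace n) :
    qFun k ξ v = ∏ r, (hermiteGauss (k r) (ξ r / 2 + v r) : ℂ) := by
  have htwo : (2 : ℝ) ^ ((n : ℝ) / 2) = √2 ^ n := by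
    rw [Real.sqrt_eq_rpow, ← Real.rpow_mul_natCast zero_le_two]
    ring_nf
  have hpi : Real.pi ^ ((n : ℝ) / 4) = (Real.pi ^ (1 / 4 : ℝ)) ^ n := by
    rw [← Real.rpow_mul_natCast Real.pi_pos.le]
    ring_nf
  have harg : ∀ r, 2 * (ξ r / 2 + v r) = ξ r + 2 * v r := fun r => by ring
  rw [qFun, ← Complex.ofReal_prod]
  simp only [hermiteGauss_eq_hermiteFun, harg, Finset.prod_mul_distrib, Finset.prod_const,
    Finset.card_univ, Fintype.card_fin, htwo, hpi]

theorem inner_eq_integral_qFun_mul (k : Fin n → ℕ) (ξ : RealSpace n) (u : Lp ℂ 2 (lebesgueT n)) :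
    inner ℂ (q k ξ) u = ∫ v, qFun k ξ v * u v ∂lebesgueT n := by
  rw [L2.inner_def]
  refine integral_congr_ae ?_
  filter_upwards [(memLp_qFun k ξ).coeFn_toLp] with v hv
  rw [q, hv, RCLike.inner_apply, qFun, Complex.conj_ofReal, mul_comm]

theorem inner_q_zero (k l : Fin n → ℕ) :
    inner ℂ (q k 0) (q l 0) = if k = l then (1 : ℂ) else 0 := by
  have hprod : (fun v => qFun k 0 v * (q l 0 : RealSpace n → ℂ) v) =ᵐ[lebesgueT n]
      fun v => ∏ r, ((hermiteGauss (k r) (v r) * hermiteGauss (l r) (v r) : ℝ) : ℂ) := by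
    filter_upwards [(memLp_qFun l 0).coeFn_toLp] with v hv
    rw [q, hv, qFun_eq_prod_hermiteGauss, qFun_eq_prod_hermiteGauss, ← Finset.prod_mul_distrib]
    simp
  have hone : (2 * Real.pi) ^ (-(1 / 2) : ℝ) * √(2 * Real.pi) = 1 := by
    rw [Real.sqrt_eq_rpow, ← Real.rpow_add (by positivity)]
    norm_num
  rw [inner_eq_integral_qFun_mul, integral_congr_ae hprod, integral_prod_coord_lebesgueT (𝕜 := ℂ)
    fun r t => ((hermiteGauss (k r) t * hermiteGauss (l r) t : ℝ) : ℂ)]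
  simp only [integral_complex_ofReal, integral_hermiteGauss_mul_hermiteGauss]
  split_ifs with hkl
  · simp only [hkl, if_true, Complex.coe_algebraMap, ← Complex.ofReal_mul, hone]
    simp
  · obtain ⟨r, hr⟩ := Function.ne_iff.1 hkl
    exact Finset.prod_eq_zero (Finset.mem_univ r) (by simp [hr])

end Fibers

/-! ### Completeness of the Hermite functions -/

section Completeness

open Polynomial

theorem exists_norm_eval_le (p : ℂ[X]) : ∃ C, ∀ z, ‖p.eval z‖ ≤ C * Real.exp ‖z‖ := by
  induction p using Polynomial.induction_on' with
  | add p q hp hq =>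
    obtain ⟨C, hC⟩ := hp
    obtain ⟨D, hD⟩ := hq
    refine ⟨C + D, fun z => ?_⟩
    rw [eval_add, add_mul]
    exact (norm_add_le _ _).trans (add_le_add (hC z) (hD z))
  | monomial j c =>
    refine ⟨‖c‖ * j.factorial, fun z => ?_⟩
    rw [eval_monomial, norm_mul, norm_pow, mul_assoc]
    gcongr
    rw [mul_comm, ← div_le_iff₀ (by positivity)]
    exact Real.pow_div_factorial_le_exp _ (norm_nonneg z) j

/-- The partial sums of the power series of `z ↦ exp (c z)`. -/
def expPoly (c : ℂ) (N : ℕ) : ℂ[X] := ∑ j ∈ Finset.range N, C (c ^ j / j.factorial) * X ^ j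

theorem eval_expPoly (c z : ℂ) (N : ℕ) :
    (expPoly c N).eval z = ∑ j ∈ Finset.range N, (c * z) ^ j / j.factorial := by
  simp only [expPoly, eval_finsetSum, eval_mul, eval_C, eval_pow, eval_X, mul_pow,
    div_mul_eq_mul_div]

theorem norm_eval_expPoly_le (c z : ℂ) (N : ℕ) : ‖(expPoly c N).eval z‖ ≤ Real.exp ‖c * z‖ := by
  rw [eval_expPoly]
  refine (norm_sum_le _ _).trans (le_of_eq_of_le ?_
    (Real.sum_le_exp_of_nonneg (norm_nonneg (c * z)) N))
  simp

theorem tendsto_eval_expPoly (c z : ℂ) :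
    Filter.Tendsto (fun N => (expPoly c N).eval z) Filter.atTop (nhds (Complex.exp (c * z))) := by
  simp only [eval_expPoly]
  rw [Complex.exp_eq_exp_ℂ]
  exact (NormedSpace.expSeries_div_hasSum_exp _).tendsto_sum_nat

variable {n : ℕ} {f : RealSpace n → ℂ}

theorem prod_exp_norm_mul_le (a v : RealSpace n) :
    ∏ r, Real.exp ‖a r * v r‖ ≤ Real.exp (n * ‖a‖ * ‖v‖) := by
  rw [← Real.exp_sum, Real.exp_le_exp]
  calc ∑ r, ‖a r * v r‖ ≤ ∑ _r : Fin n, ‖a‖ * ‖v‖ := Finset.sum_le_sum fun r _ => by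
        rw [norm_mul]
        gcongr <;> exact PiLp.norm_apply_le _ r
    _ = n * ‖a‖ * ‖v‖ := by simp [mul_assoc]

theorem expChar_eq_prod (a v : RealSpace n) :
    expChar a v = ∏ r, Complex.exp (-Complex.I * a r * v r) := by
  rw [← Complex.exp_sum, expChar, PiLp.inner_apply, Complex.ofReal_sum, ← Finset.sum_neg_distrib,
    Finset.sum_mul]
  refine congrArg Complex.exp (Finset.sum_congr rfl fun r _ => ?_)
  simp
  ring

/-- Integrability against all exponentials `e^{c‖v‖}`, under which the moments of `f` determine
it. -/
def HasExpMoments (f : RealSpace n → ℂ) : Prop :=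
  ∀ c : ℝ, Integrable (fun v => f v * Real.exp (c * ‖v‖)) (lebesgueT n)

theorem HasExpMoments.integrable (hf : HasExpMoments f) : Integrable f (lebesgueT n) := by
  simpa using hf 0

theorem HasExpMoments.integrable_mul (hf : HasExpMoments f) {g : RealSpace n → ℂ}
    (hg : Continuous g) {C c : ℝ} (hgC : ∀ v, ‖g v‖ ≤ C * Real.exp (c * ‖v‖)) :
    Integrable (fun v => f v * g v) (lebesgueT n) := by
  refine ((hf c).norm.const_mul C).mono'
    (hf.integrable.aestronglyMeasurable.mul hg.aestronglyMeasurable) (.of_forall fun v => ?_)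
  rw [norm_mul, norm_mul, Complex.norm_real, Real.norm_eq_abs, Real.abs_exp, mul_left_comm]
  gcongr
  exact hgC v

theorem HasExpMoments.integrable_mul_prod_eval (hf : HasExpMoments f) (p : Fin n → ℂ[X]) :
    Integrable (fun v => f v * ∏ r, (p r).eval (v r : ℂ)) (lebesgueT n) := by
  choose C hC using fun r => exists_norm_eval_le (p r)
  obtain ⟨c, hc⟩ : ∃ c : ℝ, ∀ v : RealSpace n, ∏ r, Real.exp ‖v r‖ ≤ Real.exp (c * ‖v‖) :=
    ⟨_, fun v => by simpa only [one_mul] using prod_exp_norm_mul_le (WithLp.toLp 2 fun _ => 1) v⟩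
  have hC0 : ∀ r, 0 ≤ C r := fun r =>
    nonneg_of_mul_nonneg_left ((norm_nonneg _).trans (hC r 0)) (Real.exp_pos _)
  refine hf.integrable_mul (by fun_prop) (C := ∏ r, C r) (c := c) fun v => ?_
  calc ‖∏ r, (p r).eval (v r : ℂ)‖ ≤ ∏ r, C r * Real.exp ‖v r‖ := by
        rw [norm_prod]
        exact Finset.prod_le_prod (fun _ _ => norm_nonneg _) fun r _ => by simpa using hC r (v r)
    _ ≤ (∏ r, C r) * Real.exp (c * ‖v‖) := by
        rw [Finset.prod_mul_distrib]
        exact mul_le_mul_of_nonneg_left (hc v) (Finset.prod_nonneg fun r _ => hC0 r)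

theorem prod_eval_update [DecidableEq (Fin n)] (p : Fin n → ℂ[X]) (i : Fin n) (x : ℂ[X])
    (z : Fin n → ℂ) : ∏ r, (Function.update p i x r).eval (z r) =
      x.eval (z i) * ∏ r ∈ Finset.univ.erase i, (p r).eval (z r) := by
  rw [← Finset.mul_prod_erase _ _ (Finset.mem_univ i), Function.update_self]
  exact congrArg _ (Finset.prod_congr rfl fun r hr => by
    rw [Function.update_of_ne (Finset.ne_of_mem_erase hr)])

/-- The moment functional `p ↦ ∫ f(v) p_1(v_1) ⋯ p_n(v_n) dμ̃(v)`. It is multilinear, so it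
vanishes as soon as it vanishes on the members of a basis of `ℂ[X]`. -/
def momentFunctional (hf : HasExpMoments f) : MultilinearMap ℂ (fun _ : Fin n => ℂ[X]) ℂ where
  toFun p := ∫ v, f v * ∏ r, (p r).eval (v r : ℂ) ∂lebesgueT n
  map_update_add' := by
    intro _ p i x y
    rw [← integral_add (hf.integrable_mul_prod_eval _) (hf.integrable_mul_prod_eval _)]
    simp only [prod_eval_update, eval_add, add_mul, mul_add]
  map_update_smul' := by
    intro _ p i c x
    rw [smul_eq_mul, ← integral_const_mul]
    simp only [prod_eval_update, eval_smul, smul_eq_mul, mul_assoc, mul_left_comm _ c]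

theorem HasExpMoments.ae_eq_zero_of_momentFunctional_eq_zero (hf : HasExpMoments f)
    (h : momentFunctional hf = 0) : f =ᵐ[lebesgueT n] 0 := by
  refine ae_eq_zero_of_integral_expChar_smul_eq_zero hf.integrable fun a => ?_
  let P (N : ℕ) (v : RealSpace n) : ℂ := ∏ r, (expPoly (-Complex.I * a r) N).eval (v r : ℂ)
  have hP : ∀ N v, ‖P N v‖ ≤ Real.exp (n * ‖a‖ * ‖v‖) := fun N v => by
    rw [norm_prod]
    refine (Finset.prod_le_prod (fun _ _ => norm_nonneg _) fun r _ =>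
      norm_eval_expPoly_le _ _ _).trans (le_of_eq_of_le ?_ (prod_exp_norm_mul_le a v))
    simp
  have hlim : ∀ v, Filter.Tendsto (fun N => f v * P N v) Filter.atTop
      (nhds (expChar a v • f v)) := fun v => by
    rw [smul_eq_mul, mul_comm, expChar_eq_prod]
    exact (tendsto_finsetProd _ fun r _ => tendsto_eval_expPoly _ _).const_mul _
  refine tendsto_nhds_unique (tendsto_integral_of_dominated_convergence
    (fun v => ‖f v * Real.exp (n * ‖a‖ * ‖v‖)‖)
    (fun N => (hf.integrable_mul_prod_eval _).aestronglyMeasurable) (hf _).norm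
    (fun N => .of_forall fun v => ?_) (.of_forall hlim)) ?_
  · rw [norm_mul, norm_mul, Complex.norm_real, Real.norm_eq_abs, Real.abs_exp]
    gcongr
    exact hP N v
  · have hzero : ∀ N, ∫ v, f v * P N v ∂lebesgueT n = 0 := fun N =>
      DFunLike.congr_fun h fun r => expPoly (-Complex.I * a r) N
    exact tendsto_const_nhds.congr fun N => (hzero N).symm

/-- The polynomials `He_k(2X)` as a basis of `ℂ[X]`. -/
def hermiteBasis : Module.Basis ℕ ℂ ℂ[X] :=
  (Polynomial.Sequence.basis
    ⟨fun k => (hermite k).map (Int.castRingHom ℂ), fun k => by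
      rw [degree_map_eq_of_injective (RingHom.injective_int _), degree_hermite]⟩
    fun k => ((hermite_monic k).map (Int.castRingHom ℂ)).leadingCoeff ▸ isUnit_one).map
    (algEquivCMulXAddC (2 : ℂ) 0).toLinearEquiv

theorem eval_hermiteBasis (k : ℕ) (t : ℝ) :
    (hermiteBasis k).eval (t : ℂ) = ((hermiteR k).eval (2 * t) : ℝ) := by
  have hmap : (hermite k).map (Int.castRingHom ℂ) = (hermiteR k).map Complex.ofRealHom := by
    rw [hermiteR, map_map]
    congr 1
  rw [hermiteBasis, Module.Basis.map_apply, Polynomial.Sequence.basis_eq_self]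
  change (algEquivCMulXAddC (2 : ℂ) 0 ((hermite k).map _)).eval _ = _
  rw [algEquivCMulXAddC_apply, ← comp_eq_aeval, eval_comp, hmap]
  have := eval₂_at_apply (p := hermiteR k) Complex.ofRealHom (2 * t)
  simpa [eval_map] using this

theorem hasExpMoments_mul_gaussian (u : Lp ℂ 2 (lebesgueT n)) :
    HasExpMoments fun v => u v * Real.exp (-‖v‖ ^ 2) := by
  intro c
  have hbound : MemLp (fun v : RealSpace n => (Real.exp (-‖v‖ ^ 2) * Real.exp (c * ‖v‖) : ℂ)) 2
      (lebesgueT n) := by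
    refine ((memLp_exp_neg_mul_sq_norm n one_half_pos).const_mul
      (Real.exp (c ^ 2 / 2) : ℂ)).mono (by fun_prop) (.of_forall fun v => ?_)
    simp only [← Complex.ofReal_mul, Complex.norm_real, Real.norm_eq_abs, ← Real.exp_add,
      Real.abs_exp, Real.exp_le_exp]
    nlinarith [sq_nonneg (c - ‖v‖)]
  exact ((Lp.memLp u).integrable_mul hbound).congr (.of_forall fun v => (mul_assoc _ _ _).symm)

theorem qFun_zero_eq (k : Fin n → ℕ) (v : RealSpace n) :
    qFun k 0 v = (∏ r, (√(2 / (k r).factorial) : ℂ)) *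
      (Real.exp (-‖v‖ ^ 2) * ∏ r, (hermiteBasis (k r)).eval (v r : ℂ)) := by
  have hexp : Real.exp (-‖v‖ ^ 2) = ∏ r, Real.exp (-v r ^ 2) := by
    rw [← Real.exp_sum, Finset.sum_neg_distrib, EuclideanSpace.real_norm_sq_eq]
  rw [qFun_eq_prod_hermiteGauss, hexp, Complex.ofReal_prod, ← Finset.prod_mul_distrib,
    ← Finset.prod_mul_distrib]
  simp [hermiteGauss, eval_hermiteBasis]

theorem eq_zero_of_inner_q_zero {u : Lp ℂ 2 (lebesgueT n)}
    (h : ∀ k, inner ℂ (q k 0) u = (0 : ℂ)) : u = 0 := by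
  have hmoment : momentFunctional (hasExpMoments_mul_gaussian u) = 0 := by
    refine Module.Basis.ext_multilinear (fun _ => hermiteBasis) fun k => ?_
    have hk := h k
    rw [inner_eq_integral_qFun_mul] at hk
    simp only [qFun_zero_eq, mul_assoc] at hk
    rw [integral_const_mul] at hk
    have hne : ∏ r, (√(2 / (k r).factorial) : ℂ) ≠ 0 := Finset.prod_ne_zero_iff.2 fun r _ => by
      exact_mod_cast (Real.sqrt_pos.2 (by positivity)).ne'
    refine (integral_congr_ae (.of_forall fun v => ?_)).trans
      ((mul_eq_zero.1 hk).resolve_left hne)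
    ring
  rw [Lp.eq_zero_iff_ae_eq_zero]
  filter_upwards [(hasExpMoments_mul_gaussian u).ae_eq_zero_of_momentFunctional_eq_zero hmoment]
    with v hv
  exact (mul_eq_zero.1 hv).resolve_right (by exact_mod_cast (Real.exp_pos _).ne')

end Completeness

section FiberBasis

variable {n m : ℕ} (ξ : RealSpace n)

theorem inner_q (k l : Fin n → ℕ) : inner ℂ (q k ξ) (q l ξ) = if k = l then (1 : ℂ) else 0 := by
  rw [q_eq k, q_eq l, ← inner_q_zero]
  exact (Lp.compMeasurePreservingₗᵢ ℂ (E := ℂ) (p := 2) _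
    (measurePreserving_half ξ)).inner_map_map (q k 0) (q l 0)

theorem compMeasurePreserving_half_neg (u : Lp ℂ 2 (lebesgueT n)) :
    Lp.compMeasurePreserving _ (measurePreserving_half ξ)
      (Lp.compMeasurePreserving _ (measurePreserving_half (-ξ)) u) = u := by
  refine Lp.ext ((Lp.coeFn_compMeasurePreserving _ (measurePreserving_half ξ)).trans
    (((measurePreserving_half ξ).quasiMeasurePreserving.ae_eq_comp
      (Lp.coeFn_compMeasurePreserving u (measurePreserving_half (-ξ)))).trans
      (.of_forall fun v => ?_)))
  simp

variable {ξ}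

theorem eq_zero_of_inner_q {u : Lp ℂ 2 (lebesgueT n)}
    (h : ∀ k, inner ℂ (q k ξ) u = (0 : ℂ)) : u = 0 := by
  let shift (η : RealSpace n) := Lp.compMeasurePreservingₗᵢ ℂ (E := ℂ) (p := 2) _
    (measurePreserving_half η)
  have hshift : shift ξ (shift (-ξ) u) = u := compMeasurePreserving_half_neg ξ u
  have hzero : shift (-ξ) u = 0 := eq_zero_of_inner_q_zero fun k => by
    rw [← h k, ← (shift ξ).inner_map_map, hshift, q_eq k ξ]
    rfl
  rw [← hshift, hzero, map_zero]

theorem sum_enum_lt (j : Fin (dim n m)) : ∑ r, enum n m j r < m :=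
  (mem_multiIndices _).1 (Finset.orderEmbOfFin_mem (multiIndices n m) rfl j)

theorem exists_enum_eq {k : Fin n → ℕ} (hk : ∑ r, k r < m) : ∃ j, enum n m j = k := by
  have hrange : toLex k ∈ Set.range ((multiIndices n m).orderEmbOfFin rfl) := by
    rw [Finset.range_orderEmbOfFin]
    exact (mem_multiIndices k).2 hk
  obtain ⟨j, hj⟩ := hrange
  exact ⟨j, congrArg ofLex hj⟩

theorem enum_injective (n m : ℕ) : Function.Injective (enum n m) := fun _ _ hij =>
  ((multiIndices n m).orderEmbOfFin rfl).injective (ofLex.injective hij)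

theorem coeffs_q_enum (j : Fin (dim n m)) :
    coeffs n m ξ (q (enum n m j) ξ) = EuclideanSpace.single j 1 := by
  ext i
  rw [coeffs_apply, inner_q]
  simp [(enum_injective n m).eq_iff]

theorem eq_sum_coeffs_smul_q {u : Lp ℂ 2 (lebesgueT n)}
    (h : ∀ k : Fin n → ℕ, m ≤ ∑ r, k r → inner ℂ (q k ξ) u = (0 : ℂ)) :
    u = ∑ j, coeffs n m ξ u j • q (enum n m j) ξ := by
  refine sub_eq_zero.1 (eq_zero_of_inner_q (ξ := ξ) fun k => ?_)
  rw [inner_sub_right, inner_sum, sub_eq_zero]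
  simp only [inner_smul_right, inner_q]
  by_cases hk : ∑ r, k r < m
  · obtain ⟨j, rfl⟩ := exists_enum_eq hk
    simp [(enum_injective n m).eq_iff, coeffs_apply]
  · rw [h k (not_lt.1 hk)]
    refine (Finset.sum_eq_zero fun j _ => ?_).symm
    rw [if_neg (fun hkj : k = enum n m j => hk (hkj ▸ sum_enum_lt j)), mul_zero]

theorem norm_coeffs_eq {u : Lp ℂ 2 (lebesgueT n)}
    (h : ∀ k : Fin n → ℕ, m ≤ ∑ r, k r → inner ℂ (q k ξ) u = (0 : ℂ)) :
    ‖coeffs n m ξ u‖ = ‖u‖ := by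
  have hinner : (inner ℂ u u : ℂ) = inner ℂ (coeffs n m ξ u) (coeffs n m ξ u) := by
    conv_lhs => enter [2]; rw [eq_sum_coeffs_smul_q h]
    rw [sum_inner, PiLp.inner_apply]
    refine Finset.sum_congr rfl fun j _ => ?_
    rw [inner_smul_left, ← coeffs_apply, RCLike.inner_apply, mul_comm]
  rw [← sq_eq_sq₀ (norm_nonneg _) (norm_nonneg _), ← inner_self_eq_norm_sq (𝕜 := ℂ),
    ← inner_self_eq_norm_sq (𝕜 := ℂ), hinner]

end FiberBasis

/-! ### Wirtinger derivatives and polyanalytic functions -/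

section Wirtinger

variable {n : ℕ} {f g : ComplexSpace n → ℂ}

theorem dbar_eq_of_hasFDerivAt {f' : ComplexSpace n →L[ℝ] ℂ} {z : ComplexSpace n}
    (hf : HasFDerivAt f f' z) (r : Fin n) :
    dbar r f z = (1 / 2 : ℂ) *
      (f' (EuclideanSpace.single r 1) + Complex.I * f' (EuclideanSpace.single r Complex.I)) := by
  rw [dbar, hf.fderiv]

theorem dbar_comm (r s : Fin n) (hf : ContDiff ℝ (⊤ : ℕ∞) f) :
    dbar r (dbar s f) = dbar s (dbar r f) := by
  have hfderiv : Differentiable ℝ (fderiv ℝ f) :=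
    (hf.fderiv_right (m := (⊤ : ℕ∞)) (by simp)).differentiable (by simp)
  have hdir (v z : ComplexSpace n) :
      HasFDerivAt (fun z => fderiv ℝ f z v) ((fderiv ℝ (fderiv ℝ f) z).flip v) z := by
    simpa using (hfderiv z).hasFDerivAt.clm_apply (hasFDerivAt_const v z)
  have hdbar (t : Fin n) (z : ComplexSpace n) : HasFDerivAt (dbar t f) ((1 / 2 : ℂ) •
      ((fderiv ℝ (fderiv ℝ f) z).flip (EuclideanSpace.single t 1) +
        Complex.I • (fderiv ℝ (fderiv ℝ f) z).flip (EuclideanSpace.single t Complex.I))) z :=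
    ((hdir _ z).add ((hdir _ z).const_mul _)).const_mul _
  have hsymm (z v w : ComplexSpace n) :
      fderiv ℝ (fderiv ℝ f) z v w = fderiv ℝ (fderiv ℝ f) z w v := by
    refine (hf.contDiffAt.isSymmSndFDerivAt ?_).eq v w
    rw [minSmoothness_of_isRCLikeNormedField]
    exact WithTop.coe_le_coe.2 (le_top : (2 : ℕ∞) ≤ ⊤)
  funext z
  rw [dbar_eq_of_hasFDerivAt (hdbar s z), dbar_eq_of_hasFDerivAt (hdbar r z)]
  simp only [smul_apply, add_apply, ContinuousLinearMap.flip_apply, smul_eq_mul]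
  rw [hsymm z (EuclideanSpace.single s 1) (EuclideanSpace.single r 1),
    hsymm z (EuclideanSpace.single s Complex.I) (EuclideanSpace.single r 1),
    hsymm z (EuclideanSpace.single s 1) (EuclideanSpace.single r Complex.I),
    hsymm z (EuclideanSpace.single s Complex.I) (EuclideanSpace.single r Complex.I)]
  ring

theorem dbar_mul (r : Fin n) (hf : ContDiff ℝ (⊤ : ℕ∞) f) (hg : ContDiff ℝ (⊤ : ℕ∞) g) :
    dbar r (fun z => f z * g z) = fun z => f z * dbar r g z + dbar r f z * g z := by
  funext z
  rw [dbar_eq_of_hasFDerivAt ((hf.differentiable (by simp) z).hasFDerivAt.fun_mul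
    (hg.differentiable (by simp) z).hasFDerivAt)]
  simp only [dbar, add_apply, smul_apply, smul_eq_mul]
  ring

theorem dbar_const_mul (r : Fin n) (c : ℂ) (hf : ContDiff ℝ (⊤ : ℕ∞) f) :
    dbar r (fun z => c * f z) = fun z => c * dbar r f z := by
  funext z
  rw [dbar_eq_of_hasFDerivAt ((hf.differentiable (by simp) z).hasFDerivAt.const_mul c)]
  simp only [dbar, smul_apply, smul_eq_mul]
  ring

theorem dbar_pow (r : Fin n) (p : ℕ) (hf : ContDiff ℝ (⊤ : ℕ∞) f) :
    dbar r (fun z => f z ^ p) = fun z => p * f z ^ (p - 1) * dbar r f z := by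
  funext z
  rw [dbar_eq_of_hasFDerivAt ((hf.differentiable (by simp) z).hasFDerivAt.pow p)]
  simp only [dbar, smul_apply, smul_eq_mul, nsmul_eq_mul]
  ring

theorem dbar_prod {ι : Type*} [DecidableEq ι] (r : Fin n) (S : Finset ι)
    {g : ι → ComplexSpace n → ℂ} (hg : ∀ i, ContDiff ℝ (⊤ : ℕ∞) (g i)) :
    dbar r (fun z => ∏ i ∈ S, g i z) =
      fun z => ∑ i ∈ S, (∏ j ∈ S.erase i, g j z) * dbar r (g i) z := by
  funext z
  rw [dbar_eq_of_hasFDerivAt (HasFDerivAt.finsetProd fun i _ =>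
    ((hg i).differentiable (by simp) z).hasFDerivAt)]
  simp only [dbar, FunLike.coe_sum, Finset.sum_apply, smul_apply, smul_eq_mul, Finset.mul_sum,
    ← Finset.sum_add_distrib]
  exact Finset.sum_congr rfl fun i _ => by ring

theorem contDiff_dbar_iterate (r : Fin n) (j : ℕ) (hf : ContDiff ℝ (⊤ : ℕ∞) f) :
    ContDiff ℝ (⊤ : ℕ∞) ((dbar r)^[j] f) := by
  induction j with
  | zero => exact hf
  | succ j ih =>
    rw [Function.iterate_succ_apply']
    exact contDiff_dbar r ih

theorem dbar_iterate_dbar (r s : Fin n) (j : ℕ) (hf : ContDiff ℝ (⊤ : ℕ∞) f) :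
    (dbar s)^[j] (dbar r f) = dbar r ((dbar s)^[j] f) := by
  induction j with
  | zero => rfl
  | succ j ih =>
    rw [Function.iterate_succ_apply', ih, dbar_comm s r (contDiff_dbar_iterate s j hf),
      Function.iterate_succ_apply']

theorem contDiff_foldr_dbar (k : Fin n → ℕ) (l : List (Fin n)) (hf : ContDiff ℝ (⊤ : ℕ∞) f) :
    ContDiff ℝ (⊤ : ℕ∞) (l.foldr (fun r g => (dbar r)^[k r] g) f) := by
  induction l with
  | nil => exact hf
  | cons r l ih => exact contDiff_dbar_iterate r (k r) ih

theorem contDiff_dbarPow (k : Fin n → ℕ) (hf : ContDiff ℝ (⊤ : ℕ∞) f) :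
    ContDiff ℝ (⊤ : ℕ∞) (dbarPow k f) :=
  contDiff_foldr_dbar k _ hf

theorem dbarPow_zero (f : ComplexSpace n → ℂ) : dbarPow 0 f = f := by
  unfold dbarPow
  induction List.finRange n with
  | nil => rfl
  | cons => simp

theorem foldr_dbar_add_single (r : Fin n) (k : Fin n → ℕ) (hf : ContDiff ℝ (⊤ : ℕ∞) f)
    {l : List (Fin n)} (hl : l.Nodup) :
    l.foldr (fun s g => (dbar s)^[(k + Pi.single r 1 : Fin n → ℕ) s] g) f =
      if r ∈ l then dbar r (l.foldr (fun s g => (dbar s)^[k s] g) f)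
      else l.foldr (fun s g => (dbar s)^[k s] g) f := by
  induction l with
  | nil => simp
  | cons s l ih =>
    obtain ⟨hsl, hl⟩ := List.nodup_cons.1 hl
    rw [List.foldr_cons, List.foldr_cons, ih hl]
    rcases eq_or_ne s r with rfl | hsr
    · rw [if_neg hsl, if_pos List.mem_cons_self, Pi.add_apply, Pi.single_eq_same,
        Function.iterate_succ_apply']
    · have hmem : r ∈ s :: l ↔ r ∈ l := by simp [hsr.symm]
      simp only [hmem, Pi.add_apply, Pi.single_eq_of_ne hsr, add_zero]
      split_ifs
      · exact dbar_iterate_dbar r s _ (contDiff_foldr_dbar k l hf)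
      · rfl

theorem dbarPow_add_single (r : Fin n) (k : Fin n → ℕ) (hf : ContDiff ℝ (⊤ : ℕ∞) f) :
    dbarPow (k + Pi.single r 1) f = dbar r (dbarPow k f) := by
  rw [dbarPow, dbarPow, foldr_dbar_add_single r k hf (List.nodup_finRange n),
    if_pos (List.mem_finRange r)]

theorem dbarPow_const_mul (k : Fin n → ℕ) (c : ℂ) (hf : ContDiff ℝ (⊤ : ℕ∞) f) :
    dbarPow k (fun z => c * f z) = fun z => c * dbarPow k f z :=
  dbarPow_comm (fun f z => c * f z) (fun r _ hf => dbar_const_mul r c hf) k hf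

theorem contDiff_finsetSum {ι : Type*} (S : Finset ι) {f : ι → ComplexSpace n → ℂ}
    (hf : ∀ i, ContDiff ℝ (⊤ : ℕ∞) (f i)) : ContDiff ℝ (⊤ : ℕ∞) (∑ i ∈ S, f i) := by
  simpa only [Finset.sum_fn] using ContDiff.sum fun i _ => hf i

theorem dbarPow_sum {ι : Type*} (S : Finset ι) (k : Fin n → ℕ) {f : ι → ComplexSpace n → ℂ}
    (hf : ∀ i, ContDiff ℝ (⊤ : ℕ∞) (f i)) :
    dbarPow k (∑ i ∈ S, f i) = ∑ i ∈ S, dbarPow k (f i) := by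
  classical
  induction S using Finset.induction_on with
  | empty =>
    simpa using! dbarPow_const_mul k 0 (f := fun _ => 0) contDiff_const
  | insert i S hi ih =>
    rw [Finset.sum_insert hi, Finset.sum_insert hi, dbarPow_add k (hf i) (contDiff_finsetSum S hf),
      ih]

/-- The monomial `z̄^j`. -/
def conjMon (j : Fin n → ℕ) (z : ComplexSpace n) : ℂ := ∏ s, (starRingEnd ℂ) (z s) ^ j s

/-- The real-linear functional `z ↦ z̄_s`. -/
def conjCoord (s : Fin n) : ComplexSpace n →L[ℝ] ℂ :=
  Complex.conjCLE.toContinuousLinearMap ∘L (EuclideanSpace.proj (𝕜 := ℂ) s).restrictScalars ℝ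

theorem contDiff_conjMon (j : Fin n → ℕ) : ContDiff ℝ (⊤ : ℕ∞) (conjMon j) :=
  contDiff_prod fun s _ => (conjCoord s).contDiff.pow _

theorem dbar_conjCoord (r s : Fin n) : dbar r (conjCoord s) = fun _ => if s = r then 1 else 0 := by
  funext z
  rw [dbar_eq_of_hasFDerivAt (conjCoord s).hasFDerivAt]
  rcases eq_or_ne s r with rfl | hs
  · simp [conjCoord]
    norm_num
  · simp [conjCoord, hs]

theorem dbar_conjMon (r : Fin n) (j : Fin n → ℕ) :
    dbar r (conjMon j) = fun z => j r * conjMon (j - Pi.single r 1) z := by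
  have hprod : conjMon j = fun z => ∏ s, conjCoord s z ^ j s := rfl
  rw [hprod, dbar_prod r _ fun s => (conjCoord s).contDiff.pow _]
  funext z
  simp only [dbar_pow r _ (conjCoord _).contDiff, dbar_conjCoord, mul_ite, mul_one, mul_zero,
    Finset.sum_ite_eq', Finset.mem_univ, if_true]
  have herase : ∏ s ∈ Finset.univ.erase r, conjCoord s z ^ (j - Pi.single r 1 : Fin n → ℕ) s =
      ∏ s ∈ Finset.univ.erase r, conjCoord s z ^ j s := Finset.prod_congr rfl fun s hs => by
    rw [Pi.sub_apply, Pi.single_eq_of_ne (Finset.ne_of_mem_erase hs), Nat.sub_zero]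
  change _ = (j r : ℂ) * ∏ s, conjCoord s z ^ (j - Pi.single r 1 : Fin n → ℕ) s
  rw [← Finset.mul_prod_erase _ _ (Finset.mem_univ r), herase, Pi.sub_apply, Pi.single_eq_same]
  ring

theorem multiIndex_induction {P : (Fin n → ℕ) → Prop} (zero : P 0)
    (add_single : ∀ k r, P k → P (k + Pi.single r 1)) (k : Fin n → ℕ) : P k := by
  induction hN : ∑ r, k r generalizing k with
  | zero =>
    have hk : k = 0 := funext fun r => Finset.sum_eq_zero_iff.1 hN r (Finset.mem_univ r)
    exact hk ▸ zero
  | succ N ih =>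
    obtain ⟨r, -, hr⟩ := Finset.exists_ne_zero_of_sum_ne_zero (hN.trans_ne N.succ_ne_zero)
    have hk : k - Pi.single r 1 + Pi.single r 1 = k :=
      tsub_add_cancel_of_le (update_le_iff.2
        ⟨Nat.one_le_iff_ne_zero.2 hr, fun _ _ => Nat.zero_le _⟩)
    have hsum := congrArg (fun k : Fin n → ℕ => ∑ s, k s) hk
    simp only [Pi.add_apply, Finset.sum_add_distrib, Finset.sum_pi_single', Finset.mem_univ,
      if_true, hN, Nat.add_right_cancel_iff] at hsum
    exact hk ▸ add_single _ r (ih _ hsum)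

theorem dbarPow_conjMon_mul (hf : ContDiff ℝ (⊤ : ℕ∞) f) (hdbar : ∀ r, dbar r f = 0)
    (j k : Fin n → ℕ) : dbarPow k (fun z => conjMon j z * f z) =
      fun z => (∏ r, (j r).descFactorial (k r) : ℕ) * (conjMon (j - k) z * f z) := by
  have hmul (i : Fin n → ℕ) : ContDiff ℝ (⊤ : ℕ∞) fun z => conjMon i z * f z :=
    (contDiff_conjMon i).mul hf
  induction k using multiIndex_induction with
  | zero => simp [dbarPow_zero]
  | add_single k r ih =>
    have hdesc : ∏ s, (j s).descFactorial ((k + Pi.single r 1 : Fin n → ℕ) s) =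
        (j r - k r) * ∏ s, (j s).descFactorial (k s) := by
      rw [← Finset.mul_prod_erase _ _ (Finset.mem_univ r),
        ← Finset.mul_prod_erase _ (fun s => (j s).descFactorial (k s)) (Finset.mem_univ r),
        Pi.add_apply, Pi.single_eq_same, Nat.descFactorial_succ, mul_assoc]
      refine congrArg _ (congrArg _ (Finset.prod_congr rfl fun s hs => ?_))
      rw [Pi.add_apply, Pi.single_eq_of_ne (Finset.ne_of_mem_erase hs), add_zero]
    rw [dbarPow_add_single r k (hmul j), ih, dbar_const_mul r _ (hmul _),
      dbar_mul r (contDiff_conjMon _) hf, hdbar r, dbar_conjMon, hdesc, tsub_add_eq_tsub_tsub]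
    funext z
    simp only [Pi.zero_apply, mul_zero, zero_add, Pi.sub_apply, Nat.cast_mul]
    ring

theorem dbarPow_conjMon_mul_eq_zero (hf : ContDiff ℝ (⊤ : ℕ∞) f) (hdbar : ∀ r, dbar r f = 0)
    {j k : Fin n → ℕ} (hkj : ¬k ≤ j) : dbarPow k (fun z => conjMon j z * f z) = 0 := by
  obtain ⟨r, hr⟩ := not_forall.1 hkj
  rw [dbarPow_conjMon_mul hf hdbar, Finset.prod_eq_zero (Finset.mem_univ r)
    (Nat.descFactorial_eq_zero_iff_lt.2 (not_le.1 hr))]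
  funext z
  simp

theorem dbarPow_conjMon_mul_self (hf : ContDiff ℝ (⊤ : ℕ∞) f) (hdbar : ∀ r, dbar r f = 0)
    (j : Fin n → ℕ) : dbarPow j (fun z => conjMon j z * f z) =
      fun z => (∏ r, (j r).factorial : ℕ) * f z := by
  rw [dbarPow_conjMon_mul hf hdbar]
  funext z
  simp [Nat.descFactorial_self, conjMon]

theorem isPolyanalytic_conjMon_mul {m : ℕ} (hf : ContDiff ℝ (⊤ : ℕ∞) f)
    (hdbar : ∀ r, dbar r f = 0) {j : Fin n → ℕ} (hj : ∑ r, j r < m) :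
    IsPolyanalytic m fun z => conjMon j z * f z :=
  ⟨(contDiff_conjMon j).mul hf, fun _ hk => dbarPow_conjMon_mul_eq_zero hf hdbar fun hkj =>
    (hj.trans_eq hk.symm).not_ge (Finset.sum_le_sum fun r _ => hkj r)⟩

theorem fderiv_single_I (hdbar : ∀ r, dbar r f = 0) (z : ComplexSpace n) (r : Fin n) :
    fderiv ℝ f z (EuclideanSpace.single r Complex.I) =
      Complex.I * fderiv ℝ f z (EuclideanSpace.single r 1) := by
  have hr := congrFun (hdbar r) z
  simp only [dbar, Pi.zero_apply] at hr
  linear_combination (-2 * Complex.I) * hr + fderiv ℝ f z (EuclideanSpace.single r Complex.I) *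
    Complex.I_mul_I

theorem differentiable_of_dbar_eq_zero (hf : Differentiable ℝ f) (hdbar : ∀ r, dbar r f = 0) :
    Differentiable ℂ f := by
  intro z
  rw [differentiableAt_iff_restrictScalars ℝ (hf z)]
  refine ⟨∑ r, fderiv ℝ f z (EuclideanSpace.single r 1) • EuclideanSpace.proj (𝕜 := ℂ) r, ?_⟩
  ext v
  have hv : v = ∑ r, ((v r).re • EuclideanSpace.single r (1 : ℂ) +
      (v r).im • EuclideanSpace.single r Complex.I) := by
    ext s
    simp [Pi.single_apply, Finset.sum_add_distrib]
  conv_rhs => rw [hv]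
  simp only [map_sum, map_add, map_smul, fderiv_single_I hdbar,
    ContinuousLinearMap.coe_restrictScalars', FunLike.coe_sum, Finset.sum_apply, smul_apply,
    EuclideanSpace.coe_proj, smul_eq_mul, Complex.real_smul]
  refine Finset.sum_congr rfl fun r _ => ?_
  conv_lhs => rw [← Complex.re_add_im (v r)]
  ring

variable {m : ℕ}

/-- The leading part `∑_{|j| = m} z̄^j D̄^j f / j!` of an `(m+1)`-analytic function `f`; its
coefficients `D̄^j f` are entire. -/
def leadingPart (m : ℕ) (f : ComplexSpace n → ℂ) : ComplexSpace n → ℂ :=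
  ∑ j ∈ Finset.piAntidiag Finset.univ m, fun z =>
    conjMon j z * (((∏ r, (j r).factorial : ℕ) : ℂ)⁻¹ * dbarPow j f z)

theorem IsPolyanalytic.dbar_dbarPow_eq_zero (hf : IsPolyanalytic (m + 1) f) {j : Fin n → ℕ}
    (hj : ∑ r, j r = m) (c : ℂ) (r : Fin n) : dbar r (fun z => c * dbarPow j f z) = 0 := by
  rw [dbar_const_mul r c (contDiff_dbarPow j hf.1), ← dbarPow_add_single r j hf.1, hf.2]
  · funext z
    simp
  · simp [Finset.sum_add_distrib, hj]

theorem IsPolyanalytic.sub_leadingPart (hf : IsPolyanalytic (m + 1) f) :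
    IsPolyanalytic m (f - leadingPart m f) := by
  let coeff (j : Fin n → ℕ) (z : ComplexSpace n) : ℂ :=
    ((∏ r, (j r).factorial : ℕ) : ℂ)⁻¹ * dbarPow j f z
  have hcoeff : ∀ j, ContDiff ℝ (⊤ : ℕ∞) (coeff j) := fun j =>
    contDiff_const.mul (contDiff_dbarPow j hf.1)
  have hterm (j : Fin n → ℕ) : ContDiff ℝ (⊤ : ℕ∞) fun z => conjMon j z * coeff j z :=
    (contDiff_conjMon j).mul (hcoeff j)
  have hlead : ContDiff ℝ (⊤ : ℕ∞) (leadingPart m f) := contDiff_finsetSum _ hterm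
  have hneg : f - leadingPart m f = f + fun z => (-1 : ℂ) * leadingPart m f z := by
    funext z
    simp [sub_eq_add_neg]
  rw [hneg]
  refine ⟨hf.1.add (contDiff_const.mul hlead), fun k hk => ?_⟩
  have hkself : dbarPow k (leadingPart m f) = dbarPow k f := by
    rw [leadingPart, dbarPow_sum _ k hterm, Finset.sum_eq_single k]
    · rw [dbarPow_conjMon_mul_self (hcoeff k) (hf.dbar_dbarPow_eq_zero hk _)]
      funext z
      exact mul_inv_cancel_left₀ (Nat.cast_ne_zero.2
        (Finset.prod_ne_zero_iff.2 fun r _ => (k r).factorial_ne_zero)) _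
    · intro j hj hjk
      have hjm : ∑ r, j r = m := (Finset.mem_piAntidiag.1 hj).1
      refine dbarPow_conjMon_mul_eq_zero (hcoeff j) (hf.dbar_dbarPow_eq_zero hjm _)
        fun hkj => hjk ?_
      have hle := (Finset.sum_eq_sum_iff_of_le fun r _ => hkj r).1 (hk.trans hjm.symm)
      exact funext fun r => (hle r (Finset.mem_univ r)).symm
    · exact fun hk' => absurd (Finset.mem_piAntidiag.2 ⟨hk, by simp⟩) hk'
  rw [dbarPow_add k hf.1 (contDiff_const.mul hlead), dbarPow_const_mul k _ hlead, hkself]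
  funext z
  simp

theorem IsPolyanalytic.induction {Q : (ComplexSpace n → ℂ) → Prop} (zero : Q 0)
    (add : ∀ f g, Q f → Q g → Q (f + g))
    (conjMon_mul : ∀ (j : Fin n → ℕ) (h : ComplexSpace n → ℂ), ∑ r, j r < m → Differentiable ℂ h →
      Q fun z => conjMon j z * h z)
    (hf : IsPolyanalytic m f) : Q f := by
  induction m generalizing f with
  | zero =>
    have hzero := hf.2 0 (by simp)
    rw [dbarPow_zero] at hzero
    exact hzero ▸ zero
  | succ m ih =>
    have hlead : Q (leadingPart m f) := by
      refine Finset.sum_induction _ Q add zero fun j hj => ?_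
      have hjm : ∑ r, j r = m := (Finset.mem_piAntidiag.1 hj).1
      refine conjMon_mul j _ (by lia) (differentiable_of_dbar_eq_zero ?_
        (hf.dbar_dbarPow_eq_zero hjm _))
      exact (contDiff_const.mul (contDiff_dbarPow j hf.1)).differentiable (by simp)
    have hrest := ih (fun j h hj => conjMon_mul j h (by lia)) hf.sub_leadingPart
    simpa using add _ _ hrest hlead

end Wirtinger

section CircleAverage

variable {n : ℕ}

theorem measurePreserving_rotation (c : Circle) :
    MeasurePreserving (fun z : ComplexSpace n => (c : ℂ) • z) volume volume :=
  let rotation : ComplexSpace n ≃ₗᵢ[ℝ] ComplexSpace n :=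
    ⟨(LinearEquiv.smulOfNeZero ℂ (ComplexSpace n) (c : ℂ) c.coe_ne_zero).restrictScalars ℝ,
      fun z => (norm_smul (c : ℂ) z).trans (by rw [Circle.norm_coe, one_mul])⟩
  rotation.measurePreserving

theorem measurePreserving_rotation_gaussian (α : ℝ) (c : Circle) :
    MeasurePreserving (fun z : ComplexSpace n => (c : ℂ) • z) (gaussian n α) (gaussian n α) := by
  have hrot := measurePreserving_rotation (n := n) c
  refine ⟨hrot.measurable, Measure.ext fun s hs => ?_⟩
  rw [Measure.map_apply hrot.measurable hs, gaussian, withDensity_apply _ (hrot.measurable hs),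
    withDensity_apply _ hs, ← hrot.setLIntegral_comp_preimage hs (by fun_prop)]
  simp only [norm_smul, Circle.norm_coe, one_mul]

theorem integral_eq_zero_of_circleAverage {μ : Measure (ComplexSpace n)} [SFinite μ]
    (hμ : ∀ c : Circle, MeasurePreserving (fun z : ComplexSpace n => (c : ℂ) • z) μ μ)
    {u : ComplexSpace n → ℂ} (hu : Integrable u μ)
    (havg : ∀ z, Real.circleAverage (fun w => u (w • z)) 0 1 = 0) : ∫ z, u z ∂μ = 0 := by
  let ν : Measure ℝ := volume.restrict (Set.Ioc 0 (2 * Real.pi))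
  have hskew : MeasurePreserving (fun p : ℝ × ComplexSpace n =>
      (p.1, (Circle.exp p.1 : ℂ) • p.2)) (ν.prod μ) (ν.prod μ) :=
    (MeasurePreserving.id ν).skew_product (g := fun θ z => (Circle.exp θ : ℂ) • z)
      (by unfold Function.uncurry; fun_prop) (.of_forall fun θ => (hμ (Circle.exp θ)).map_eq)
  have hswap : ∫ θ, ∫ z, u ((Circle.exp θ : ℂ) • z) ∂μ ∂ν =
      ∫ z, ∫ θ, u ((Circle.exp θ : ℂ) • z) ∂ν ∂μ :=
    integral_integral_swap (hskew.integrable_comp_of_integrable (hu.comp_snd ν))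
  have hinv (θ : ℝ) : ∫ z, u ((Circle.exp θ : ℂ) • z) ∂μ = ∫ z, u z ∂μ := by
    have hmap := (hμ (Circle.exp θ)).map_eq
    rw [← integral_map (hμ _).aemeasurable (hmap.symm ▸ hu.aestronglyMeasurable), hmap]
  have hzero (z : ComplexSpace n) : ∫ θ, u ((Circle.exp θ : ℂ) • z) ∂ν = 0 := by
    have hz := havg z
    rw [Real.circleAverage_def, smul_eq_zero_iff_right (by positivity),
      intervalIntegral.integral_of_le Real.two_pi_pos.le] at hz
    simpa [circleMap, Circle.coe_exp] using hz
  simp only [hinv, hzero, integral_zero, integral_const, smul_eq_zero] at hswap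
  refine hswap.resolve_left ?_
  simp [ν, Measure.real, Real.pi_pos.le, Real.pi_pos.ne']

theorem circleAverage_pow_mul_comp {h : ComplexSpace n → ℂ} (hh : Differentiable ℂ h)
    (x z : ComplexSpace n) (p : ℕ) :
    Real.circleAverage (fun w => w ^ p * h (x + w • z)) 0 1 = 0 ^ p * h x := by
  have hd : Differentiable ℂ fun w : ℂ => w ^ p * h (x + w • z) := by fun_prop
  simpa using (hd.diffContOnCl (s := Metric.ball 0 |(1 : ℝ)|)).circleAverage

theorem conjMon_smul (j : Fin n → ℕ) (w : ℂ) (z : ComplexSpace n) :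
    conjMon j (w • z) = starRingEnd ℂ w ^ (∑ r, j r) * conjMon j z := by
  simp only [conjMon, PiLp.smul_apply, smul_eq_mul, map_mul, mul_pow, Finset.prod_mul_distrib,
    Finset.prod_pow_eq_pow_sum]

theorem conj_pow_mul_pow {w : ℂ} (hw : ‖w‖ = 1) (p : ℕ) : starRingEnd ℂ w ^ p * w ^ p = 1 := by
  rw [← mul_pow, Complex.conj_mul', hw, Complex.ofReal_one, one_pow, one_pow]

theorem IsPolyanalytic.circleAverage_eq_zero {m : ℕ} {f : ComplexSpace n → ℂ}
    (hf : IsPolyanalytic m f) (z : ComplexSpace n) {l : ℕ} (hl : m ≤ l) :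
    Real.circleAverage (fun w => w ^ l * f (w • z)) 0 1 = 0 := by
  refine (hf.induction (Q := fun f => Continuous f ∧
    Real.circleAverage (fun w => w ^ l * f (w • z)) 0 1 = 0) ?_ ?_ ?_).2
  · exact ⟨continuous_const, by simp [Real.circleAverage_def]⟩
  · rintro f g ⟨hf, hf0⟩ ⟨hg, hg0⟩
    have hcircle : ∀ f : ComplexSpace n → ℂ, Continuous f →
        CircleIntegrable (fun w => w ^ l * f (w • z)) 0 1 := fun f hf =>
      (Continuous.continuousOn (by fun_prop)).circleIntegrable zero_le_one
    refine ⟨hf.add hg, ?_⟩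
    simp only [Pi.add_apply, mul_add]
    rw [Real.circleAverage_fun_add (hcircle f hf) (hcircle g hg), hf0, hg0, add_zero]
  · intro j h hj hh
    refine ⟨(contDiff_conjMon j).continuous.mul hh.continuous, ?_⟩
    have havg := circleAverage_pow_mul_comp hh 0 z (l - ∑ r, j r)
    rw [zero_pow (by lia), zero_mul] at havg
    have hscaled : Real.circleAverage
        (fun w => conjMon j z • (w ^ (l - ∑ r, j r) * h (0 + w • z))) 0 1 = 0 := by
      rw [Real.circleAverage_fun_smul, havg, smul_zero]
    refine (Real.circleAverage_congr_sphere fun w hw => ?_).trans hscaled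
    simp only [smul_eq_mul, zero_add, conjMon_smul]
    rw [← Nat.sub_add_cancel (hj.le.trans hl), pow_add, Nat.add_sub_cancel]
    linear_combination w ^ (l - ∑ r, j r) * conjMon j z * h (w • z) *
      conj_pow_mul_pow (by simpa using hw) (∑ r, j r)

end CircleAverage

section Monomials

variable {n : ℕ} {α : ℝ}

theorem norm_conjMon_le (k : Fin n → ℕ) (z : ComplexSpace n) :
    ‖conjMon k z‖ ≤ ‖z‖ ^ ∑ r, k r := by
  rw [conjMon, norm_prod, ← Finset.prod_pow_eq_pow_sum]
  refine Finset.prod_le_prod (fun _ _ => norm_nonneg _) fun s _ => ?_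
  rw [norm_pow, RCLike.norm_conj]
  exact pow_le_pow_left₀ (norm_nonneg _) (PiLp.norm_apply_le z s) _

theorem pow_mul_exp_neg_mul_le (hα : 0 < α) {t : ℝ} (ht : 0 ≤ t) (p : ℕ) :
    t ^ p * Real.exp (-α * t) ≤ p.factorial * (2 / α) ^ p * Real.exp (-(α / 2) * t) := by
  have hpow := Real.pow_div_factorial_le_exp (α / 2 * t) (by positivity) p
  rw [div_le_iff₀ (by positivity)] at hpow
  have hexp : Real.exp (α / 2 * t) * Real.exp (-α * t) = Real.exp (-(α / 2) * t) := by
    rw [← Real.exp_add]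
    congr 1
    ring
  calc t ^ p * Real.exp (-α * t)
      = (2 / α) ^ p * (α / 2 * t) ^ p * Real.exp (-α * t) := by
        rw [← mul_pow, ← mul_assoc, div_mul_div_cancel₀ hα.ne', div_self two_ne_zero, one_mul]
    _ ≤ (2 / α) ^ p * (Real.exp (α / 2 * t) * p.factorial) * Real.exp (-α * t) := by gcongr
    _ = p.factorial * (2 / α) ^ p * Real.exp (-(α / 2) * t) := by
        rw [← hexp]
        ring

theorem integrable_norm_pow_mul_exp_neg {V : Type*} [NormedAddCommGroup V]
    [InnerProductSpace ℝ V] [FiniteDimensional ℝ V] [MeasurableSpace V] [BorelSpace V]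
    (hα : 0 < α) (p : ℕ) :
    Integrable fun v : V => (‖v‖ ^ 2) ^ p * Real.exp (-α * ‖v‖ ^ 2) := by
  have hα2 : 0 < α / 2 := by positivity
  refine ((integrable_exp_neg_mul_sq_norm hα2).const_mul (p.factorial * (2 / α) ^ p)).mono'
    (by fun_prop) (.of_forall fun v => ?_)
  rw [Real.norm_of_nonneg (by positivity)]
  exact pow_mul_exp_neg_mul_le hα (sq_nonneg _) p

theorem integrable_gaussian_iff (hα : 0 < α) {E : Type*} [NormedAddCommGroup E]
    [NormedSpace ℝ E] {f : ComplexSpace n → E} : Integrable f (gaussian n α) ↔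
      Integrable fun z => (α ^ n / Real.pi ^ n * Real.exp (-α * ‖z‖ ^ 2)) • f z := by
  rw [gaussian, integrable_withDensity_iff_integrable_smul' (by fun_prop) (by simp)]
  refine integrable_congr (.of_forall fun z => ?_)
  simp only
  rw [ENNReal.toReal_ofReal (by positivity)]

theorem memLp_conjMon (hα : 0 < α) (k : Fin n → ℕ) : MemLp (conjMon k) 2 (gaussian n α) := by
  have hc := (contDiff_conjMon k).continuous
  rw [memLp_two_iff_integrable_sq_norm hc.aestronglyMeasurable, integrable_gaussian_iff hα]
  refine ((integrable_norm_pow_mul_exp_neg hα (∑ r, k r)).const_mul (α ^ n / Real.pi ^ n)).mono'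
    (by fun_prop) (.of_forall fun z => ?_)
  have hsq := pow_le_pow_left₀ (norm_nonneg _) (norm_conjMon_le k z) 2
  rw [pow_right_comm] at hsq
  rw [Real.norm_of_nonneg (by positivity), smul_eq_mul, mul_assoc, mul_comm (Real.exp _)]
  gcongr

/-- The monomial `z̄^k` as an element of the weighted space `L²(ℂⁿ, (α/π)ⁿ e^{-α|z|²} dz)`. -/
def monL2 (hα : 0 < α) (k : Fin n → ℕ) : Lp ℂ 2 (gaussian n α) :=
  (memLp_conjMon hα k).toLp _

theorem coeFn_monL2 (hα : 0 < α) (k : Fin n → ℕ) : monL2 hα k =ᵐ[gaussian n α] conjMon k :=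
  MemLp.coeFn_toLp _

theorem monL2_mem_fock (hα : 0 < α) {m : ℕ} {k : Fin n → ℕ} (hk : ∑ r, k r < m) :
    monL2 hα k ∈ fock n m α := by
  have hone (r : Fin n) : dbar r (1 : ComplexSpace n → ℂ) = 0 := by
    funext z
    simp [dbar]
  refine ⟨fun z => conjMon k z * 1, isPolyanalytic_conjMon_mul contDiff_const hone hk, ?_⟩
  simpa only [mul_one] using coeFn_monL2 hα k

theorem inner_monL2_eq_zero (hα : 0 < α) {m : ℕ} {k : Fin n → ℕ} (hk : m ≤ ∑ r, k r)
    {f : Lp ℂ 2 (gaussian n α)} (hf : f ∈ fock n m α) : inner ℂ (monL2 hα k) f = (0 : ℂ) := by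
  have : SFinite (gaussian n α) := by
    unfold gaussian
    infer_instance
  obtain ⟨g, hg, hfg⟩ := hf
  have hinner : inner ℂ (monL2 hα k) f =
      ∫ z, g z * starRingEnd ℂ (conjMon k z) ∂gaussian n α := by
    rw [L2.inner_def]
    refine integral_congr_ae ?_
    filter_upwards [hfg, coeFn_monL2 hα k] with z hfz hkz
    rw [hfz, hkz, RCLike.inner_apply]
  rw [hinner]
  refine integral_eq_zero_of_circleAverage (measurePreserving_rotation_gaussian α)
    (((memLp_congr_ae hfg).1 (Lp.memLp f)).integrable_mul (memLp_conjMon hα k).star) fun z => ?_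
  have hscaled : Real.circleAverage (fun w => starRingEnd ℂ (conjMon k z) •
      (w ^ (∑ r, k r) * g (w • z))) 0 1 = 0 := by
    rw [Real.circleAverage_fun_smul, hg.circleAverage_eq_zero z hk, smul_zero]
  rw [← hscaled]
  congr 1
  funext w
  simp only [conjMon_smul, map_mul, map_pow, Complex.conj_conj, smul_eq_mul]
  ring

end Monomials

section Convolution

variable {E : Type*} [NormedAddCommGroup E] [MeasureSpace E]

/-- The convolution `f ∗ g` of complex functions, with respect to the volume. -/
abbrev cconv (f g : E → ℂ) : E → ℂ :=
  convolution f g (ContinuousLinearMap.mul ℝ ℂ) volume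

theorem cconv_apply (f g : E → ℂ) (x : E) : cconv f g x = ∫ t, f t * g (x - t) := rfl

theorem cconv_congr_ae {f f' : E → ℂ} (g : E → ℂ) (h : f =ᵐ[volume] f') :
    cconv f g = cconv f' g := by
  funext x
  rw [cconv_apply, cconv_apply]
  refine integral_congr_ae ?_
  filter_upwards [h] with t ht
  rw [ht]

theorem cconv_smul (c : ℂ) (f g : E → ℂ) : cconv f (c • g) = c • cconv f g :=
  convolution_smul (L := ContinuousLinearMap.mul ℂ ℂ)

theorem smul_cconv (c : ℂ) (f g : E → ℂ) : cconv (c • f) g = c • cconv f g :=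
  smul_convolution (L := ContinuousLinearMap.mul ℂ ℂ)

variable [BorelSpace E] {f f' g g' k : E → ℂ}

theorem convolutionExists_mul (hf : LocallyIntegrable f) (hg : Continuous g)
    (hgc : HasCompactSupport g) : ConvolutionExists f g (ContinuousLinearMap.mul ℝ ℂ) volume :=
  hgc.convolutionExists_right _ hf hg

theorem cconv_sub (hf : LocallyIntegrable f) (hg : Continuous g) (hgc : HasCompactSupport g)
    (hg' : Continuous g') (hgc' : HasCompactSupport g') :
    cconv f (g - g') = cconv f g - cconv f g' := by
  funext x
  simp only [Pi.sub_apply, cconv_apply, mul_sub]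
  exact integral_sub (convolutionExists_mul hf hg hgc x) (convolutionExists_mul hf hg' hgc' x)

theorem sub_cconv (hf : LocallyIntegrable f) (hf' : LocallyIntegrable f') (hg : Continuous g)
    (hgc : HasCompactSupport g) : cconv (f - f') g = cconv f g - cconv f' g := by
  funext x
  simp only [Pi.sub_apply, cconv_apply, sub_mul]
  exact integral_sub (convolutionExists_mul hf hg hgc x) (convolutionExists_mul hf' hg hgc x)

variable [NormedSpace ℝ E]

theorem contDiff_cconv (hf : LocallyIntegrable f) (hg : ContDiff ℝ (⊤ : ℕ∞) g)
    (hgc : HasCompactSupport g) : ContDiff ℝ (⊤ : ℕ∞) (cconv f g) :=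
  hgc.contDiff_convolution_right _ hf hg

variable [FiniteDimensional ℝ E] [(volume : Measure E).IsAddHaarMeasure]

theorem cconv_assoc (hf : Continuous f) (hg : Continuous g) (hgc : HasCompactSupport g)
    (hk : Continuous k) (hkc : HasCompactSupport k) :
    cconv (cconv f g) k = cconv f (cconv g k) := by
  funext x
  refine convolution_assoc (ContinuousLinearMap.mul ℝ ℂ) (ContinuousLinearMap.mul ℝ ℂ)
    (ContinuousLinearMap.mul ℝ ℂ) (ContinuousLinearMap.mul ℝ ℂ) (fun x y z => mul_assoc x y z)
    hf.aestronglyMeasurable hg.aestronglyMeasurable hk.aestronglyMeasurable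
    (.of_forall (convolutionExists_mul hf.locallyIntegrable hg hgc))
    (.of_forall (hkc.norm.convolutionExists_right _ hg.norm.locallyIntegrable hk.norm)) ?_
  exact (hgc.norm.convolution (ContinuousLinearMap.mul ℝ ℝ) hkc.norm).convolutionExists_right _
    hf.norm.locallyIntegrable
    (hkc.norm.continuous_convolution_right _ hg.norm.locallyIntegrable hk.norm) x

theorem fderiv_cconv (hf : LocallyIntegrable f) (hg : ContDiff ℝ (⊤ : ℕ∞) g)
    (hgc : HasCompactSupport g) (x v : E) :
    fderiv ℝ (cconv f g) x v = cconv f (fun t => fderiv ℝ g t v) x := by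
  rw [(hgc.hasFDerivAt_convolution_right (ContinuousLinearMap.mul ℝ ℂ) hf
    (hg.of_le (by simp)) x).fderiv, convolution_precompR_apply _ hf (hgc.fderiv ℝ)
    (hg.continuous_fderiv (by simp))]

theorem cconv_fderiv (hf : ContDiff ℝ (⊤ : ℕ∞) f) (hg : ContDiff ℝ (⊤ : ℕ∞) g)
    (hgc : HasCompactSupport g) (v : E) :
    cconv f (fun t => fderiv ℝ g t v) = cconv (fun t => fderiv ℝ f t v) g := by
  funext x
  have hgx (t : E) : HasFDerivAt (fun t => g (x - t)) (-fderiv ℝ g (x - t)) t := by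
    simpa using! ((hg.differentiable (by simp) (x - t)).hasFDerivAt).comp t
      ((hasFDerivAt_id t).const_sub x)
  have hfc : Continuous (fderiv ℝ f) := hf.continuous_fderiv (by simp)
  have hgc' : Continuous (fderiv ℝ g) := hg.continuous_fderiv (by simp)
  have hloc : LocallyIntegrable f := hf.continuous.locallyIntegrable
  have hloc' : LocallyIntegrable fun t => fderiv ℝ f t v :=
    Continuous.locallyIntegrable (by fun_prop)
  have hright : Integrable fun t => f t * fderiv ℝ g (x - t) v :=
    convolutionExists_mul hloc (by fun_prop) (hgc.fderiv_apply ℝ v) x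
  have hparts := integral_mul_fderiv_eq_neg_fderiv_mul_of_integrable (μ := volume) (f := f)
    (g := fun t => g (x - t)) (v := v) (convolutionExists_mul hloc' hg.continuous hgc x)
    (by simpa [fun t => (hgx t).fderiv] using hright.neg)
    (convolutionExists_mul hloc hg.continuous hgc x)
    (fun t _ => hf.differentiable (by simp) t) (fun t _ => (hgx t).differentiableAt)
  simp only [cconv_apply]
  simpa only [fun t => (hgx t).fderiv, neg_apply, mul_neg, integral_neg, neg_inj] using hparts

end Convolution

section DbarConvolution

variable {n : ℕ} {f g : ComplexSpace n → ℂ}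

theorem dbar_eq_smul_add (r : Fin n) (f : ComplexSpace n → ℂ) :
    dbar r f = (1 / 2 : ℂ) • ((fun z => fderiv ℝ f z (EuclideanSpace.single r 1)) +
      Complex.I • fun z => fderiv ℝ f z (EuclideanSpace.single r Complex.I)) := rfl

theorem hasCompactSupport_dbar (r : Fin n) (hg : HasCompactSupport g) :
    HasCompactSupport (dbar r g) :=
  ((hg.fderiv_apply ℝ _).add (hg.fderiv_apply ℝ _).mul_left).mul_left

theorem cconv_dbar_eq_smul_add (r : Fin n) (hf : LocallyIntegrable f)
    (hg : ContDiff ℝ (⊤ : ℕ∞) g) (hgc : HasCompactSupport g) :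
    cconv f (dbar r g) =
      (1 / 2 : ℂ) • (cconv f (fun z => fderiv ℝ g z (EuclideanSpace.single r 1)) +
        Complex.I • cconv f fun z => fderiv ℝ g z (EuclideanSpace.single r Complex.I)) := by
  have hcont : Continuous (fderiv ℝ g) := hg.continuous_fderiv (by simp)
  rw [dbar_eq_smul_add, cconv_smul, ← cconv_smul Complex.I]
  congr 1
  exact (convolutionExists_mul hf (by fun_prop) (hgc.fderiv_apply ℝ _)).distrib_add
    (convolutionExists_mul hf (by fun_prop) (hgc.fderiv_apply ℝ _).smul_left)

theorem dbar_cconv (r : Fin n) (hf : LocallyIntegrable f) (hg : ContDiff ℝ (⊤ : ℕ∞) g)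
    (hgc : HasCompactSupport g) : dbar r (cconv f g) = cconv f (dbar r g) := by
  rw [cconv_dbar_eq_smul_add r hf hg hgc, dbar_eq_smul_add]
  simp only [fderiv_cconv hf hg hgc]

theorem cconv_dbar (r : Fin n) (hf : ContDiff ℝ (⊤ : ℕ∞) f) (hg : ContDiff ℝ (⊤ : ℕ∞) g)
    (hgc : HasCompactSupport g) : cconv f (dbar r g) = cconv (dbar r f) g := by
  have hcont : Continuous (fderiv ℝ f) := hf.continuous_fderiv (by simp)
  rw [cconv_dbar_eq_smul_add r hf.continuous.locallyIntegrable hg hgc, cconv_fderiv hf hg hgc,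
    cconv_fderiv hf hg hgc, dbar_eq_smul_add, smul_cconv, ← smul_cconv Complex.I]
  congr 1
  exact ((convolutionExists_mul (Continuous.locallyIntegrable (by fun_prop)) hg.continuous
    hgc).add_distrib (convolutionExists_mul (Continuous.locallyIntegrable (by fun_prop))
    hg.continuous hgc)).symm

theorem dbarPow_cconv_left (k : Fin n → ℕ) (hf : ContDiff ℝ (⊤ : ℕ∞) f)
    (hg : ContDiff ℝ (⊤ : ℕ∞) g) (hgc : HasCompactSupport g) :
    dbarPow k (cconv f g) = cconv (dbarPow k f) g :=
  dbarPow_comm (fun f => cconv f g) (fun r f hf => by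
    rw [dbar_cconv r hf.continuous.locallyIntegrable hg hgc, cconv_dbar r hf hg hgc]) k hf

theorem rel_dbarPow {R : (ComplexSpace n → ℂ) → (ComplexSpace n → ℂ) → Prop}
    (hR : ∀ r f g, R f g → R (dbar r f) (dbar r g)) (k : Fin n → ℕ) (hfg : R f g) :
    R (dbarPow k f) (dbarPow k g) := by
  have iterate (r : Fin n) (j : ℕ) (f g : ComplexSpace n → ℂ) (hfg : R f g) :
      R ((dbar r)^[j] f) ((dbar r)^[j] g) := by
    induction j with
    | zero => exact hfg
    | succ j ih =>
      rw [Function.iterate_succ_apply', Function.iterate_succ_apply']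
      exact hR r _ _ ih
  unfold dbarPow
  induction List.finRange n with
  | nil => exact hfg
  | cons r l ih => exact iterate r (k r) _ _ ih

theorem dbarPow_cconv_right (k : Fin n → ℕ) (hf : LocallyIntegrable f)
    (hg : ContDiff ℝ (⊤ : ℕ∞) g) (hgc : HasCompactSupport g) :
    dbarPow k (cconv f g) = cconv f (dbarPow k g) ∧ HasCompactSupport (dbarPow k g) := by
  obtain ⟨heq, -, hsupp⟩ := rel_dbarPow
    (R := fun u v => u = cconv f v ∧ ContDiff ℝ (⊤ : ℕ∞) v ∧ HasCompactSupport v)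
    (fun r u v ⟨huv, hv, hvc⟩ => ⟨by rw [huv, dbar_cconv r hf hv hvc], contDiff_dbar r hv,
      hasCompactSupport_dbar r hvc⟩) k ⟨rfl, hg, hgc⟩
  exact ⟨heq, hsupp⟩

/-- A smooth radial function with compact support. -/
def radialBump (n : ℕ) (z : ComplexSpace n) : ℝ := Real.smoothTransition (2 - ‖z‖ ^ 2)

theorem contDiff_radialBump (n : ℕ) : ContDiff ℝ (⊤ : ℕ∞) (radialBump n) :=
  Real.smoothTransition.contDiff.comp (contDiff_const.sub (contDiff_norm_sq ℝ))

theorem hasCompactSupport_radialBump (n : ℕ) : HasCompactSupport (radialBump n) := by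
  refine HasCompactSupport.intro (isCompact_closedBall (0 : ComplexSpace n) 2) fun z hz => ?_
  have hnorm : 2 < ‖z‖ := by simpa using hz
  exact Real.smoothTransition.zero_of_nonpos (by nlinarith)

theorem integral_radialBump_pos (n : ℕ) : 0 < ∫ z, radialBump n z := by
  refine (contDiff_radialBump n).continuous.integral_pos_of_hasCompactSupport_nonneg_nonzero
    (hasCompactSupport_radialBump n) (fun z => Real.smoothTransition.nonneg _) (x := 0) ?_
  rw [radialBump, Real.smoothTransition.one_of_one_le (by simp)]
  exact one_ne_zero

/-- The radial mollifier: `radialBump` normalized to integral one. Convolution with it fixes the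
entire functions, by the mean value property. -/
def mollifier (n : ℕ) (z : ComplexSpace n) : ℂ :=
  (((∫ w, radialBump n w)⁻¹ * radialBump n z : ℝ) : ℂ)

theorem contDiff_mollifier (n : ℕ) : ContDiff ℝ (⊤ : ℕ∞) (mollifier n) :=
  Complex.ofRealCLM.contDiff.comp (contDiff_const.mul (contDiff_radialBump n))

theorem hasCompactSupport_mollifier (n : ℕ) : HasCompactSupport (mollifier n) :=
  ((hasCompactSupport_radialBump n).mul_left (f := fun _ => (∫ w, radialBump n w)⁻¹)).comp_left
    (g := fun t : ℝ => (t : ℂ)) rfl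

theorem integral_mollifier (n : ℕ) : ∫ z, mollifier n z = 1 := by
  unfold mollifier
  rw [integral_complex_ofReal, integral_const_mul, inv_mul_cancel₀ (integral_radialBump_pos n).ne',
    Complex.ofReal_one]

theorem mollifier_smul {w : ℂ} (hw : ‖w‖ = 1) (z : ComplexSpace n) :
    mollifier n (w • z) = mollifier n z := by
  rw [mollifier, mollifier, radialBump, radialBump, norm_smul, hw, one_mul]

theorem cconv_mollifier_of_differentiable {h : ComplexSpace n → ℂ} (hh : Differentiable ℂ h) :
    cconv h (mollifier n) = h := by
  funext x
  have hcs := hasCompactSupport_mollifier n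
  have hc := (contDiff_mollifier n).continuous
  have hconv : Integrable fun t => h (x - t) * mollifier n t :=
    ((hh.continuous.comp (by fun_prop)).mul hc).integrable_of_hasCompactSupport hcs.mul_left
  have hmol : Integrable fun t => h x * mollifier n t :=
    (hc.integrable_of_hasCompactSupport hcs).const_mul _
  have hdiff : ∫ t, (h (x - t) * mollifier n t - h x * mollifier n t) = 0 := by
    refine integral_eq_zero_of_circleAverage measurePreserving_rotation (hconv.sub hmol)
      fun t => ?_
    have hcircle : CircleIntegrable (fun w => h (x + w • -t)) 0 1 :=
      (hh.continuous.comp (by fun_prop)).continuousOn.circleIntegrable zero_le_one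
    have hmean := circleAverage_pow_mul_comp hh x (-t) 0
    simp only [pow_zero, one_mul] at hmean
    have havg : Real.circleAverage (fun w => mollifier n t • (h (x + w • -t) - h x)) 0 1 = 0 := by
      rw [Real.circleAverage_fun_smul,
        Real.circleAverage_fun_sub hcircle (circleIntegrable_const _ _ _), hmean,
        Real.circleAverage_const, sub_self, smul_zero]
    refine (Real.circleAverage_congr_sphere fun w hw => ?_).trans havg
    simp only [mollifier_smul (n := n) (w := w) (by simpa using hw), smul_neg, ← sub_eq_add_neg,
      smul_eq_mul]
    ring
  rw [integral_sub hconv hmol, integral_const_mul, integral_mollifier, mul_one,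
    sub_eq_zero] at hdiff
  rw [cconv, convolution_eq_swap, ← hdiff]
  rfl

theorem IsPolyanalytic.sub_cconv_mollifier {m : ℕ} (hg : IsPolyanalytic (m + 1) g) :
    IsPolyanalytic m (g - cconv g (mollifier n)) := by
  have hφ := contDiff_mollifier n
  have hφc := hasCompactSupport_mollifier n
  have hgφ : ContDiff ℝ (⊤ : ℕ∞) (cconv g (mollifier n)) :=
    contDiff_cconv hg.1.continuous.locallyIntegrable hφ hφc
  refine ⟨hg.1.sub hgφ, fun k hk => ?_⟩
  have hentire : Differentiable ℂ (dbarPow k g) :=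
    differentiable_of_dbar_eq_zero ((contDiff_dbarPow k hg.1).differentiable (by simp)) fun r => by
      simpa only [one_mul] using hg.dbar_dbarPow_eq_zero hk 1 r
  have hneg : g - cconv g (mollifier n) = g + fun z => (-1 : ℂ) * cconv g (mollifier n) z := by
    funext z
    simp [sub_eq_add_neg]
  rw [hneg, dbarPow_add k hg.1 (contDiff_const.mul hgφ), dbarPow_const_mul k _ hgφ,
    dbarPow_cconv_left k hg.1 hφ hφc, cconv_mollifier_of_differentiable hentire]
  funext z
  simp

/-- A convolution kernel that reproduces every `m`-analytic function is obtained recursively: if `Ψ`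
reproduces the `m`-analytic functions and `φ` is the mollifier, then `Ψ - (φ ∗ Ψ - φ)` reproduces
the `(m+1)`-analytic functions `g`, because `g - g ∗ φ` is `m`-analytic. -/
theorem exists_reproducing (n m : ℕ) : ∃ Ψ : ComplexSpace n → ℂ, ContDiff ℝ (⊤ : ℕ∞) Ψ ∧
    HasCompactSupport Ψ ∧ ∀ g, IsPolyanalytic m g → cconv g Ψ = g := by
  induction m with
  | zero =>
    refine ⟨0, contDiff_const, HasCompactSupport.zero, fun g hg => ?_⟩
    have hzero := hg.2 0 (by simp)
    rw [dbarPow_zero] at hzero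
    rw [hzero]
    exact convolution_zero
  | succ m ih =>
    obtain ⟨Ψ, hΨ, hΨc, hrep⟩ := ih
    have hφ := contDiff_mollifier n
    have hφc := hasCompactSupport_mollifier n
    have hφΨ : ContDiff ℝ (⊤ : ℕ∞) (cconv (mollifier n) Ψ) :=
      contDiff_cconv hφ.continuous.locallyIntegrable hΨ hΨc
    have hφΨc : HasCompactSupport (cconv (mollifier n) Ψ) := hφc.convolution _ hΨc
    refine ⟨Ψ - (cconv (mollifier n) Ψ - mollifier n), hΨ.sub (hφΨ.sub hφ),
      hΨc.sub (hφΨc.sub hφc), fun g hg => ?_⟩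
    have hgl := hg.1.continuous.locallyIntegrable (μ := (volume : Measure (ComplexSpace n)))
    have hgφ := contDiff_cconv hgl hφ hφc
    have hsub := hrep _ hg.sub_cconv_mollifier
    rw [sub_cconv hgl hgφ.continuous.locallyIntegrable hΨ.continuous hΨc,
      cconv_assoc hg.1.continuous hφ.continuous hφc hΨ.continuous hΨc] at hsub
    rw [cconv_sub hgl hΨ.continuous hΨc (hφΨ.continuous.sub hφ.continuous) (hφΨc.sub hφc),
      cconv_sub hgl hφΨ.continuous hφΨc hφ.continuous hφc, sub_sub_eq_add_sub,
      add_sub_right_comm, hsub, sub_add_cancel]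

end DbarConvolution

section Complete

variable {n : ℕ} {α : ℝ}

theorem ae_gaussian (hα : 0 < α) : ae (gaussian n α) = ae volume := by
  refine le_antisymm (withDensity_absolutelyContinuous _ _).ae_le
    (withDensity_absolutelyContinuous' (by fun_prop) (.of_forall fun z => ?_)).ae_le
  simp only [ne_eq, ENNReal.ofReal_eq_zero, not_le]
  positivity

theorem isFiniteMeasure_gaussian (hα : 0 < α) : IsFiniteMeasure (gaussian n α) :=
  isFiniteMeasure_withDensity_ofReal
    ((integrable_exp_neg_mul_sq_norm hα).const_mul (α ^ n / Real.pi ^ n)).2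

theorem locallyIntegrable_Lp_gaussian (hα : 0 < α) (f : Lp ℂ 2 (gaussian n α)) :
    LocallyIntegrable f (volume : Measure (ComplexSpace n)) := by
  have := isFiniteMeasure_gaussian (n := n) hα
  have hint : Integrable f (gaussian n α) := (Lp.memLp f).integrable (by norm_num)
  rw [integrable_gaussian_iff hα] at hint
  have hdensity (z : ComplexSpace n) : α ^ n / Real.pi ^ n * Real.exp (-α * ‖z‖ ^ 2) ≠ 0 := by
    positivity
  have hcont : Continuous fun z : ComplexSpace n =>
      (((α ^ n / Real.pi ^ n * Real.exp (-α * ‖z‖ ^ 2))⁻¹ : ℝ) : ℂ) :=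
    Complex.continuous_ofReal.comp (Continuous.inv₀ (by fun_prop) hdensity)
  refine (hint.locallyIntegrable.mul_continuous hcont).congr (.of_forall fun z => ?_)
  simp only [Complex.real_smul]
  rw [mul_right_comm, ← Complex.ofReal_mul, mul_inv_cancel₀ (hdensity z), Complex.ofReal_one,
    one_mul]

theorem integral_gaussian (hα : 0 < α) (f : ComplexSpace n → ℂ) : ∫ z, f z ∂gaussian n α =
    ∫ z, (α ^ n / Real.pi ^ n * Real.exp (-α * ‖z‖ ^ 2)) • f z := by
  rw [gaussian, integral_withDensity_eq_integral_toReal_smul (by fun_prop) (by simp)]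
  congr 1
  funext z
  rw [ENNReal.toReal_ofReal (by positivity)]

theorem continuous_integral_mul (hα : 0 < α) {ψ : ComplexSpace n → ℂ} (hψ : Continuous ψ)
    (hψc : HasCompactSupport ψ) :
    Continuous fun f : Lp ℂ 2 (gaussian n α) => ∫ t, f t * ψ t := by
  have := isFiniteMeasure_gaussian (n := n) hα
  let ρ : ComplexSpace n → ℝ := fun z => α ^ n / Real.pi ^ n * Real.exp (-α * ‖z‖ ^ 2)
  have hρ (z : ComplexSpace n) : ρ z ≠ 0 := by positivity
  have hquot : MemLp (fun z => starRingEnd ℂ (ψ z * ((ρ z)⁻¹ : ℝ))) 2 (gaussian n α) :=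
    (Complex.continuous_conj.comp (hψ.mul (Complex.continuous_ofReal.comp
      (Continuous.inv₀ (by fun_prop) hρ)))).memLp_of_hasCompactSupport
      (hψc.mul_right.comp_left (map_zero _))
  have hinner (f : Lp ℂ 2 (gaussian n α)) : ∫ t, f t * ψ t = inner ℂ (hquot.toLp _) f := by
    rw [L2.inner_def]
    have hint : ∫ z, inner ℂ ((hquot.toLp _ : Lp ℂ 2 (gaussian n α)) z) (f z) ∂gaussian n α =
        ∫ z, f z * (ψ z * ((ρ z)⁻¹ : ℝ)) ∂gaussian n α := by
      refine integral_congr_ae ?_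
      filter_upwards [hquot.coeFn_toLp] with z hz
      rw [hz, RCLike.inner_apply, Complex.conj_conj]
    rw [hint, integral_gaussian hα]
    congr 1
    funext z
    change _ = ρ z • _
    have hρz : (ρ z : ℂ) ≠ 0 := Complex.ofReal_ne_zero.2 (hρ z)
    rw [Complex.real_smul, Complex.ofReal_inv]
    field_simp
  simp only [hinner]
  fun_prop

theorem continuous_cconv_Lp (hα : 0 < α) {ψ : ComplexSpace n → ℂ} (hψ : Continuous ψ)
    (hψc : HasCompactSupport ψ) (z : ComplexSpace n) :
    Continuous fun f : Lp ℂ 2 (gaussian n α) => cconv f ψ z :=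
  continuous_integral_mul hα (ψ := fun t => ψ (z - t)) (by fun_prop)
    (hψc.comp_homeomorph (Homeomorph.subLeft z))

theorem isPolyanalytic_cconv_of_mem_closure {m : ℕ} (hα : 0 < α) {Ψ : ComplexSpace n → ℂ}
    (hΨ : ContDiff ℝ (⊤ : ℕ∞) Ψ) (hΨc : HasCompactSupport Ψ)
    (hrep : ∀ g, IsPolyanalytic m g → cconv g Ψ = g) {f : Lp ℂ 2 (gaussian n α)}
    (hf : f ∈ closure (fock n m α : Set (Lp ℂ 2 (gaussian n α)))) :
    IsPolyanalytic m (cconv f Ψ) := by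
  refine ⟨contDiff_cconv (locallyIntegrable_Lp_gaussian hα f) hΨ hΨc, fun k hk => ?_⟩
  obtain ⟨hcomm, hsupp⟩ := dbarPow_cconv_right k (locallyIntegrable_Lp_gaussian hα f) hΨ hΨc
  rw [hcomm]
  funext z
  have hclosed : IsClosed {f : Lp ℂ 2 (gaussian n α) | cconv f (dbarPow k Ψ) z = 0} :=
    isClosed_eq (continuous_cconv_Lp hα (contDiff_dbarPow k hΨ).continuous hsupp z)
      continuous_const
  refine closure_minimal (fun f hf => ?_) hclosed hf
  obtain ⟨g, hg, hfg⟩ := hf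
  rw [Filter.EventuallyEq, ae_gaussian hα] at hfg
  rw [Set.mem_ofPred_eq, cconv_congr_ae _ hfg,
    ← (dbarPow_cconv_right k hg.1.continuous.locallyIntegrable hΨ hΨc).1, hrep g hg, hg.2 k hk]
  rfl

theorem ae_eq_cconv_of_mem_closure {m : ℕ} (hα : 0 < α) {Ψ : ComplexSpace n → ℂ}
    (hΨ : Continuous Ψ) (hΨc : HasCompactSupport Ψ)
    (hrep : ∀ g, IsPolyanalytic m g → cconv g Ψ = g) {f : Lp ℂ 2 (gaussian n α)}
    (hf : f ∈ closure (fock n m α : Set (Lp ℂ 2 (gaussian n α)))) :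
    f =ᵐ[gaussian n α] cconv f Ψ := by
  obtain ⟨u, hu, hlim⟩ := mem_closure_iff_seq_limit.1 hf
  obtain ⟨ns, hns, hae⟩ := (tendstoInMeasure_of_tendsto_Lp hlim).exists_seq_tendsto_ae
  have hfix : ∀ᵐ z ∂gaussian n α, ∀ i, u i z = cconv (u i) Ψ z := ae_all_iff.2 fun i => by
    obtain ⟨g, hg, hug⟩ := hu i
    filter_upwards [hug] with z hz
    rw [Filter.EventuallyEq, ae_gaussian hα] at hug
    rw [cconv_congr_ae _ hug, hrep g hg, hz]
  filter_upwards [hae, hfix] with z hlimz hfixz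
  simp only [hfixz] at hlimz
  exact tendsto_nhds_unique hlimz
    (((continuous_cconv_Lp hα hΨ hΨc z).tendsto f).comp (hlim.comp hns.tendsto_atTop))

theorem isClosed_fock (n m : ℕ) (hα : 0 < α) :
    IsClosed (fock n m α : Set (Lp ℂ 2 (gaussian n α))) := by
  obtain ⟨Ψ, hΨ, hΨc, hrep⟩ := exists_reproducing n m
  exact isClosed_of_closure_subset fun f hf => ⟨cconv f Ψ,
    isPolyanalytic_cconv_of_mem_closure hα hΨ hΨc hrep hf,
    ae_eq_cconv_of_mem_closure hα hΨ.continuous hΨc hrep hf⟩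

theorem completeSpace_fock (n m : ℕ) (hα : 0 < α) : CompleteSpace (fock n m α) :=
  (isClosed_fock n m hα).completeSpace_coe

end Complete

/-! ### Fourier integrals of polynomials times Gaussians -/

section GaussianFourier

open Polynomial

theorem derivative_hermiteR_succ (k : ℕ) :
    derivative (hermiteR (k + 1)) = (k + 1 : ℝ[X]) * hermiteR k := by
  induction k with
  | zero => simp [hermiteR]
  | succ k ih =>
    rw [hermiteR_succ (k + 1), derivative_sub, derivative_mul, derivative_X, ih, derivative_mul]
    simp only [derivative_add, derivative_natCast, derivative_one, add_zero, zero_mul, zero_add]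
    push_cast
    linear_combination (-(k + 1 : ℝ[X])) * hermiteR_succ k

theorem hermiteR_add_two (k : ℕ) :
    hermiteR (k + 2) = X * hermiteR (k + 1) - (k + 1 : ℝ[X]) * hermiteR k := by
  rw [hermiteR_succ, derivative_hermiteR_succ]

/-- The function `x ↦ p(x) e^{-x²/2 - isx}`, whose integral is the Fourier transform at `s` of the
polynomial `p` times the Gaussian. -/
def polyExp (p : ℂ[X]) (s x : ℝ) : ℂ :=
  p.eval (x : ℂ) * Complex.exp (-(1 / 2) * (x : ℂ) ^ 2 - Complex.I * s * x)

theorem continuous_polyExp (p : ℂ[X]) (s : ℝ) : Continuous (polyExp p s) := by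
  unfold polyExp
  fun_prop

theorem norm_polyExp (p : ℂ[X]) (s x : ℝ) :
    ‖polyExp p s x‖ = ‖p.eval (x : ℂ)‖ * Real.exp (-(1 / 2) * x ^ 2) := by
  rw [polyExp, norm_mul, Complex.norm_exp]
  congr 2
  simp [← Complex.ofReal_pow]

theorem integrable_polyExp (p : ℂ[X]) (s : ℝ) : Integrable (polyExp p s) := by
  induction p using Polynomial.induction_on' with
  | add p q hp hq =>
    refine (hp.add hq).congr (.of_forall fun x => ?_)
    simp [polyExp, add_mul]
  | monomial j c =>
    refine ((integrable_eval_mul_exp (X ^ j) one_half_pos).norm.const_mul ‖c‖).mono'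
      (continuous_polyExp _ s).aestronglyMeasurable (.of_forall fun x => ?_)
    rw [norm_polyExp, eval_monomial]
    simp [mul_assoc]

theorem integral_polyExp_add_C_mul (p q : ℂ[X]) (c : ℂ) (s : ℝ) :
    ∫ x, polyExp (p + C c * q) s x = (∫ x, polyExp p s x) + c * ∫ x, polyExp q s x := by
  rw [← integral_const_mul, ← integral_add (integrable_polyExp p s)
    ((integrable_polyExp q s).const_mul c)]
  refine integral_congr_ae (.of_forall fun x => ?_)
  simp only [polyExp, eval_add, eval_mul, eval_C]
  ring

theorem hasDerivAt_polyExp (p : ℂ[X]) (s x : ℝ) :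
    HasDerivAt (polyExp p s) (polyExp (derivative p - (X + C (Complex.I * s)) * p) s x) x := by
  have hexp : HasDerivAt (fun z : ℂ => Complex.exp (-(1 / 2) * z ^ 2 - Complex.I * s * z))
      (Complex.exp (-(1 / 2) * (x : ℂ) ^ 2 - Complex.I * s * x) *
        (-(1 / 2) * (2 * (x : ℂ)) - Complex.I * s)) (x : ℂ) := by
    simpa using! (((hasDerivAt_pow 2 (x : ℂ)).const_mul (-(1 / 2) : ℂ)).sub
      ((hasDerivAt_id (x : ℂ)).const_mul (Complex.I * s))).cexp
  refine ((p.hasDerivAt (x : ℂ)).mul hexp).comp_ofReal.congr_deriv ?_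
  simp only [polyExp, eval_sub, eval_mul, eval_add, eval_X, eval_C]
  ring

theorem integral_polyExp_derivative (p : ℂ[X]) (s : ℝ) :
    ∫ x, polyExp (derivative p - (X + C (Complex.I * s)) * p) s x = 0 :=
  integral_eq_zero_of_hasDerivAt_of_integrable (hasDerivAt_polyExp p s) (integrable_polyExp _ s)
    (integrable_polyExp _ s)

theorem integral_polyExp_pow_succ (k : ℕ) (y s : ℝ) :
    ∫ x, polyExp ((X - C (Complex.I * y)) ^ (k + 1)) s x =
      k * (∫ x, polyExp ((X - C (Complex.I * y)) ^ (k - 1)) s x) -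
        Complex.I * (y + s) * ∫ x, polyExp ((X - C (Complex.I * y)) ^ k) s x := by
  set B : ℂ[X] := X - C (Complex.I * y) with hB
  have hparts := integral_polyExp_derivative (B ^ k) s
  have hexpand : derivative (B ^ k) - (X + C (Complex.I * s)) * B ^ k =
      (0 + C (k : ℂ) * B ^ (k - 1)) + C (-1) * (B ^ (k + 1) + C (Complex.I * (y + s)) * B ^ k) := by
    have hB' : derivative B = 1 := by simp [hB]
    rw [derivative_pow, hB', pow_succ]
    simp only [hB, map_add, map_mul, map_neg, map_one]
    ring
  have hzero : ∫ x, polyExp 0 s x = 0 := by simp [polyExp]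
  rw [hexpand, integral_polyExp_add_C_mul, integral_polyExp_add_C_mul, integral_polyExp_add_C_mul,
    hzero] at hparts
  linear_combination -hparts

theorem integral_polyExp_pow (k : ℕ) (y s : ℝ) :
    ∫ x, polyExp ((X - C (Complex.I * y)) ^ k) s x =
      (-Complex.I) ^ k * ((hermiteR k).eval (y + s) : ℝ) * ∫ x, polyExp 1 s x := by
  induction k using Nat.twoStepInduction with
  | zero => simp [hermiteR]
  | one =>
    have hstep := integral_polyExp_pow_succ 0 y s
    rw [zero_add] at hstep
    rw [hstep]
    simp [hermiteR]
  | more k ih₀ ih₁ =>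
    rw [integral_polyExp_pow_succ (k + 1), Nat.add_sub_cancel, ih₀, ih₁, hermiteR_add_two]
    simp only [eval_sub, eval_mul, eval_add, eval_X, eval_natCast, eval_one]
    push_cast
    linear_combination ((-Complex.I) ^ k * (k + 1) * ((hermiteR k).eval (y + s) : ℝ) *
      ∫ x, polyExp 1 s x) * Complex.I_mul_I

theorem integral_polyExp_one (s : ℝ) : ∫ x, polyExp 1 s x =
    (2 * Real.pi : ℂ) ^ (1 / 2 : ℂ) * Complex.exp (-(1 / 2) * (s : ℂ) ^ 2) := by
  have hquad : ∀ x : ℝ, polyExp 1 s x =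
      Complex.exp (-(1 / 2) * (x : ℂ) ^ 2 + -Complex.I * s * x + 0) := fun x => by
    rw [polyExp, eval_one, one_mul]
    ring_nf
  simp only [hquad]
  rw [integral_cexp_quadratic (by norm_num)]
  congr 2
  · ring_nf
  · rw [neg_mul, neg_sq, mul_pow, Complex.I_sq]
    ring

theorem integral_exp_mul_sub_I_mul_pow (k : ℕ) (ξ y : ℝ) :
    ∫ x : ℝ, Complex.exp (-Complex.I * ξ * x) *
      (Complex.exp (-(1 / 2) * (x : ℂ) ^ 2 - 1 / 2 * (y : ℂ) ^ 2 - Complex.I * (x * y)) *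
        ((x : ℂ) - Complex.I * y) ^ k) =
      (2 * Real.pi : ℂ) ^ (1 / 2 : ℂ) * (-Complex.I) ^ k * √(k.factorial / 2) *
        (Real.exp (-(1 / 4) * ξ ^ 2) * hermiteGauss k (ξ / 2 + y) : ℝ) := by
  have hpoly : ∀ x : ℝ, Complex.exp (-Complex.I * ξ * x) *
      (Complex.exp (-(1 / 2) * (x : ℂ) ^ 2 - 1 / 2 * (y : ℂ) ^ 2 - Complex.I * (x * y)) *
        ((x : ℂ) - Complex.I * y) ^ k) = Complex.exp (-(1 / 2) * (y : ℂ) ^ 2) *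
          polyExp ((X - C (Complex.I * y)) ^ k) (y + ξ) x := fun x => by
    simp only [polyExp, eval_pow, eval_sub, eval_X, eval_C]
    rw [mul_left_comm (Complex.exp _) (_ ^ k), ← Complex.exp_add, ← mul_assoc, mul_comm _ (_ ^ k),
      ← Complex.exp_add]
    push_cast
    ring_nf
  have hexp : Complex.exp (-(1 / 2) * (y : ℂ) ^ 2) *
      Complex.exp (-(1 / 2) * ((y + ξ : ℝ) : ℂ) ^ 2) =
      (Real.exp (-(1 / 4) * ξ ^ 2) * Real.exp (-(ξ / 2 + y) ^ 2) : ℝ) := by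
    rw [← Real.exp_add, ← Complex.exp_add, Complex.ofReal_exp]
    push_cast
    ring_nf
  have hfact : √(k.factorial / 2) * √(2 / k.factorial) = 1 := by
    rw [← Real.sqrt_mul (by positivity), div_mul_div_cancel₀ two_ne_zero,
      div_self (by positivity), Real.sqrt_one]
  simp only [hpoly]
  rw [integral_const_mul, integral_polyExp_pow, integral_polyExp_one, hermiteGauss,
    show 2 * (ξ / 2 + y) = y + (y + ξ) by ring]
  apply_fun ((↑) : ℝ → ℂ) at hfact
  push_cast at hexp hfact ⊢
  linear_combination ((-Complex.I) ^ k * ((hermiteR k).eval (y + (y + ξ)) : ℝ) *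
    (2 * Real.pi : ℂ) ^ (1 / 2 : ℂ)) * (hexp - hfact * Complex.exp (-(1 / 4) * (ξ : ℂ) ^ 2) *
      Complex.exp (-((ξ : ℂ) / 2 + y) ^ 2))

end GaussianFourier

/-! ### The Fourier–Plancherel transform by duality -/

section SliceIntegral

variable {X Y E : Type*} [MeasurableSpace X] [MeasurableSpace Y] {μ : Measure X} {ν : Measure Y}

theorem integrable_smul_of_memLp_two [NormedAddCommGroup E] [NormedSpace ℂ E] {f : X → ℂ}
    {g : X → E} (hf : MemLp f 2 μ) (hg : MemLp g 2 μ) : Integrable (fun x => f x • g x) μ :=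
  memLp_one_iff_integrable.1 (hg.smul hf)

theorem memLp_two_mul_prod {f : X → ℂ} {g : Y → ℂ} (hf : MemLp f 2 μ)
    (hg : MemLp g 2 ν) : MemLp (fun p : X × Y => f p.1 * g p.2) 2 (μ.prod ν) := by
  have hmeas : AEStronglyMeasurable (fun p : X × Y => f p.1 * g p.2) (μ.prod ν) :=
    hf.1.comp_fst.mul hg.1.comp_snd
  rw [memLp_two_iff_integrable_sq_norm hmeas]
  simpa only [norm_mul, mul_pow] using hf.norm.integrable_sq.mul_prod hg.norm.integrable_sq

variable [SigmaFinite μ] [SigmaFinite ν] [MeasurableSpace.CountablyGenerated Y]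

theorem coeFn_slice (f : Lp ℂ 2 (μ.prod ν)) :
    slice μ ν f =ᵐ[μ] fun x => classL2 ν fun y => f (x, y) :=
  MemLp.coeFn_toLp (memLp_classL2_slice f)

theorem coeFn_slice_toLp {f : X × Y → ℂ} (hf : MemLp f 2 (μ.prod ν)) :
    slice μ ν (hf.toLp f) =ᵐ[μ] fun x => classL2 ν fun y => f (x, y) := by
  filter_upwards [coeFn_slice (hf.toLp f), Measure.ae_ae_of_ae_prod hf.coeFn_toLp] with x hslice hx
  rw [hslice, classL2_congr hx]

theorem slice_compMeasurePreserving {φ : X → X} (hφ : MeasurePreserving φ μ μ)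
    (hφY : MeasurePreserving (fun p : X × Y => (φ p.1, p.2)) (μ.prod ν) (μ.prod ν))
    (f : Lp ℂ 2 (μ.prod ν)) :
    slice μ ν (Lp.compMeasurePreserving _ hφY f) = Lp.compMeasurePreserving φ hφ (slice μ ν f) := by
  refine Lp.ext ?_
  filter_upwards [coeFn_slice (Lp.compMeasurePreserving _ hφY f),
    Measure.ae_ae_of_ae_prod (Lp.coeFn_compMeasurePreserving f hφY),
    Lp.coeFn_compMeasurePreserving (slice μ ν f) hφ,
    hφ.quasiMeasurePreserving.ae (coeFn_slice f)] with x hleft hcomp hright hx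
  rw [hleft, hright, Function.comp_apply, hx]
  exact classL2_congr hcomp

theorem inner_integral_smul_slice {f : X × Y → ℂ} (hf : MemLp f 2 (μ.prod ν)) {h : X → ℂ}
    (hh : MemLp h 2 μ) (e : Lp ℂ 2 ν) :
    inner ℂ e (∫ x, h x • slice μ ν (hf.toLp f) x ∂μ) =
      ∫ y, (starRingEnd ℂ) (e y) * ∫ x, h x * f (x, y) ∂μ ∂ν := by
  have hslice : ∀ᵐ x ∂μ, inner ℂ e (h x • slice μ ν (hf.toLp f) x) =
      ∫ y, (h x * (starRingEnd ℂ) (e y)) * f (x, y) ∂ν := by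
    filter_upwards [coeFn_slice_toLp hf, memLp_slice hf] with x hx hm
    rw [hx, inner_smul_right, classL2_of_memLp hm, L2.inner_def, ← integral_const_mul]
    refine integral_congr_ae ?_
    filter_upwards [hm.coeFn_toLp] with y hy
    rw [hy, RCLike.inner_apply]
    ring
  have hint : Integrable (fun p : X × Y => (h p.1 * (starRingEnd ℂ) (e p.2)) * f p) (μ.prod ν) :=
    integrable_smul_of_memLp_two (memLp_two_mul_prod hh (Lp.memLp e).star) hf
  rw [← integral_inner (integrable_smul_of_memLp_two hh (Lp.memLp _)), integral_congr_ae hslice,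
    integral_integral_swap hint]
  refine integral_congr_ae (.of_forall fun y => ?_)
  simp only [← integral_const_mul]
  refine integral_congr_ae (.of_forall fun x => ?_)
  ring

end SliceIntegral

section FourierIntegral

variable {n : ℕ} {E : Type*} [NormedAddCommGroup E]

/-- The Fourier integral `ξ ↦ ∫ e^{-i⟨ξ,x⟩} f(x) dμ̃_n(x)`, in the normalization of `fourierT`. -/
def fourierIntegralT [NormedSpace ℂ E] (f : RealSpace n → E) (ξ : RealSpace n) : E :=
  ∫ x, expChar ξ x • f x ∂lebesgueT n

theorem expChar_comm (a b : RealSpace n) : expChar a b = expChar b a := by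
  rw [expChar, expChar, real_inner_comm]

theorem fourierIntegralT_eq_fourier [NormedSpace ℂ E] (f : RealSpace n → E) (ξ : RealSpace n) :
    fourierIntegralT f ξ = ((2 * Real.pi) ^ (-(n : ℝ) / 2) : ℝ) • 𝓕 f ((2 * Real.pi)⁻¹ • ξ) := by
  rw [fourierIntegralT, integral_lebesgueT, fourier_inv_two_pi_smul]

theorem fourierIntegralT_expChar_smul [NormedSpace ℂ E] (a : RealSpace n) (f : RealSpace n → E)
    (ξ : RealSpace n) :
    fourierIntegralT (fun x => expChar a x • f x) ξ = fourierIntegralT f (ξ + a) := by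
  simp only [fourierIntegralT, smul_smul, expChar_add]

theorem integral_fourierIntegralT_smul_eq [NormedSpace ℂ E] [CompleteSpace E] {f : RealSpace n → ℂ}
    {g : RealSpace n → E} (hf : Integrable f (lebesgueT n)) (hg : Integrable g (lebesgueT n)) :
    ∫ ξ, fourierIntegralT f ξ • g ξ ∂lebesgueT n =
      ∫ x, f x • fourierIntegralT g x ∂lebesgueT n := by
  have hint : Integrable (fun p : RealSpace n × RealSpace n => expChar p.1 p.2 • (f p.2 • g p.1))
      ((lebesgueT n).prod (lebesgueT n)) := by
    refine (hf.smul_prod hg).swap.bdd_smul 1 (Continuous.aestronglyMeasurable ?_)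
      (.of_forall fun p => (norm_expChar p.1 p.2).le)
    unfold expChar
    fun_prop
  calc ∫ ξ, fourierIntegralT f ξ • g ξ ∂lebesgueT n
      = ∫ ξ, ∫ x, expChar ξ x • (f x • g ξ) ∂lebesgueT n ∂lebesgueT n := by
        simp only [fourierIntegralT, ← integral_smul_const, smul_assoc]
    _ = ∫ x, ∫ ξ, expChar ξ x • (f x • g ξ) ∂lebesgueT n ∂lebesgueT n :=
        integral_integral_swap hint
    _ = ∫ x, f x • fourierIntegralT g x ∂lebesgueT n := by
        simp only [fourierIntegralT, ← integral_smul, expChar_comm _ (_ : RealSpace n),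
          smul_comm (f _)]

theorem integral_comp_inv_two_pi_smul [NormedSpace ℝ E] (f : RealSpace n → E) :
    ∫ ξ, f ((2 * Real.pi)⁻¹ • ξ) ∂lebesgueT n = ((2 * Real.pi) ^ ((n : ℝ) / 2) : ℝ) • ∫ ξ, f ξ := by
  rw [integral_lebesgueT, Measure.integral_comp_smul, smul_smul, finrank_euclideanSpace_fin,
    inv_pow, inv_inv, abs_of_pos (by positivity), ← Real.rpow_natCast,
    ← Real.rpow_add (by positivity)]
  ring_nf

theorem fourierIntegralT_comp_inv_two_pi_smul [NormedSpace ℂ E] (f : RealSpace n → E)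
    (ξ : RealSpace n) : fourierIntegralT (fun x => f ((2 * Real.pi)⁻¹ • x)) ξ =
      ((2 * Real.pi) ^ ((n : ℝ) / 2) : ℝ) • 𝓕 f ξ := by
  have hpi : 2 * Real.pi ≠ 0 := by positivity
  have hchar : ∀ x, expChar ((2 * Real.pi) • ξ) ((2 * Real.pi)⁻¹ • x) = expChar ξ x := fun x => by
    rw [expChar, expChar, real_inner_smul_left, real_inner_smul_right, mul_inv_cancel_left₀ hpi]
  have hdil := integral_comp_inv_two_pi_smul fun x => expChar ((2 * Real.pi) • ξ) x • f x
  rw [← fourier_inv_two_pi_smul, inv_smul_smul₀ hpi] at hdil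
  simpa only [fourierIntegralT, hchar] using hdil

variable {g : RealSpace n → ℂ}

theorem memLp_fourierIntegralT (hg : ContDiff ℝ (⊤ : ℕ∞) g) (hgc : HasCompactSupport g) :
    MemLp (fourierIntegralT g) 2 (lebesgueT n) := by
  have hdil := (isWeightedChange_dilation n).memLp
    ((𝓕 (hgc.toSchwartzMap hg) : 𝓢(RealSpace n, ℂ)).memLp 2 volume)
  refine (hdil.const_smul ((2 * Real.pi) ^ (-(n : ℝ) / 4))).ae_eq (.of_forall fun ξ => ?_)
  rw [fourierIntegralT_eq_fourier, Pi.smul_apply, Complex.coe_smul, smul_smul,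
    ← Real.rpow_add (by positivity), SchwartzMap.fourier_coe]
  ring_nf
  rfl

instance (n : ℕ) : IsLocallyFiniteMeasure (lebesgueT n) := by
  unfold lebesgueT
  infer_instance

theorem Lp_ext_contDiff_smul [NormedSpace ℂ E] [CompleteSpace E] {f₁ f₂ : Lp E 2 (lebesgueT n)}
    (h : ∀ g : RealSpace n → ℂ, ContDiff ℝ (⊤ : ℕ∞) g → HasCompactSupport g →
      ∫ ξ, g ξ • f₁ ξ ∂lebesgueT n = ∫ ξ, g ξ • f₂ ξ ∂lebesgueT n) : f₁ = f₂ := by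
  refine Lp.ext (ae_eq_of_integral_contDiff_smul_eq
    ((Lp.memLp f₁).locallyIntegrable one_le_two) ((Lp.memLp f₂).locallyIntegrable one_le_two)
    fun g hg hgc => ?_)
  simpa using h (fun ξ => g ξ) (Complex.ofRealCLM.contDiff.comp hg)
    (hgc.comp_left (g := fun t : ℝ => (t : ℂ)) rfl)

variable [InnerProductSpace ℂ E] [CompleteSpace E]

theorem integral_smul_fourierTransformₗᵢ (g : 𝓢(RealSpace n, ℂ))
    (f : Lp E 2 (volume : Measure (RealSpace n))) :
    ∫ ξ, g ξ • Lp.fourierTransformₗᵢ (RealSpace n) E f ξ = ∫ x, 𝓕 (⇑g) x • f x := by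
  have h := congrArg (fun T => T g) (Lp.fourier_toTemperedDistribution_eq f)
  simp only [TemperedDistribution.fourier_apply, Lp.toTemperedDistribution_apply,
    SchwartzMap.fourier_coe] at h
  exact h.symm

theorem integral_smul_fourierT (hg : ContDiff ℝ (⊤ : ℕ∞) g) (hgc : HasCompactSupport g)
    (f : Lp E 2 (lebesgueT n)) :
    ∫ ξ, g ξ • fourierT n E f ξ ∂lebesgueT n = ∫ x, fourierIntegralT g x • f x ∂lebesgueT n := by
  have hpi : 2 * Real.pi ≠ 0 := by positivity
  set c : ℝ := (2 * Real.pi) ^ (-(n : ℝ) / 4) with hc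
  set f₁ := weightedComp (isWeightedChange_id n) f
  set h : RealSpace n → ℂ := fun η => g ((2 * Real.pi) • η)
  have hsupp : HasCompactSupport h := hgc.comp_smul hpi
  have hsmooth : ContDiff ℝ (⊤ : ℕ∞) h := by fun_prop
  have hgh : g = fun ξ => h ((2 * Real.pi)⁻¹ • ξ) := by
    simp only [h, smul_inv_smul₀ hpi]
  calc ∫ ξ, g ξ • fourierT n E f ξ ∂lebesgueT n
      = ∫ ξ, c • (h ((2 * Real.pi)⁻¹ • ξ) •
          Lp.fourierTransformₗᵢ (RealSpace n) E f₁ ((2 * Real.pi)⁻¹ • ξ)) ∂lebesgueT n := by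
        refine integral_congr_ae ?_
        filter_upwards [coeFn_weightedComp (isWeightedChange_dilation n)
          (Lp.fourierTransformₗᵢ (RealSpace n) E f₁)] with ξ hξ
        rw [hgh, ← Complex.coe_smul c, smul_comm (c : ℂ), ← hξ]
        rfl
    _ = ((2 * Real.pi) ^ ((n : ℝ) / 2) : ℝ) • c • ∫ x, 𝓕 h x • f₁ x := by
        rw [integral_comp_inv_two_pi_smul fun η =>
            c • (h η • Lp.fourierTransformₗᵢ (RealSpace n) E f₁ η), integral_smul]
        exact congrArg _ (congrArg _ (integral_smul_fourierTransformₗᵢ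
          (hsupp.toSchwartzMap hsmooth) f₁))
    _ = ((2 * Real.pi) ^ ((n : ℝ) / 2) : ℝ) • ∫ x, 𝓕 h x • f x ∂lebesgueT n := by
        have hf₁ : ∫ x, 𝓕 h x • f₁ x = c • ∫ x, 𝓕 h x • f x := by
          rw [← integral_smul]
          refine integral_congr_ae ?_
          filter_upwards [coeFn_weightedComp (isWeightedChange_id n) f] with x hx
          rw [hx, smul_comm, Complex.coe_smul]
        rw [hf₁, integral_lebesgueT, smul_smul c, hc, ← Real.rpow_add (by positivity)]
        ring_nf
    _ = ∫ x, fourierIntegralT g x • f x ∂lebesgueT n := by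
        rw [← integral_smul]
        refine integral_congr_ae (.of_forall fun x => ?_)
        simp only [hgh, fourierIntegralT_comp_inv_two_pi_smul, smul_assoc]

end FourierIntegral

section PartialFourier

variable {n : ℕ}

/-- The translation `(T_a f)(x) = f(x - a)` on `L²(ℝⁿ, μ̃_n; E)`. -/
def translate {E : Type*} [NormedAddCommGroup E] [NormedSpace ℂ E] (a : RealSpace n) :
    Lp E 2 (lebesgueT n) →ₗᵢ[ℂ] Lp E 2 (lebesgueT n) :=
  Lp.compMeasurePreservingₗᵢ ℂ _ (measurePreserving_sub_right (lebesgueT n) a)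

theorem coeFn_translate {E : Type*} [NormedAddCommGroup E] [NormedSpace ℂ E] (a : RealSpace n)
    (f : Lp E 2 (lebesgueT n)) : translate a f =ᵐ[lebesgueT n] fun x => f (x - a) :=
  Lp.coeFn_compMeasurePreserving f (measurePreserving_sub_right (lebesgueT n) a)

theorem contDiff_expChar (a : RealSpace n) : ContDiff ℝ (⊤ : ℕ∞) (expChar a) := by
  unfold expChar
  exact ((Complex.ofRealCLM.contDiff.comp (contDiff_const.inner ℝ contDiff_id)).neg.mul
    contDiff_const).cexp

theorem fourierT_translate {E : Type*} [NormedAddCommGroup E] [InnerProductSpace ℂ E]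
    [CompleteSpace E] (a : RealSpace n) (f : Lp E 2 (lebesgueT n)) :
    fourierT n E (translate a f) = modulation a (fourierT n E f) := by
  refine Lp_ext_contDiff_smul fun g hg hgc => ?_
  calc ∫ ξ, g ξ • fourierT n E (translate a f) ξ ∂lebesgueT n
      = ∫ x, fourierIntegralT g x • translate a f x ∂lebesgueT n :=
        integral_smul_fourierT hg hgc (translate a f)
    _ = ∫ x, fourierIntegralT g x • f (x - a) ∂lebesgueT n := by
        refine integral_congr_ae ?_
        filter_upwards [coeFn_translate a f] with x hx
        rw [hx]
    _ = ∫ x, fourierIntegralT g (x + a) • f x ∂lebesgueT n := by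
        rw [← integral_sub_right_eq_self (fun x => fourierIntegralT g (x + a) • f x) a]
        simp only [sub_add_cancel]
    _ = ∫ x, fourierIntegralT (fun ξ => expChar a ξ • g ξ) x • f x ∂lebesgueT n := by
        simp only [fourierIntegralT_expChar_smul]
    _ = ∫ ξ, (expChar a ξ • g ξ) • fourierT n E f ξ ∂lebesgueT n :=
        (integral_smul_fourierT ((contDiff_expChar a).smul hg) hgc.smul_left f).symm
    _ = ∫ ξ, g ξ • modulation a (fourierT n E f) ξ ∂lebesgueT n := by
        refine integral_congr_ae ?_
        filter_upwards [coeFn_modulation a (fourierT n E f)] with ξ hξ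
        rw [hξ, smul_eq_mul, mul_comm, mul_smul]

theorem slice_translation (a : RealSpace n) (f : Lp ℂ 2 ((lebesgueT n).prod (lebesgueT n))) :
    slice (lebesgueT n) (lebesgueT n) (translation a f) =
      translate a (slice (lebesgueT n) (lebesgueT n) f) :=
  slice_compMeasurePreserving (measurePreserving_sub_right (lebesgueT n) a)
    (measurePreserving_horizontal a) f

theorem fourierT_slice_toLp {Y : Type*} [MeasurableSpace Y] [MeasurableSpace.CountablyGenerated Y]
    {ν : Measure Y} [SigmaFinite ν] {f w : RealSpace n × Y → ℂ}
    (hf : MemLp f 2 ((lebesgueT n).prod ν)) (hw : MemLp w 2 ((lebesgueT n).prod ν))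
    (hfi : ∀ y, Integrable (fun x => f (x, y)) (lebesgueT n))
    (hfw : ∀ ξ y, fourierIntegralT (fun x => f (x, y)) ξ = w (ξ, y)) :
    fourierT n _ (slice (lebesgueT n) ν (hf.toLp f)) = slice (lebesgueT n) ν (hw.toLp w) := by
  refine Lp_ext_contDiff_smul fun g hg hgc => ?_
  have hgi : Integrable g (lebesgueT n) := hg.continuous.integrable_of_hasCompactSupport hgc
  have hg2 : MemLp g 2 (lebesgueT n) := hg.continuous.memLp_of_hasCompactSupport hgc
  rw [integral_smul_fourierT hg hgc]
  refine ext_inner_left ℂ fun e => ?_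
  refine (inner_integral_smul_slice hf (memLp_fourierIntegralT hg hgc) e).trans
    (Eq.trans ?_ (inner_integral_smul_slice hw hg2 e).symm)
  simp only [← hfw]
  exact integral_congr_ae (.of_forall fun y =>
    congrArg _ (integral_fourierIntegralT_smul_eq hgi (hfi y)))

end PartialFourier

/-! ### The partial Fourier transform of the flattened monomials -/

section FlatMonomials

open Polynomial in
theorem integrable_exp_mul_sub_I_mul_pow (k : ℕ) (y : ℝ) :
    Integrable fun x : ℝ => Complex.exp (-(1 / 2) * (x : ℂ) ^ 2 - 1 / 2 * (y : ℂ) ^ 2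
      - Complex.I * (x * y)) * ((x : ℂ) - Complex.I * y) ^ k := by
  refine ((integrable_polyExp ((X - C (Complex.I * y)) ^ k) y).const_mul
    (Complex.exp (-(1 / 2) * (y : ℂ) ^ 2))).congr (.of_forall fun x => ?_)
  simp only [polyExp, eval_pow, eval_sub, eval_X, eval_C]
  rw [mul_left_comm, ← Complex.exp_add, mul_comm]
  ring_nf

variable {n : ℕ} {α : ℝ}

/-- The function `U z̄ᵏ`. -/
def flatMon (α : ℝ) (k : Fin n → ℕ) (p : RealSpace n × RealSpace n) : ℂ :=
  flatWeight p • conjMon k (flatPoint α p)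

theorem flatWeight_eq_prod (x y : RealSpace n) : flatWeight (x, y) =
    ∏ r, (√2 * Complex.exp (-(1 / 2) * (x r : ℂ) ^ 2 - 1 / 2 * (y r : ℂ) ^ 2
      - Complex.I * (x r * y r)) : ℂ) := by
  have htwo : (2 : ℝ) ^ ((n : ℝ) / 2) = √2 ^ n := by
    rw [Real.sqrt_eq_rpow, ← Real.rpow_mul_natCast zero_le_two]
    ring_nf
  have hexp : -(1 / 2) * (‖x‖ : ℂ) ^ 2 - 1 / 2 * (‖y‖ : ℂ) ^ 2 - Complex.I * (inner ℝ x y : ℝ) =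
      ∑ r, (-(1 / 2) * (x r : ℂ) ^ 2 - 1 / 2 * (y r : ℂ) ^ 2 - Complex.I * (x r * y r)) := by
    simp only [← Complex.ofReal_pow, EuclideanSpace.real_norm_sq_eq, PiLp.inner_apply,
      RCLike.inner_apply, conj_trivial, Finset.sum_sub_distrib, ← Finset.mul_sum,
      Complex.ofReal_sum, Complex.ofReal_mul, mul_comm (y _ : ℂ)]
  rw [flatWeight, hexp, Complex.exp_sum, htwo, Finset.prod_mul_distrib]
  simp

theorem conjMon_flatPoint (α : ℝ) (k : Fin n → ℕ) (x y : RealSpace n) :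
    conjMon k (flatPoint α (x, y)) =
      ∏ r, ((√α : ℂ)⁻¹ ^ k r * ((x r : ℂ) - Complex.I * y r) ^ k r) := by
  refine Finset.prod_congr rfl fun r _ => ?_
  rw [← mul_pow]
  simp [flatPoint, complexPoint, sub_eq_add_neg, mul_add]

theorem flatMon_eq_prod (α : ℝ) (k : Fin n → ℕ) (x y : RealSpace n) :
    flatMon α k (x, y) = ∏ r, (√2 * (√α : ℂ)⁻¹ ^ k r *
      (Complex.exp (-(1 / 2) * (x r : ℂ) ^ 2 - 1 / 2 * (y r : ℂ) ^ 2
        - Complex.I * (x r * y r)) * ((x r : ℂ) - Complex.I * y r) ^ k r)) := by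
  rw [flatMon, flatWeight_eq_prod, conjMon_flatPoint, smul_eq_mul, ← Finset.prod_mul_distrib]
  refine Finset.prod_congr rfl fun r _ => ?_
  ring

theorem integrable_flatMon (α : ℝ) (k : Fin n → ℕ) (y : RealSpace n) :
    Integrable (fun x => flatMon α k (x, y)) (lebesgueT n) := by
  simp only [integrable_lebesgueT_iff, flatMon_eq_prod]
  exact integrable_prod_coord fun r => (integrable_exp_mul_sub_I_mul_pow (k r) (y r)).const_mul
    (√2 * (√α : ℂ)⁻¹ ^ k r)

theorem memLp_flatMon (hα : 0 < α) (k : Fin n → ℕ) :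
    MemLp (flatMon α k) 2 ((lebesgueT n).prod (lebesgueT n)) :=
  (isWeightedChange_flat hα).memLp (memLp_conjMon hα k)

/-- The constant `∏ (-i/√α)^{k_r} √(k_r!)` relating the partial Fourier transform of `U z̄ᵏ` to
`q_{k,ξ}`. -/
def flatMonConst (α : ℝ) (k : Fin n → ℕ) : ℂ :=
  ∏ r, ((-Complex.I * (√α : ℂ)⁻¹) ^ k r * √(k r).factorial)

theorem flatMonConst_ne_zero (hα : 0 < α) (k : Fin n → ℕ) : flatMonConst α k ≠ 0 := by
  have hsqrt : (√α : ℂ) ≠ 0 := Complex.ofReal_ne_zero.2 (Real.sqrt_pos.2 hα).ne'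
  refine Finset.prod_ne_zero_iff.2 fun r _ => mul_ne_zero (pow_ne_zero _ ?_) ?_
  · exact mul_ne_zero (neg_ne_zero.2 Complex.I_ne_zero) (inv_ne_zero hsqrt)
  · exact Complex.ofReal_ne_zero.2 (by positivity)

theorem fourierIntegralT_flatMon (α : ℝ) (k : Fin n → ℕ) (ξ y : RealSpace n) :
    fourierIntegralT (fun x => flatMon α k (x, y)) ξ =
      flatMonConst α k * (Real.exp (-(1 / 4) * ‖ξ‖ ^ 2) : ℂ) * qFun k ξ y := by
  have hfactor : ∀ x, expChar ξ x • flatMon α k (x, y) = ∏ r, (√2 * (√α : ℂ)⁻¹ ^ k r *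
      (Complex.exp (-Complex.I * ξ r * x r) * (Complex.exp (-(1 / 2) * (x r : ℂ) ^ 2
        - 1 / 2 * (y r : ℂ) ^ 2 - Complex.I * (x r * y r)) *
          ((x r : ℂ) - Complex.I * y r) ^ k r))) := fun x => by
    rw [flatMon_eq_prod, expChar_eq_prod, smul_eq_mul, ← Finset.prod_mul_distrib]
    refine Finset.prod_congr rfl fun r _ => ?_
    ring
  have hexp : (Real.exp (-(1 / 4) * ‖ξ‖ ^ 2) : ℂ) = ∏ r, (Real.exp (-(1 / 4) * ξ r ^ 2) : ℂ) := by
    rw [← Complex.ofReal_prod, ← Real.exp_sum, EuclideanSpace.real_norm_sq_eq, Finset.mul_sum]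
  have hpi : (((2 * Real.pi) ^ (-(1 / 2) : ℝ) : ℝ) : ℂ) * (2 * Real.pi : ℂ) ^ (1 / 2 : ℂ) = 1 := by
    rw [Complex.ofReal_cpow (by positivity)]
    push_cast
    rw [Complex.cpow_neg, inv_mul_cancel₀]
    simp [Complex.cpow_eq_zero_iff, Real.pi_ne_zero]
  simp only [fourierIntegralT, hfactor]
  rw [integral_prod_coord_lebesgueT (𝕜 := ℂ) fun r (t : ℝ) => √2 * (√α : ℂ)⁻¹ ^ k r *
      (Complex.exp (-Complex.I * ξ r * t) * (Complex.exp (-(1 / 2) * (t : ℂ) ^ 2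
        - 1 / 2 * (y r : ℂ) ^ 2 - Complex.I * (t * y r)) * ((t : ℂ) - Complex.I * y r) ^ k r)),
    flatMonConst, hexp, qFun_eq_prod_hermiteGauss, ← Finset.prod_mul_distrib,
    ← Finset.prod_mul_distrib]
  refine Finset.prod_congr rfl fun r _ => ?_
  have hfact : (√2 : ℂ) * √((k r).factorial / 2) = √(k r).factorial := by
    rw [← Complex.ofReal_mul, ← Real.sqrt_mul zero_le_two, mul_div_cancel₀ _ two_ne_zero]
  rw [integral_const_mul, integral_exp_mul_sub_I_mul_pow, ← hfact, mul_pow]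
  push_cast
  linear_combination (√2 * (√α : ℂ)⁻¹ ^ k r * (-Complex.I) ^ k r * √((k r).factorial / 2) *
    Complex.exp (-(1 / 4) * (ξ r : ℂ) ^ 2) * hermiteGauss (k r) (ξ r / 2 + y r)) * hpi

theorem memLp_gaussian_mul_qFun {b : ℝ} (hb : 0 < b) (k : Fin n → ℕ) :
    MemLp (fun p : RealSpace n × RealSpace n =>
      (Real.exp (-b * ‖p.1‖ ^ 2) : ℂ) * qFun k p.1 p.2) 2 ((lebesgueT n).prod (lebesgueT n)) := by
  have hshear : MeasurePreserving (fun p : RealSpace n × RealSpace n =>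
      (p.1, p.2 + (2 : ℝ)⁻¹ • p.1)) ((lebesgueT n).prod (lebesgueT n))
      ((lebesgueT n).prod (lebesgueT n)) :=
    (MeasurePreserving.id _).skew_product (g := fun ξ v => v + (2 : ℝ)⁻¹ • ξ) (by fun_prop)
      (.of_forall fun ξ => (measurePreserving_half ξ).map_eq)
  have hprod := memLp_two_mul_prod (memLp_exp_neg_mul_sq_norm n hb) (memLp_qFun_zero k)
  refine (hprod.comp_measurePreserving hshear).ae_eq (.of_forall fun p => ?_)
  simp only [Function.comp_apply]
  rw [← qFun_eq]

theorem flatten_monL2 (hα : 0 < α) (k : Fin n → ℕ) :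
    flatten n hα (monL2 hα k) = (memLp_flatMon hα k).toLp _ :=
  MemLp.toLp_congr ((isWeightedChange_flat hα).memLp (Lp.memLp _)) _
    ((isWeightedChange_flat hα).ae_smul_eq (coeFn_monL2 hα k))

theorem fourierT_slice_flatten_monL2 (hα : 0 < α) (k : Fin n → ℕ) :
    fourierT n _ (slice (lebesgueT n) (lebesgueT n) (flatten n hα (monL2 hα k))) =ᵐ[lebesgueT n]
      fun ξ => (flatMonConst α k * (Real.exp (-(1 / 4) * ‖ξ‖ ^ 2) : ℂ)) • q k ξ := by
  have hw := (memLp_gaussian_mul_qFun (b := 1 / 4) (by norm_num) k).const_mul (flatMonConst α k)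
  have hfw : ∀ ξ y, fourierIntegralT (fun x => flatMon α k (x, y)) ξ =
      flatMonConst α k * ((Real.exp (-(1 / 4) * ‖ξ‖ ^ 2) : ℂ) * qFun k ξ y) := fun ξ y => by
    rw [fourierIntegralT_flatMon, mul_assoc]
  rw [flatten_monL2, fourierT_slice_toLp (memLp_flatMon hα k) hw (integrable_flatMon α k) hfw]
  refine (coeFn_slice_toLp hw).trans (.of_forall fun ξ => ?_)
  simp only [← mul_assoc]
  rw [q, ← MemLp.toLp_const_smul]
  exact classL2_of_memLp ((memLp_qFun k ξ).const_smul
    (flatMonConst α k * (Real.exp (-(1 / 4) * ‖ξ‖ ^ 2) : ℂ)))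

end FlatMonomials

/-! ### The unitary operators `R` -/

section Partial

variable {n m : ℕ}

/-- The partial Fourier transform `F ⊗ I` on `L²(ℝ²ⁿ, μ̃_{2n})`, with `F f` read as the
`L²(ℝⁿ, μ̃_n)`-valued function `ξ ↦ (F ⊗ I) f (ξ, ·)`. -/
def partialFourier (n : ℕ) : Lp ℂ 2 ((lebesgueT n).prod (lebesgueT n)) →ₗᵢ[ℂ]
    Lp (Lp ℂ 2 (lebesgueT n)) 2 (lebesgueT n) :=
  (fourierT n (Lp ℂ 2 (lebesgueT n))).comp (slice (lebesgueT n) (lebesgueT n))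

theorem partialFourier_translation (a : RealSpace n)
    (f : Lp ℂ 2 ((lebesgueT n).prod (lebesgueT n))) :
    partialFourier n (translation a f) = modulation a (partialFourier n f) :=
  (congrArg (fourierT n _) (slice_translation a f)).trans (fourierT_translate a _)

theorem coeFn_fiberCoeffs (f : Lp (Lp ℂ 2 (lebesgueT n)) 2 (lebesgueT n)) :
    fiberCoeffs n m f =ᵐ[lebesgueT n] fun ξ => coeffs n m ξ (f ξ) := by
  filter_upwards [(memLp_coeffs n m).coeFn_toLp, ContinuousLinearMap.coeFn_holder (r := 2)
    (ContinuousLinearMap.id ℂ (Lp ℂ 2 (lebesgueT n) →L[ℂ] EuclideanSpace ℂ (Fin (dim n m))))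
    ((memLp_coeffs n m).toLp (coeffs n m)) f] with ξ hcoeffs hholder
  refine hholder.trans ?_
  rw [hcoeffs]
  rfl

theorem fiberCoeffs_modulation (a : RealSpace n)
    (f : Lp (Lp ℂ 2 (lebesgueT n)) 2 (lebesgueT n)) :
    fiberCoeffs n m (modulation a f) = modulation a (fiberCoeffs n m f) := by
  refine Lp.ext ?_
  filter_upwards [coeFn_fiberCoeffs (m := m) (modulation a f), coeFn_modulation a f,
    coeFn_modulation a (fiberCoeffs n m f), coeFn_fiberCoeffs (m := m) f] with ξ h₁ h₂ h₃ h₄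
  rw [h₁, h₂, h₃, h₄, map_smul]

theorem norm_fiberCoeffs {f : Lp (Lp ℂ 2 (lebesgueT n)) 2 (lebesgueT n)}
    (h : ∀ k : Fin n → ℕ, m ≤ ∑ r, k r → ∀ᵐ ξ ∂lebesgueT n, inner ℂ (q k ξ) (f ξ) = (0 : ℂ)) :
    ‖fiberCoeffs n m f‖ = ‖f‖ := by
  rw [Lp.norm_def, Lp.norm_def]
  refine congrArg ENNReal.toReal (eLpNorm_congr_norm_ae ?_)
  have hall : ∀ᵐ ξ ∂lebesgueT n, ∀ k : Fin n → ℕ, m ≤ ∑ r, k r → inner ℂ (q k ξ) (f ξ) = (0 : ℂ) :=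
    ae_all_iff.2 fun k => Filter.eventually_imp_distrib_left.2 (h k)
  filter_upwards [coeFn_fiberCoeffs (m := m) f, hall] with ξ hcoeffs hξ
  rw [hcoeffs, norm_coeffs_eq hξ]

theorem ae_inner_eq_zero_of_inner_modulation_eq_zero {E : Type*} [NormedAddCommGroup E]
    [InnerProductSpace ℂ E] {f u : Lp E 2 (lebesgueT n)} {c : RealSpace n → ℂ} {e : RealSpace n → E}
    (hf : f =ᵐ[lebesgueT n] fun ξ => c ξ • e ξ) (hc : ∀ ξ, c ξ ≠ 0)
    (h : ∀ a, inner ℂ f (modulation a u) = (0 : ℂ)) :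
    ∀ᵐ ξ ∂lebesgueT n, inner ℂ (e ξ) (u ξ) = (0 : ℂ) := by
  have hzero : ∀ᵐ ξ ∂lebesgueT n, (inner ℂ (f ξ) (u ξ) : ℂ) = inner ℂ (f ξ) ((0 : Lp E 2 _) ξ) :=
    ae_inner_eq_of_inner_modulation_eq fun a => by rw [h, map_zero, inner_zero_right]
  filter_upwards [hzero, hf, Lp.coeFn_zero E 2 (lebesgueT n)] with ξ hξ hfξ h0
  rw [h0, hfξ, inner_smul_left, Pi.zero_apply, inner_zero_right] at hξ
  exact (mul_eq_zero.1 hξ).resolve_left ((map_ne_zero _).2 (hc ξ))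

end Partial

theorem surjective_of_norm_map_of_inner_eq_zero {𝕜 H K : Type*} [RCLike 𝕜] [NormedAddCommGroup H]
    [InnerProductSpace 𝕜 H] [CompleteSpace H] [NormedAddCommGroup K] [InnerProductSpace 𝕜 K]
    [CompleteSpace K] {R : H →L[𝕜] K} (hR : ∀ x, ‖R x‖ = ‖x‖)
    (h : ∀ u, (∀ x, inner 𝕜 (R x) u = 0) → u = 0) : Function.Surjective R := by
  have hclosed : IsClosed (R.range : Set K) :=
    (AddMonoidHomClass.isometry_of_norm R hR).isClosedEmbedding.isClosed_range
  have : CompleteSpace R.range := hclosed.completeSpace_coe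
  refine LinearMap.range_eq_top.1 (Submodule.orthogonal_eq_bot_iff.1 ?_)
  exact (Submodule.eq_bot_iff _).2 fun u hu => h u fun x => hu _ ⟨x, rfl⟩

section FlatFock

variable {n m : ℕ} {α : ℝ} (hα : 0 < α)

theorem flatMonConst_mul_exp_ne_zero {α : ℝ} (hα : 0 < α) (k : Fin n → ℕ) (ξ : RealSpace n) :
    flatMonConst α k * (Real.exp (-(1 / 4) * ‖ξ‖ ^ 2) : ℂ) ≠ 0 :=
  mul_ne_zero (flatMonConst_ne_zero hα k) (Complex.ofReal_ne_zero.2 (Real.exp_pos _).ne')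

theorem RH_rhoH (a : RealSpace n) (g : flatFock n m hα) :
    RH n m hα (rhoH n m hα a g) = modulation a (RH n m hα g) :=
  (congrArg (fiberCoeffs n m) (partialFourier_translation a g)).trans (fiberCoeffs_modulation a _)

theorem ae_inner_q_partialFourier_eq_zero {g : Lp ℂ 2 ((lebesgueT n).prod (lebesgueT n))}
    (hg : g ∈ flatFock n m hα) {k : Fin n → ℕ} (hk : m ≤ ∑ r, k r) :
    ∀ᵐ ξ ∂lebesgueT n, inner ℂ (q k ξ) (partialFourier n g ξ) = (0 : ℂ) := by
  refine ae_inner_eq_zero_of_inner_modulation_eq_zero (fourierT_slice_flatten_monL2 hα k)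
    (flatMonConst_mul_exp_ne_zero hα k) fun a => ?_
  obtain ⟨f, hf, hfg⟩ := translation_mem_flatFock hα a g hg
  rw [← partialFourier_translation, ← hfg]
  exact ((partialFourier n).inner_map_map _ _).trans
    (((flatten n hα).inner_map_map _ _).trans (inner_monL2_eq_zero hα hk hf))

theorem norm_RH (g : flatFock n m hα) : ‖RH n m hα g‖ = ‖g‖ :=
  (norm_fiberCoeffs fun _ hk => ae_inner_q_partialFourier_eq_zero hα g.2 hk).trans
    ((partialFourier n).norm_map g)

theorem RH_flattenFock_monL2 (j : Fin (dim n m)) :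
    RH n m hα (flattenFock n m hα ⟨monL2 hα (enum n m j), monL2_mem_fock hα (sum_enum_lt j)⟩)
      =ᵐ[lebesgueT n] fun ξ => (flatMonConst α (enum n m j) *
        (Real.exp (-(1 / 4) * ‖ξ‖ ^ 2) : ℂ)) • EuclideanSpace.single j (1 : ℂ) := by
  refine (coeFn_fiberCoeffs _).trans ?_
  filter_upwards [fourierT_slice_flatten_monL2 hα (enum n m j)] with ξ hξ
  exact (congrArg (coeffs n m ξ) hξ).trans (by rw [map_smul, coeffs_q_enum])

theorem eq_zero_of_inner_RH_eq_zero {u : L2d n m}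
    (hu : ∀ g, inner ℂ (RH n m hα g) u = (0 : ℂ)) : u = 0 := by
  have hcoord : ∀ j, ∀ᵐ ξ ∂lebesgueT n, inner ℂ (EuclideanSpace.single j (1 : ℂ)) (u ξ) = (0 : ℂ) :=
    fun j => ae_inner_eq_zero_of_inner_modulation_eq_zero (RH_flattenFock_monL2 hα j)
      (flatMonConst_mul_exp_ne_zero hα _) fun a => by
        rw [← neg_neg a, ← inner_modulation_left, ← RH_rhoH, hu]
  refine (Lp.eq_zero_iff_ae_eq_zero).2 ?_
  filter_upwards [ae_all_iff.2 hcoord] with ξ hξ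
  ext j
  simpa only [EuclideanSpace.inner_single_left, map_one, one_mul, Pi.zero_apply,
    PiLp.zero_apply] using hξ j

theorem completeSpace_flatFock (n m : ℕ) (hα : 0 < α) : CompleteSpace (flatFock n m hα) := by
  have := completeSpace_fock n m hα
  exact ((flatten n hα).isComplete_map_iff.2
    (completeSpace_coe_iff_isComplete.1 this)).completeSpace_coe

theorem RH_surjective : Function.Surjective (RH n m hα) :=
  have := completeSpace_flatFock n m hα
  surjective_of_norm_map_of_inner_eq_zero (norm_RH hα) fun _ => eq_zero_of_inner_RH_eq_zero hα

theorem flattenFock_rhoF (a : RealSpace n) (f : fock n m α) :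
    flattenFock n m hα (rhoF n m α a f) = rhoH n m hα (√α • a) (flattenFock n m hα f) := by
  have h := translation_flatten hα (√α • a) (f : Lp ℂ 2 (gaussian n α))
  rw [inv_smul_smul₀ (Real.sqrt_pos.2 hα).ne'] at h
  exact Subtype.ext h.symm

theorem RF_rhoF (a : RealSpace n) (f : fock n m α) :
    RF n m hα (rhoF n m α a f) = modulation (√α • a) (RF n m hα f) :=
  (congrArg (RH n m hα) (flattenFock_rhoF hα a f)).trans (RH_rhoH hα (√α • a) _)

theorem norm_RF (f : fock n m α) : ‖RF n m hα f‖ = ‖f‖ :=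
  (norm_RH hα _).trans ((flatten n hα).norm_map f)

theorem flattenFock_surjective : Function.Surjective (flattenFock n m hα) := by
  rintro ⟨_, f, hf, rfl⟩
  exact ⟨⟨f, hf⟩, rfl⟩

/-- `R_{H_m}` as a unitary operator. -/
def unitaryRH (n m : ℕ) (hα : 0 < α) : flatFock n m hα ≃ₗᵢ[ℂ] L2d n m :=
  .ofSurjective ⟨(RH n m hα).toLinearMap, norm_RH hα⟩ (RH_surjective hα)

/-- `R_{F_{α,m}}` as a unitary operator. -/
def unitaryRF (n m : ℕ) (hα : 0 < α) : fock n m α ≃ₗᵢ[ℂ] L2d n m :=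
  .ofSurjective ⟨(RF n m hα).toLinearMap, norm_RF hα⟩
    ((RH_surjective hα).comp (flattenFock_surjective hα))

end FlatFock

theorem dim_eq_choose (n : ℕ) {m : ℕ} (hm : 1 ≤ m) : dim n m = (n + m - 1).choose n := by
  obtain ⟨M, rfl⟩ := Nat.exists_eq_add_of_le' hm
  -- Adding the slack `M - |k|` as a zeroth entry turns `|k| ≤ M` into an exact sum, as in `Sym`.
  let e : multiIndices n (M + 1) ≃ {P : Fin (n + 1) → ℕ // ∑ i, P i = M} :=
    { toFun := fun k => ⟨Fin.cons (M - ∑ r, ofLex k.1 r) (ofLex k.1), by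
        have hk := (mem_multiIndices (ofLex k.1)).1 k.2
        rw [Fin.sum_cons]
        omega⟩
      invFun := fun P => ⟨toLex (Fin.tail P.1), (mem_multiIndices _).2 (by
        have hP := P.2
        rw [Fin.sum_univ_succ] at hP
        simp only [Fin.tail]
        omega)⟩
      left_inv := fun k => Subtype.ext (by simp)
      right_inv := fun P => Subtype.ext (by
        have hP := P.2
        rw [Fin.sum_univ_succ] at hP
        conv_rhs => rw [← Fin.cons_self_tail P.1]
        simp only [ofLex_toLex, Fin.tail]
        congr 1
        omega) }
  rw [dim, ← Fintype.card_coe, Fintype.card_congr (e.trans (Sym.equivNatSumOfFintype _ _).symm),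
    Sym.card_sym_eq_choose, Fintype.card_fin, Nat.add_right_comm, Nat.add_sub_cancel,
    ← add_assoc, Nat.add_sub_cancel, ← Nat.choose_symm_add]

end
end PolyFock

theorem mainTheorem1 (n m : ℕ) (hn : 1 ≤ n) (hm : 1 ≤ m) (α : ℝ) (hα : 0 < α) :
    PolyFock.dim n m = (n + m - 1).choose n ∧
    (∃ _ : CompleteSpace (PolyFock.flatFock n m hα),
      ∃ A : VonNeumannAlgebra (PolyFock.flatFock n m hα),
        (A : Set (PolyFock.flatFock n m hα →L[ℂ] PolyFock.flatFock n m hα)) =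
            Set.centralizer (Set.range (PolyFock.rhoH n m hα)) ∧
          ∃ Φ : PolyFock.Symbols n m ≃⋆ₐ[ℂ] A.toStarSubalgebra,
            Isometry Φ ∧
              ∀ σ : PolyFock.Symbols n m,
                (Φ σ : PolyFock.flatFock n m hα →L[ℂ] PolyFock.flatFock n m hα) =
                  PolyFock.Lam (PolyFock.RH n m hα) σ) ∧
    (∃ _ : CompleteSpace (PolyFock.fock n m α),
      ∃ A : VonNeumannAlgebra (PolyFock.fock n m α),
        (A : Set (PolyFock.fock n m α →L[ℂ] PolyFock.fock n m α)) =
            Set.centralizer (Set.range (PolyFock.rhoF n m α)) ∧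
          ∃ Φ : PolyFock.Symbols n m ≃⋆ₐ[ℂ] A.toStarSubalgebra,
            Isometry Φ ∧
              ∀ σ : PolyFock.Symbols n m,
                (Φ σ : PolyFock.fock n m α →L[ℂ] PolyFock.fock n m α) =
                  PolyFock.Lam (PolyFock.RF n m hα) σ) := by
  have hH := PolyFock.completeSpace_flatFock n m hα
  have hF := PolyFock.completeSpace_fock n m hα
  refine ⟨PolyFock.dim_eq_choose n hm, ⟨hH, ?_⟩, ⟨hF, ?_⟩⟩
  · exact PolyFock.exists_vonNeumann_starAlgEquiv (U := PolyFock.unitaryRH n m hα) one_ne_zero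
      fun a g => (PolyFock.RH_rhoH hα a g).trans (by rw [one_smul]; rfl)
  · exact PolyFock.exists_vonNeumann_starAlgEquiv (U := PolyFock.unitaryRF n m hα)
      (Real.sqrt_pos.2 hα).ne' (PolyFock.RF_rhoF hα)
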